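/- **Setting.** Let $\Bbbk$ be a commutative ring, $\Gamma$ an abelian group with a symmetric bilinear form $\langle\,,\rangle\colon\Gamma\times\Gamma\to\mathbb Z/2$, and $\iota\in\Gamma$ an element with $\langle\iota,\iota\rangle=1$. All complexes are $\Gamma$-graded $\Bbbk$-modules with a differential of degree $\iota$ and square zero; tensor products and graded maps follow the Koszul sign rule for $\langle\,,\rangle$. Let $\mathcal C$ be a dg category, that is, a category enriched in such complexes, and write $\langle X|Y\rangle=\operatorname{Hom}_{\mathcal C}(Y,X)$. A $(\mathcal C,\mathcal C)$-bimodule $M$ assigns to each pair of objects a complex $M(Y,Y')$, with associative unital left and right actions of $\mathcal C$ obeying the Leibniz rule. A bimodule map $\phi\colon M\to N$ of degree $l$ satisfies $\phi(g\cdot m\cdot g')=(-1)^{\langle l,|g|\rangle}g\cdot\phi(m)\cdot g'$ and has differential $d\circ\phi-(-1)^{\langle\iota,l\rangle}\phi\circ d$; it is closed if this vanishes, and $\phi\simeq\phi'$ means that $\phi-\phi'$ is the differential of a bimodule map. A closed map of degree $0$ is a homotopy equivalence if it has a closed degree-$0$ two-sided inverse up to $\simeq$. Bimodules form a dg monoidal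 category under $\otimes_{\mathcal C}$, with unit the bimodule $\mathcal C$, $\mathcal C(Y,Y')=\langle Y|Y'\rangle$. A *counital idempotent* is a bimodule $P$ with a closed degree-$0$ map $\varepsilon\colon P\to\mathcal C$ such that $\varepsilon\otimes\mathrm{id}_P$ and $\mathrm{id}_P\otimes\varepsilon\colon P\otimes_{\mathcal C}P\to P$ are homotopy equivalences. For counital idempotents, $(P_1,\varepsilon_1)\le(P_2,\varepsilon_2)$ means that there is a closed degree-$0$ bimodule map $\theta\colon P_1\to P_2$ with $\varepsilon_2\circ\theta\simeq\varepsilon_1$. For a set $\mathcal X$ of objects of $\mathcal C$, the bar complex $\operatorname{Bar}(\mathcal C,\mathcal X)$ is the bimodule whose underlying graded module at $(Y,Y')$ is $$\bigoplus_{r\ge0}q^{-r\iota}\bigoplus_{X_0,\dots,X_r\in\mathcal X}\langle Y|X_0\rangle\otimes_{\Bbbk}\langle X_0|X_1\rangle\otimes_{\Bbbk}\cdots\otimes_{\Bbbk}\langle X_{r-1}|X_r\rangle\otimes_{\Bbbk}\langle X_r|Y'\rangle ,$$ so that the element $[f_0,\dots,f_{r+1}]$ given by $f_0\otimes\cdots\otimes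 f_{r+1}$ has degree $\sum_i|f_i|-r\iota$. The actions are $$g\cdot[f_0,\dots,f_{r+1}]\cdot g'=(-1)^{r\langle\iota,|g|\rangle}[g f_0,f_1,\dots,f_r,f_{r+1}g'],$$ and, with $k_i=\langle\iota,|f_i|\rangle$, the differential is $$d[f_0,\dots,f_{r+1}]=\sum_{i=0}^{r+1}(-1)^{r+k_0+\cdots+k_{i-1}}[f_0,\dots,d(f_i),\dots,f_{r+1}]+\sum_{i=0}^{r}(-1)^i[f_0,\dots,f_if_{i+1},\dots,f_{r+1}],$$ where the second sum is absent for $r=0$. The counit $\varepsilon_{\mathcal X}\colon\operatorname{Bar}(\mathcal C,\mathcal X)\to\mathcal C$ sends $[f_0,f_1]$ to $f_0f_1$ and is zero on $[f_0,\dots,f_{r+1}]$ for $r>0$. **Proposition.** Let $\mathcal X\subset\mathcal Y$ be sets of objects of $\mathcal C$. 1. $(\operatorname{Bar}(\mathcal C,\mathcal X),\varepsilon_{\mathcal X})$ and $(\operatorname{Bar}(\mathcal C,\mathcal Y),\varepsilon_{\mathcal Y})$ are counital idempotents, and $\operatorname{Bar}(\mathcal C,\mathcal X)\le\operatorname{Bar}(\mathcal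 C,\mathcal Y)$. 2. If $\Xi\colon\operatorname{Bar}(\mathcal C,\mathcal Y)\to\operatorname{Bar}(\mathcal C,\mathcal X)$ is a closed degree-zero bimodule map with $\varepsilon_{\mathcal X}\circ\Xi\simeq\varepsilon_{\mathcal Y}$, then $\Xi$ is a homotopy equivalence. -/

import Mathlib

universe u v w u₁ v₁ u₂ v₂ w₁ w₂ w₃ x y

namespace DGBar

/-! ## Grading data -/

/-- The data governing gradings and signs: a symmetric bilinear form on the grading group `Γ` with
values in `ℤ/2`, and the degree `ι` of all differentials, which satisfies `⟨ι, ι⟩ = 1`. -/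
structure Grading (Γ : Type x) [AddCommGroup Γ] where
  pair : Γ →+ Γ →+ ZMod 2
  symm : ∀ i j, pair i j = pair j i
  ι : Γ
  pair_ι : pair ι ι = 1

section signs

variable {Γ : Type x} [AddCommGroup Γ] (G : Grading Γ)

/-- The Koszul sign `(-1) ^ ⟨i, j⟩`. -/
def Grading.sgn (i j : Γ) : ℤ := if G.pair i j = 0 then 1 else -1

theorem Grading.sgn_aux (a b : ZMod 2) :
    (if a + b = 0 then (1 : ℤ) else -1) = (if a = 0 then 1 else -1) * (if b = 0 then 1 else -1) := by
  revert a b; decide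

theorem Grading.sgn_add_left (i i' j : Γ) : G.sgn (i + i') j = G.sgn i j * G.sgn i' j := by
  simp only [Grading.sgn, map_add, AddMonoidHom.add_apply]; exact Grading.sgn_aux _ _

theorem Grading.sgn_add_right (i j j' : Γ) : G.sgn i (j + j') = G.sgn i j * G.sgn i j' := by
  simp only [Grading.sgn, map_add]; exact Grading.sgn_aux _ _

theorem Grading.sgn_symm (i j : Γ) : G.sgn i j = G.sgn j i := by
  simp only [Grading.sgn, G.symm i j]

@[simp] theorem Grading.sgn_zero_left (j : Γ) : G.sgn 0 j = 1 := by simp [Grading.sgn]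

@[simp] theorem Grading.sgn_zero_right (j : Γ) : G.sgn j 0 = 1 := by simp [Grading.sgn]

@[simp] theorem Grading.sgn_ι : G.sgn G.ι G.ι = -1 := by simp [Grading.sgn, G.pair_ι]

@[simp] theorem Grading.sgn_mul_self (i j : Γ) : G.sgn i j * G.sgn i j = 1 := by
  unfold Grading.sgn; split_ifs <;> rfl

@[simp] theorem Grading.sgn_neg_left (i j : Γ) : G.sgn (-i) j = G.sgn i j := by
  have h : ∀ a : ZMod 2, -a = a := by decide
  simp only [Grading.sgn, map_neg, AddMonoidHom.neg_apply, h]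

end signs

/-! ## Differential graded modules -/

/-- A differential `Γ`-graded `k`-module: a `k`-module which is the internal direct sum of its
homogeneous components `gr i`, with a differential of degree `ι`. -/
structure DGMod {Γ : Type x} [AddCommGroup Γ] (G : Grading Γ) (k : Type y) [CommRing k] where
  carrier : Type w
  [addCommGroup : AddCommGroup carrier]
  [module : Module k carrier]
  gr : Γ → Submodule k carrier
  indep : iSupIndep gr
  span : iSup gr = ⊤
  d : carrier →ₗ[k] carrier
  d_mem : ∀ {i : Γ} {m : carrier}, m ∈ gr i → d m ∈ gr (i + G.ι)
  d_d : ∀ m, d (d m) = 0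

attribute [instance] DGMod.addCommGroup DGMod.module

instance {Γ : Type x} [AddCommGroup Γ] {G : Grading Γ} {k : Type y} [CommRing k] :
    CoeSort (DGMod.{w} G k) (Type w) := ⟨DGMod.carrier⟩

namespace DGMod

variable {Γ : Type x} [AddCommGroup Γ] {G : Grading Γ} {k : Type y} [CommRing k]

theorem indep_of_proj {Γ : Type x} {k : Type y} [CommRing k] {M : Type w} [AddCommGroup M]
    [Module k M] (gr : Γ → Submodule k M)
    (p : M →ₗ[k] Γ →₀ M) (hp : ∀ i, ∀ m ∈ gr i, p m = Finsupp.single i m) : iSupIndep gr := by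
  intro i
  rw [Submodule.disjoint_def]
  intro m hm hm'
  have h1 : (⨆ (j) (_ : j ≠ i), gr j) ≤ LinearMap.ker (Finsupp.lapply i ∘ₗ p) := by
    refine iSup₂_le fun j hj m hm => ?_
    simp [hp j m hm, hj]
  have h2 := h1 hm'
  simpa [hp i m hm] using h2

theorem ind (M : DGMod.{w} G k) {P : M → Prop} (homog : ∀ i, ∀ m ∈ M.gr i, P m)
    (add : ∀ m n, P m → P n → P (m + n)) (m : M) : P m := by
  have hm : m ∈ iSup M.gr := by rw [M.span]; trivial
  exact Submodule.iSup_induction _ (motive := P) hm homog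
    (homog 0 0 (Submodule.zero_mem _)) add

/-- The map sending `m` to the family of its homogeneous components. -/
noncomputable def decomp (M : DGMod.{w} G k) : M →ₗ[k] Γ →₀ M :=
  letI : DecidableEq Γ := Classical.decEq Γ
  DirectSum.toModule k Γ _ (fun i => Finsupp.lsingle i ∘ₗ (M.gr i).subtype) ∘ₗ
    (LinearEquiv.ofBijective (DirectSum.coeLinearMap M.gr)
      ((DirectSum.isInternal_submodule_iff_iSupIndep_and_iSup_eq_top M.gr).2
        ⟨M.indep, M.span⟩)).symm.toLinearMap

theorem decomp_of_mem (M : DGMod.{w} G k) {i : Γ} {m : M} (hm : m ∈ M.gr i) :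
    M.decomp m = Finsupp.single i m := by
  let _ : DecidableEq Γ := Classical.decEq Γ
  have hB : Function.Bijective (DirectSum.coeLinearMap M.gr) :=
    ((DirectSum.isInternal_submodule_iff_iSupIndep_and_iSup_eq_top M.gr).2 ⟨M.indep, M.span⟩)
  have h : (LinearEquiv.ofBijective (DirectSum.coeLinearMap M.gr) hB).symm m =
      DirectSum.lof k Γ (fun i => M.gr i) i ⟨m, hm⟩ := by
    rw [LinearEquiv.symm_apply_eq]
    simp
  simp only [decomp, LinearMap.comp_apply, LinearEquiv.coe_coe]
  erw [h]
  simp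

/-- The linear map which is given by `φ i` on the component of degree `i`. -/
noncomputable def glue (M : DGMod.{w} G k) {N : Type w₁} [AddCommGroup N] [Module k N]
    (φ : Γ → M →ₗ[k] N) : M →ₗ[k] N :=
  Finsupp.lsum ℕ φ ∘ₗ M.decomp

theorem glue_of_mem (M : DGMod.{w} G k) {N : Type w₁} [AddCommGroup N] [Module k N]
    (φ : Γ → M →ₗ[k] N) {i : Γ} {m : M} (hm : m ∈ M.gr i) : M.glue φ m = φ i m := by
  simp [glue, M.decomp_of_mem hm]

/-- The linear map which multiplies `m` by `(-1) ^ ⟨j, |m|⟩`. -/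
noncomputable def par (M : DGMod.{w} G k) (j : Γ) : M →ₗ[k] M :=
  M.glue fun i => G.sgn j i • LinearMap.id

theorem par_of_mem (M : DGMod.{w} G k) (j : Γ) {i : Γ} {m : M} (hm : m ∈ M.gr i) :
    M.par j m = G.sgn j i • m := by
  simp [par, M.glue_of_mem _ hm]

theorem par_mem (M : DGMod.{w} G k) (j : Γ) {i : Γ} {m : M} (hm : m ∈ M.gr i) :
    M.par j m ∈ M.gr i := by
  rw [M.par_of_mem j hm]; exact zsmul_mem hm _

theorem d_par (M : DGMod.{w} G k) (j : Γ) (m : M) :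
    M.d (M.par j m) = G.sgn j G.ι • M.par j (M.d m) := by
  induction m using M.ind with
  | homog i m hm =>
    rw [M.par_of_mem j hm, M.par_of_mem j (M.d_mem hm), map_zsmul, smul_smul, G.sgn_add_right,
      mul_comm, mul_assoc, G.sgn_mul_self, mul_one]
  | add m n hm hn => simp only [map_add, hm, hn, smul_add]

/-! ### Tensor products -/

/-- The tensor product of dg modules, with differential
`d (m ⊗ n) = d m ⊗ n + (-1) ^ ⟨ι, |m|⟩ m ⊗ d n`. -/
noncomputable def tensor (M : DGMod.{w₁} G k) (N : DGMod.{w₂} G k) : DGMod.{max w₁ w₂} G k where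
  carrier := TensorProduct k M N
  gr n := Submodule.span k {t | ∃ i j, i + j = n ∧ ∃ a ∈ M.gr i, ∃ b ∈ N.gr j,
    t = TensorProduct.tmul k a b}
  indep := by
    refine indep_of_proj _ (TensorProduct.lift (M.glue fun i => (N.glue fun j =>
      ((TensorProduct.mk k M N).compr₂ (Finsupp.lsingle (i + j))).flip).flip)) ?_
    intro n t ht
    induction ht using Submodule.span_induction with
    | mem t ht =>
      obtain ⟨i, j, rfl, a, ha, b, hb, rfl⟩ := ht
      simp [M.glue_of_mem _ ha, N.glue_of_mem _ hb]
    | zero => simp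
    | add s t _ _ hs ht => rw [map_add, hs, ht, Finsupp.single_add]
    | smul c t _ ht => rw [map_smul, ht, Finsupp.smul_single]
  span := by
    rw [eq_top_iff]
    refine fun t _ => ?_
    clear * -
    induction t using TensorProduct.induction_on with
    | zero => exact Submodule.zero_mem _
    | add s t hs ht => exact Submodule.add_mem _ hs ht
    | tmul a b =>
      induction a using M.ind with
      | add a a' h h' => rw [TensorProduct.add_tmul]; exact Submodule.add_mem _ h h'
      | homog i a ha =>
        induction b using N.ind with
        | add b b' h h' => rw [TensorProduct.tmul_add]; exact Submodule.add_mem _ h h'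
        | homog j b hb =>
          exact Submodule.mem_iSup_of_mem (i + j)
            (Submodule.subset_span ⟨i, j, rfl, a, ha, b, hb, rfl⟩)
  d := TensorProduct.map M.d LinearMap.id + TensorProduct.map (M.par G.ι) N.d
  d_mem := by
    intro n t ht
    induction ht using Submodule.span_induction with
    | mem t ht =>
      obtain ⟨i, j, rfl, a, ha, b, hb, rfl⟩ := ht
      refine Submodule.add_mem _ (Submodule.subset_span
        ⟨i + G.ι, j, by abel, _, M.d_mem ha, _, hb, rfl⟩) (Submodule.subset_span
        ⟨i, j + G.ι, by abel, _, M.par_mem _ ha, _, N.d_mem hb, rfl⟩)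
    | zero => rw [map_zero]; exact Submodule.zero_mem _
    | add s t _ _ hs ht => rw [map_add]; exact Submodule.add_mem _ hs ht
    | smul c t _ ht => rw [map_smul]; exact Submodule.smul_mem _ _ ht
  d_d := by
    intro t
    induction t using TensorProduct.induction_on with
    | zero => simp
    | add s t hs ht => rw [map_add, map_add, hs, ht, add_zero]
    | tmul a b =>
      simp [M.d_d, N.d_d, M.d_par, TensorProduct.neg_tmul]

section tensorAPI

variable {M : DGMod.{w₁} G k} {N : DGMod.{w₂} G k}

/-- The pure tensor `m ⊗ n`. -/
noncomputable def tmul : M →ₗ[k] N →ₗ[k] tensor M N := TensorProduct.mk k M N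

/-- The linear map out of a tensor product given by a bilinear map. -/
noncomputable def tlift {Q : Type w₃} [AddCommGroup Q] [Module k Q] (φ : M →ₗ[k] N →ₗ[k] Q) :
    tensor M N →ₗ[k] Q := TensorProduct.lift φ

@[simp] theorem tlift_tmul {Q : Type w₃} [AddCommGroup Q] [Module k Q] (φ : M →ₗ[k] N →ₗ[k] Q)
    (m : M) (n : N) : tlift φ (tmul m n) = φ m n := TensorProduct.lift.tmul m n

theorem tensor_gr (n : Γ) : (tensor M N).gr n = Submodule.span k
    {t | ∃ i j, i + j = n ∧ ∃ a ∈ M.gr i, ∃ b ∈ N.gr j, t = tmul a b} := rfl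

theorem tensor_ind {P : tensor M N → Prop}
    (tmul : ∀ i, ∀ m ∈ M.gr i, ∀ j, ∀ n ∈ N.gr j, P (tmul m n))
    (add : ∀ s t, P s → P t → P (s + t)) (t : tensor M N) : P t := by
  refine (tensor M N).ind (P := P) (fun n t ht => ?_) add t
  rw [tensor_gr] at ht
  have key : ∀ c : k, P (c • t) := by
    induction ht using Submodule.span_induction with
    | mem t ht =>
      obtain ⟨i, j, rfl, a, ha, b, hb, rfl⟩ := ht
      intro c
      have := tmul i (c • a) (Submodule.smul_mem _ _ ha) j b hb
      rwa [map_smul, LinearMap.smul_apply] at this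
    | zero =>
      intro c
      have := tmul 0 0 (Submodule.zero_mem _) 0 0 (Submodule.zero_mem _)
      simpa using this
    | add s t _ _ hs ht =>
      intro c
      rw [smul_add]; exact add _ _ (hs c) (ht c)
    | smul a t _ ht =>
      intro c
      rw [smul_smul]; exact ht _
  simpa using key 1

theorem tmul_mem {i j : Γ} {m : M} {n : N} (hm : m ∈ M.gr i) (hn : n ∈ N.gr j) :
    tmul m n ∈ (tensor M N).gr (i + j) := by
  rw [tensor_gr]
  exact Submodule.subset_span ⟨i, j, rfl, m, hm, n, hn, rfl⟩

theorem tensor_gr_map {Q : Type w₃} [AddCommGroup Q] [Module k Q] (φ : tensor M N →ₗ[k] Q)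
    (S : Submodule k Q) {n : Γ}
    (h : ∀ i j, i + j = n → ∀ a ∈ M.gr i, ∀ b ∈ N.gr j, φ (tmul a b) ∈ S)
    {t : tensor M N} (ht : t ∈ (tensor M N).gr n) : φ t ∈ S := by
  rw [tensor_gr] at ht
  refine (Submodule.span_le (p := S.comap φ)).2 ?_ ht
  rintro _ ⟨i, j, hij, a, ha, b, hb, rfl⟩
  exact h i j hij a ha b hb

@[simp] theorem d_tmul (m : M) (n : N) :
    (tensor M N).d (tmul m n) = tmul (M.d m) n + tmul (M.par G.ι m) (N.d n) := rfl

@[simp] theorem par_tmul (j : Γ) (m : M) (n : N) :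
    (tensor M N).par j (tmul m n) = tmul (M.par j m) (N.par j n) := by
  induction m using M.ind with
  | add m m' h h' => simp only [map_add, LinearMap.add_apply, h, h']
  | homog i m hm =>
    induction n using N.ind with
    | add n n' h h' => simp only [map_add, h, h']
    | homog i' n hn =>
      rw [par_of_mem _ _ (tmul_mem hm hn), par_of_mem _ _ hm, par_of_mem _ _ hn]
      simp [G.sgn_add_right, mul_smul]

/-- `h · (m ⊗ n) = μ h m ⊗ n`. -/
noncomputable def onLeft {H : Type w₃} [AddCommGroup H] [Module k H] {M' : DGMod.{v₁} G k}
    (μ : H →ₗ[k] M →ₗ[k] M') : H →ₗ[k] tensor M N →ₗ[k] tensor M' N :=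
  LinearMap.flip (tlift (LinearMap.mk₂ k (fun m n => (tmul.flip n) ∘ₗ (μ.flip m))
    (by intros; ext; simp) (by intros; ext; simp) (by intros; ext; simp) (by intros; ext; simp)))

@[simp] theorem onLeft_tmul {H : Type w₃} [AddCommGroup H] [Module k H] {M' : DGMod.{v₁} G k}
    (μ : H →ₗ[k] M →ₗ[k] M') (h : H) (m : M) (n : N) :
    onLeft μ h (tmul m n) = tmul (μ h m) n := by simp [onLeft]

/-- `(m ⊗ n) · h = m ⊗ μ n h`. -/
noncomputable def onRight {H : Type w₃} [AddCommGroup H] [Module k H] {N' : DGMod.{v₁} G k}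
    (μ : N →ₗ[k] H →ₗ[k] N') : tensor M N →ₗ[k] H →ₗ[k] tensor M N' :=
  tlift (LinearMap.mk₂ k (fun m n => (tmul m) ∘ₗ (μ n))
    (by intros; ext; simp) (by intros; ext; simp) (by intros; ext; simp) (by intros; ext; simp))

@[simp] theorem onRight_tmul {H : Type w₃} [AddCommGroup H] [Module k H] {N' : DGMod.{v₁} G k}
    (μ : N →ₗ[k] H →ₗ[k] N') (h : H) (m : M) (n : N) :
    onRight μ (tmul m n) h = tmul m (μ n h) := by simp [onRight]

end tensorAPI

/-! ### Direct sums -/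

open Classical in
/-- The direct sum of a family of dg modules. -/
noncomputable def directSum {A : Type u} (M : A → DGMod.{w} G k) : DGMod.{max u w} G k where
  carrier := DirectSum A fun a => M a
  gr n := ⨆ a, ((M a).gr n).map (DirectSum.lof k A (fun a => (M a : Type w)) a)
  indep := by
    refine indep_of_proj _ (DirectSum.toModule k A _ fun a =>
      (Finsupp.mapRange.linearMap (DirectSum.lof k A (fun a => (M a : Type w)) a)) ∘ₗ
        (M a).decomp) ?_
    intro n t ht
    refine Submodule.iSup_induction _ (motive := fun t => _ = Finsupp.single n t) ht ?_ ?_ ?_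
    · rintro a _ ⟨m, hm, rfl⟩
      simp [(M a).decomp_of_mem hm]
    · simp
    · intro s t hs ht
      rw [map_add, hs, ht, Finsupp.single_add]
  span := by
    rw [eq_top_iff]
    refine fun t _ => ?_
    clear * -
    induction t using DirectSum.induction_on with
    | zero => exact Submodule.zero_mem _
    | add s t hs ht => exact Submodule.add_mem _ hs ht
    | of a m =>
      induction m using (M a).ind with
      | add m m' h h' => rw [map_add]; exact Submodule.add_mem _ h h'
      | homog i m hm =>
        exact Submodule.mem_iSup_of_mem i (Submodule.mem_iSup_of_mem a ⟨m, hm, rfl⟩)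
  d := DirectSum.lmap fun a => (M a).d
  d_mem := by
    intro n t ht
    refine Submodule.iSup_induction _ (motive := fun t => DirectSum.lmap _ t ∈ _) ht ?_ ?_ ?_
    · rintro a _ ⟨m, hm, rfl⟩
      rw [DirectSum.lmap_lof]
      exact Submodule.mem_iSup_of_mem a ⟨_, (M a).d_mem hm, rfl⟩
    · rw [map_zero]; exact Submodule.zero_mem _
    · intro s t hs ht
      rw [map_add]; exact Submodule.add_mem _ hs ht
  d_d := by
    intro t
    induction t using DirectSum.induction_on with
    | zero => simp
    | add s t hs ht => rw [map_add, map_add, hs, ht, add_zero]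
    | of a m =>
      change DirectSum.lmap _ (DirectSum.lmap _ (DirectSum.lof k A (fun a => (M a : Type w)) a m)) = 0
      rw [DirectSum.lmap_lof, DirectSum.lmap_lof, (M a).d_d, map_zero]

section directSumAPI

variable {A : Type u} {M : A → DGMod.{w} G k}

open Classical in
/-- The inclusion of a summand. -/
noncomputable def incl (a : A) : M a →ₗ[k] directSum M :=
  DirectSum.lof k A (fun a => (M a : Type w)) a

theorem directSum_gr (n : Γ) : (directSum M).gr n = ⨆ a, ((M a).gr n).map (incl a) := rfl

open Classical in
/-- The linear map out of a direct sum given by a family of linear maps. -/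
noncomputable def desc {Q : Type w₃} [AddCommGroup Q] [Module k Q] (φ : ∀ a, M a →ₗ[k] Q) :
    directSum M →ₗ[k] Q := DirectSum.toModule k A Q φ

@[simp] theorem desc_incl {Q : Type w₃} [AddCommGroup Q] [Module k Q] (φ : ∀ a, M a →ₗ[k] Q)
    (a : A) (m : M a) : desc φ (incl a m) = φ a m := by
  classical exact DirectSum.toModule_lof (M := fun a => (M a : Type w)) k a m

theorem directSum_ind {P : directSum M → Prop} (zero : P 0) (incl : ∀ a m, P (incl a m))
    (add : ∀ s t, P s → P t → P (s + t)) (t : directSum M) : P t := by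
  classical exact DirectSum.induction_on t zero incl add

theorem incl_mem {n : Γ} {a : A} {m : M a} (hm : m ∈ (M a).gr n) :
    incl a m ∈ (directSum M).gr n := by
  rw [directSum_gr]
  exact Submodule.mem_iSup_of_mem a ⟨m, hm, rfl⟩

theorem directSum_gr_map {Q : Type w₃} [AddCommGroup Q] [Module k Q] (φ : directSum M →ₗ[k] Q)
    (S : Submodule k Q) {n : Γ} (h : ∀ a, ∀ m ∈ (M a).gr n, φ (incl a m) ∈ S)
    {t : directSum M} (ht : t ∈ (directSum M).gr n) : φ t ∈ S := by
  rw [directSum_gr] at ht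
  have : (⨆ a, ((M a).gr n).map (incl (M := M) a)) ≤ S.comap φ := by
    refine iSup_le fun a => ?_
    rintro _ ⟨m, hm, rfl⟩
    exact h a m hm
  exact this ht

@[simp] theorem d_incl (a : A) (m : M a) : (directSum M).d (incl a m) = incl a ((M a).d m) := by
  classical exact DirectSum.lmap_lof (fun a => (M a).d) a m

@[simp] theorem par_incl (j : Γ) (a : A) (m : M a) :
    (directSum M).par j (incl a m) = incl a ((M a).par j m) := by
  induction m using (M a).ind with
  | add m m' h h' => simp only [map_add, h, h']
  | homog i m hm => rw [par_of_mem _ _ (incl_mem hm), par_of_mem _ _ hm, map_zsmul]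

/-- `h · (m_a) = (μ a h m_a)`. -/
noncomputable def sumLeft {H : Type w₃} [AddCommGroup H] [Module k H] {M' : A → DGMod.{v₁} G k}
    (μ : ∀ a, H →ₗ[k] M a →ₗ[k] M' a) : H →ₗ[k] directSum M →ₗ[k] directSum M' :=
  LinearMap.flip (desc fun a => LinearMap.flip ((μ a).compr₂ (incl a)))

@[simp] theorem sumLeft_incl {H : Type w₃} [AddCommGroup H] [Module k H] {M' : A → DGMod.{v₁} G k}
    (μ : ∀ a, H →ₗ[k] M a →ₗ[k] M' a) (h : H) (a : A) (m : M a) :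
    sumLeft μ h (incl a m) = incl a (μ a h m) := by simp [sumLeft]

/-- `(m_a) · h = (μ a m_a h)`. -/
noncomputable def sumRight {H : Type w₃} [AddCommGroup H] [Module k H] {M' : A → DGMod.{v₁} G k}
    (μ : ∀ a, M a →ₗ[k] H →ₗ[k] M' a) : directSum M →ₗ[k] H →ₗ[k] directSum M' :=
  desc fun a => (μ a).compr₂ (incl a)

@[simp] theorem sumRight_incl {H : Type w₃} [AddCommGroup H] [Module k H]
    {M' : A → DGMod.{v₁} G k} (μ : ∀ a, M a →ₗ[k] H →ₗ[k] M' a) (h : H) (a : A) (m : M a) :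
    sumRight μ (incl a m) h = incl a (μ a m h) := by simp [sumRight]

end directSumAPI

/-! ### Shifts -/

/-- The shift `q ^ j M`: its component of degree `i` is that of `M` in degree `i - j`, and the
differential is multiplied by `(-1) ^ ⟨j, ι⟩`. -/
def shift (j : Γ) (M : DGMod.{w} G k) : DGMod.{w} G k where
  carrier := M
  gr i := M.gr (i - j)
  indep := M.indep.comp (sub_left_injective (b := j))
  span := by
    rw [← M.span]
    exact (Equiv.subRight j).iSup_comp (g := M.gr)
  d := G.sgn j G.ι • M.d
  d_mem := by
    intro i m hm
    have := zsmul_mem (M.d_mem hm) (G.sgn j G.ι)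
    rwa [sub_add_eq_add_sub] at this
  d_d := by
    intro m
    simp [M.d_d]

/-- The identity map `M → q ^ j M` (of degree `j`). -/
def toShift (j : Γ) (M : DGMod.{w} G k) : M ≃ₗ[k] shift j M := LinearEquiv.refl k M

theorem toShift_mem {j : Γ} {M : DGMod.{w} G k} {i : Γ} {m : M} :
    toShift j M m ∈ (shift j M).gr i ↔ m ∈ M.gr (i - j) := Iff.rfl

@[simp] theorem d_toShift (j : Γ) (M : DGMod.{w} G k) (m : M) :
    (shift j M).d (toShift j M m) = G.sgn j G.ι • toShift j M (M.d m) := rfl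

@[simp] theorem par_toShift (l j : Γ) (M : DGMod.{w} G k) (m : M) :
    (shift j M).par l (toShift j M m) = G.sgn l j • toShift j M (M.par l m) := by
  induction m using M.ind with
  | add m m' h h' => simp only [map_add, smul_add, h, h']
  | homog i m hm =>
    have : toShift j M m ∈ (shift j M).gr (i + j) := by
      rw [toShift_mem, add_sub_cancel_right]; exact hm
    rw [par_of_mem _ _ this, par_of_mem _ _ hm, map_zsmul, smul_smul, G.sgn_add_right, mul_comm]

/-! ### Twists -/

/-- The twist of a dg module by a Maurer--Cartan endomorphism `α` of degree `ι`: the differential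
becomes `d + α`. -/
def twist (M : DGMod.{w} G k) (α : M →ₗ[k] M) (hα : ∀ {i m}, m ∈ M.gr i → α m ∈ M.gr (i + G.ι))
    (mc : ∀ m, M.d (α m) + α (M.d m) + α (α m) = 0) : DGMod.{w} G k where
  carrier := M
  gr := M.gr
  indep := M.indep
  span := M.span
  d := M.d + α
  d_mem hm := Submodule.add_mem _ (M.d_mem hm) (hα hm)
  d_d m := by
    have := mc m
    simp only [LinearMap.add_apply, map_add, M.d_d, zero_add]
    rw [← this]; abel

/-- The identity map from a dg module to a twist of it. -/
def toTwist (M : DGMod.{w} G k) (α : M →ₗ[k] M) (hα : ∀ {i m}, m ∈ M.gr i → α m ∈ M.gr (i + G.ι))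
    (mc : ∀ m, M.d (α m) + α (M.d m) + α (α m) = 0) : M ≃ₗ[k] twist M α hα mc :=
  LinearEquiv.refl k M

/-! ### Quotients -/

/-- The quotient of a dg module by the submodule spanned by a set of homogeneous elements. -/
noncomputable def quot (M : DGMod.{w} G k) (T : Set M) (hT : ∀ t ∈ T, ∃ i, t ∈ M.gr i)
    (hd : ∀ t ∈ T, M.d t ∈ Submodule.span k T) : DGMod.{w} G k where
  carrier := M ⧸ Submodule.span k T
  gr i := (M.gr i).map (Submodule.span k T).mkQ
  indep := by
    refine indep_of_proj _ ((Submodule.span k T).liftQ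
      (Finsupp.mapRange.linearMap (Submodule.span k T).mkQ ∘ₗ M.decomp) ?_) ?_
    · rw [Submodule.span_le]
      intro t ht
      obtain ⟨i, hi⟩ := hT t ht
      have : (Submodule.span k T).mkQ t = 0 := by
        simpa using Submodule.subset_span ht
      simp [M.decomp_of_mem hi]
      simpa using this
    · rintro i _ ⟨m, hm, rfl⟩
      simp [M.decomp_of_mem hm]
  span := by
    rw [← Submodule.map_iSup, M.span, Submodule.map_top, Submodule.range_mkQ]
  d := (Submodule.span k T).mapQ (Submodule.span k T) M.d (Submodule.span_le.2 hd)
  d_mem := by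
    rintro i _ ⟨m, hm, rfl⟩
    exact ⟨_, M.d_mem hm, rfl⟩
  d_d := by
    intro m
    obtain ⟨m, rfl⟩ := (Submodule.span k T).mkQ_surjective m
    simp [M.d_d]

section quotAPI

variable {M : DGMod.{w} G k} {T : Set M} {hT : ∀ t ∈ T, ∃ i, t ∈ M.gr i}
  {hd : ∀ t ∈ T, M.d t ∈ Submodule.span k T}

/-- The quotient map. -/
noncomputable def proj : M →ₗ[k] quot M T hT hd := (Submodule.span k T).mkQ

theorem proj_surjective : Function.Surjective (proj (hT := hT) (hd := hd)) :=
  (Submodule.span k T).mkQ_surjective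

theorem proj_of_mem {t : M} (ht : t ∈ Submodule.span k T) :
    proj (hT := hT) (hd := hd) t = 0 :=
  (Submodule.Quotient.mk_eq_zero _).2 ht

/-- The linear map out of a quotient given by a linear map which vanishes on the relations. -/
noncomputable def qdesc {Q : Type w₃} [AddCommGroup Q] [Module k Q] (φ : M →ₗ[k] Q)
    (h : ∀ t ∈ T, φ t = 0) : quot M T hT hd →ₗ[k] Q :=
  (Submodule.span k T).liftQ φ (Submodule.span_le.2 h)

@[simp] theorem qdesc_proj {Q : Type w₃} [AddCommGroup Q] [Module k Q] (φ : M →ₗ[k] Q)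
    (h : ∀ t ∈ T, φ t = 0) (m : M) :
    qdesc φ h (proj (hT := hT) (hd := hd) m) = φ m := rfl

theorem proj_mem {n : Γ} {m : M} (hm : m ∈ M.gr n) :
    proj m ∈ (quot M T hT hd).gr n := ⟨m, hm, rfl⟩

@[simp] theorem d_proj (m : M) : (quot M T hT hd).d (proj m) = proj (M.d m) := rfl

@[simp] theorem par_proj (j : Γ) (m : M) : (quot M T hT hd).par j (proj m) = proj (M.par j m) := by
  induction m using M.ind with
  | add m m' h h' => simp only [map_add, h, h']
  | homog i m hm => rw [par_of_mem _ _ (proj_mem hm), par_of_mem _ _ hm, map_zsmul]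

end quotAPI

end DGMod

/-! ## Differential graded categories -/

/-- A dg category. The hom complex `Hom X Y` is `⟨X|C|Y⟩ = Hom_C(Y, X)`, so that composition is a
map `⟨X|C|Y⟩ ⊗ ⟨Y|C|Z⟩ → ⟨X|C|Z⟩`. -/
structure DGCat {Γ : Type x} [AddCommGroup Γ] (G : Grading Γ) (k : Type y) [CommRing k] where
  Obj : Type u
  Hom : Obj → Obj → DGMod.{v} G k
  id : ∀ X, Hom X X
  comp : ∀ {X Y Z}, Hom X Y →ₗ[k] Hom Y Z →ₗ[k] Hom X Z
  id_mem : ∀ X, id X ∈ (Hom X X).gr 0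
  comp_mem : ∀ {X Y Z} {i j : Γ} {f : Hom X Y} {g : Hom Y Z},
    f ∈ (Hom X Y).gr i → g ∈ (Hom Y Z).gr j → comp f g ∈ (Hom X Z).gr (i + j)
  d_comp : ∀ {X Y Z} {i : Γ} {f : Hom X Y} (g : Hom Y Z), f ∈ (Hom X Y).gr i →
    (Hom X Z).d (comp f g) = comp ((Hom X Y).d f) g + G.sgn G.ι i • comp f ((Hom Y Z).d g)
  id_comp : ∀ {X Y} (f : Hom X Y), comp (id X) f = f
  comp_id : ∀ {X Y} (f : Hom X Y), comp f (id Y) = f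
  assoc : ∀ {W X Y Z} (f : Hom W X) (g : Hom X Y) (h : Hom Y Z),
    comp (comp f g) h = comp f (comp g h)

section

variable {Γ : Type x} [AddCommGroup Γ] {G : Grading Γ} {k : Type y} [CommRing k]

/-! ## Bimodules -/

/-- A dg `(C, D)`-bimodule: dg modules `⟨X|M|Y⟩` with commuting left and right actions
`⟨X'|C|X⟩ ⊗ ⟨X|M|Y⟩ → ⟨X'|M|Y⟩` and `⟨X|M|Y⟩ ⊗ ⟨Y|D|Y'⟩ → ⟨X|M|Y'⟩` which are degree zero chain
maps. -/
structure Bimod (C : DGCat.{u₁, v₁} G k) (D : DGCat.{u₂, v₂} G k) where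
  obj : C.Obj → D.Obj → DGMod.{w} G k
  actL : ∀ {X' X Y}, C.Hom X' X →ₗ[k] obj X Y →ₗ[k] obj X' Y
  actR : ∀ {X Y Y'}, obj X Y →ₗ[k] D.Hom Y Y' →ₗ[k] obj X Y'
  actL_mem : ∀ {X' X Y} {i j : Γ} {f : C.Hom X' X} {m : obj X Y},
    f ∈ (C.Hom X' X).gr i → m ∈ (obj X Y).gr j → actL f m ∈ (obj X' Y).gr (i + j)
  actR_mem : ∀ {X Y Y'} {i j : Γ} {m : obj X Y} {g : D.Hom Y Y'},
    m ∈ (obj X Y).gr i → g ∈ (D.Hom Y Y').gr j → actR m g ∈ (obj X Y').gr (i + j)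
  d_actL : ∀ {X' X Y} {i : Γ} {f : C.Hom X' X} (m : obj X Y), f ∈ (C.Hom X' X).gr i →
    (obj X' Y).d (actL f m) =
      actL ((C.Hom X' X).d f) m + G.sgn G.ι i • actL f ((obj X Y).d m)
  d_actR : ∀ {X Y Y'} {i : Γ} {m : obj X Y} (g : D.Hom Y Y'), m ∈ (obj X Y).gr i →
    (obj X Y').d (actR m g) =
      actR ((obj X Y).d m) g + G.sgn G.ι i • actR m ((D.Hom Y Y').d g)
  id_actL : ∀ {X Y} (m : obj X Y), actL (C.id X) m = m
  actR_id : ∀ {X Y} (m : obj X Y), actR m (D.id Y) = m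
  comp_actL : ∀ {X'' X' X Y} (f : C.Hom X'' X') (f' : C.Hom X' X) (m : obj X Y),
    actL (C.comp f f') m = actL f (actL f' m)
  actR_comp : ∀ {X Y Y' Y''} (m : obj X Y) (g : D.Hom Y Y') (g' : D.Hom Y' Y''),
    actR m (D.comp g g') = actR (actR m g) g'
  actL_actR : ∀ {X' X Y Y'} (f : C.Hom X' X) (m : obj X Y) (g : D.Hom Y Y'),
    actR (actL f m) g = actL f (actR m g)

variable {C : DGCat.{u₁, v₁} G k} {D : DGCat.{u₂, v₂} G k}

namespace DGCat

theorem d_comp_par (C : DGCat.{u₁, v₁} G k) {X Y Z} (f : C.Hom X Y) (g : C.Hom Y Z) :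
    (C.Hom X Z).d (C.comp f g) =
      C.comp ((C.Hom X Y).d f) g + C.comp ((C.Hom X Y).par G.ι f) ((C.Hom Y Z).d g) := by
  induction f using (C.Hom X Y).ind with
  | add f f' h h' => simp only [map_add, LinearMap.add_apply, h, h']; abel
  | homog i f hf => rw [C.d_comp g hf, DGMod.par_of_mem _ _ hf]; simp

theorem par_comp (C : DGCat.{u₁, v₁} G k) (l : Γ) {X Y Z} (f : C.Hom X Y) (g : C.Hom Y Z) :
    (C.Hom X Z).par l (C.comp f g) = C.comp ((C.Hom X Y).par l f) ((C.Hom Y Z).par l g) := by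
  induction f using (C.Hom X Y).ind with
  | add f f' h h' => simp only [map_add, LinearMap.add_apply, h, h']
  | homog i f hf =>
    induction g using (C.Hom Y Z).ind with
    | add g g' h h' => simp only [map_add, h, h']
    | homog j g hg =>
      rw [DGMod.par_of_mem _ _ hf, DGMod.par_of_mem _ _ hg, DGMod.par_of_mem _ _ (C.comp_mem hf hg)]
      simp [G.sgn_add_right, mul_smul]

end DGCat

namespace Bimod

theorem d_actR_par (M : Bimod.{w} C D) {X Y Y'} (m : M.obj X Y) (g : D.Hom Y Y') :
    (M.obj X Y').d (M.actR m g) = M.actR ((M.obj X Y).d m) g +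
      M.actR ((M.obj X Y).par G.ι m) ((D.Hom Y Y').d g) := by
  induction m using (M.obj X Y).ind with
  | add f f' h h' => simp only [map_add, LinearMap.add_apply, h, h']; abel
  | homog i f hf => rw [M.d_actR g hf, DGMod.par_of_mem _ _ hf]; simp

theorem d_actL_par (M : Bimod.{w} C D) {X' X Y} (f : C.Hom X' X) (m : M.obj X Y) :
    (M.obj X' Y).d (M.actL f m) = M.actL ((C.Hom X' X).d f) m +
      M.actL ((C.Hom X' X).par G.ι f) ((M.obj X Y).d m) := by
  induction f using (C.Hom X' X).ind with
  | add f f' h h' => simp only [map_add, LinearMap.add_apply, h, h']; abel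
  | homog i f hf => rw [M.d_actL m hf, DGMod.par_of_mem _ _ hf]; simp

theorem par_actR (M : Bimod.{w} C D) (l : Γ) {X Y Y'} (m : M.obj X Y) (g : D.Hom Y Y') :
    (M.obj X Y').par l (M.actR m g) = M.actR ((M.obj X Y).par l m) ((D.Hom Y Y').par l g) := by
  induction m using (M.obj X Y).ind with
  | add f f' h h' => simp only [map_add, LinearMap.add_apply, h, h']
  | homog i f hf =>
    induction g using (D.Hom Y Y').ind with
    | add g g' h h' => simp only [map_add, h, h']
    | homog j g hg =>
      rw [DGMod.par_of_mem _ _ hf, DGMod.par_of_mem _ _ hg, DGMod.par_of_mem _ _ (M.actR_mem hf hg)]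
      simp [G.sgn_add_right, mul_smul]

theorem par_actL (M : Bimod.{w} C D) (l : Γ) {X' X Y} (f : C.Hom X' X) (m : M.obj X Y) :
    (M.obj X' Y).par l (M.actL f m) = M.actL ((C.Hom X' X).par l f) ((M.obj X Y).par l m) := by
  induction f using (C.Hom X' X).ind with
  | add f f' h h' => simp only [map_add, LinearMap.add_apply, h, h']
  | homog i f hf =>
    induction m using (M.obj X Y).ind with
    | add g g' h h' => simp only [map_add, h, h']
    | homog j g hg =>
      rw [DGMod.par_of_mem _ _ hf, DGMod.par_of_mem _ _ hg, DGMod.par_of_mem _ _ (M.actL_mem hf hg)]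
      simp [G.sgn_add_right, mul_smul]

/-- The identity bimodule of `C`. -/
def unit (C : DGCat.{u₁, v₁} G k) : Bimod.{v₁} C C where
  obj := C.Hom
  actL := C.comp
  actR := C.comp
  actL_mem := C.comp_mem
  actR_mem := C.comp_mem
  d_actL := C.d_comp
  d_actR := C.d_comp
  id_actL := C.id_comp
  actR_id := C.comp_id
  comp_actL := C.assoc
  actR_comp m g g' := (C.assoc m g g').symm
  actL_actR := C.assoc

/-- An element of the identity bimodule, regarded as a morphism of `C`. -/
def toHom {X Y : C.Obj} : (unit C).obj X Y →ₗ[k] C.Hom X Y := LinearMap.id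

theorem toHom_mem {X Y : C.Obj} {i : Γ} {m : (unit C).obj X Y} (hm : m ∈ ((unit C).obj X Y).gr i) :
    toHom m ∈ (C.Hom X Y).gr i := hm

theorem toHom_actL {X' X Y : C.Obj} (f : C.Hom X' X) (m : (unit C).obj X Y) :
    toHom ((unit C).actL f m) = C.comp f (toHom m) := rfl

theorem toHom_actR {X Y Y' : C.Obj} (m : (unit C).obj X Y) (g : C.Hom Y Y') :
    toHom ((unit C).actR m g) = C.comp (toHom m) g := rfl

/-- The bimodule `M|Y⟩ ⊗ ⟨Y|N`, for an object `Y` of `C`, with the actions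
`g · (m ⊗ n) · g' = (g · m) ⊗ (n · g')`. -/
noncomputable def outer {B : DGCat.{u₁, v₁} G k} {C : DGCat.{u, v} G k} {D : DGCat.{u₂, v₂} G k}
    (M : Bimod.{w₁} B C) (Y : C.Obj) (N : Bimod.{w₂} C D) : Bimod.{max w₁ w₂} B D where
  obj X Z := DGMod.tensor (M.obj X Y) (N.obj Y Z)
  actL := DGMod.onLeft M.actL
  actR := DGMod.onRight N.actR
  actL_mem := by
    intro _ _ _ i j f m hf hm
    refine DGMod.tensor_gr_map (DGMod.onLeft M.actL f) _ ?_ hm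
    rintro a b rfl p hp q hq
    simpa [add_assoc] using DGMod.tmul_mem (M.actL_mem hf hp) hq
  actR_mem := by
    intro _ _ _ i j m g hm hg
    refine DGMod.tensor_gr_map ((DGMod.onRight N.actR).flip g) _ ?_ hm
    rintro a b rfl p hp q hq
    simpa [add_assoc] using DGMod.tmul_mem hp (N.actR_mem hq hg)
  d_actL := by
    intro _ _ _ i f m hf
    rw [← LinearMap.smul_apply, ← map_zsmul, ← DGMod.par_of_mem _ _ hf]
    induction m using DGMod.tensor_ind with
    | add s t hs ht => simp only [map_add, hs, ht]; abel
    | tmul a p hp b q hq => simp [M.d_actL_par, M.par_actL]; abel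
  d_actR := by
    intro _ _ _ i m g hm
    rw [← LinearMap.smul_apply, ← map_zsmul, ← DGMod.par_of_mem _ _ hm]
    clear hm
    induction m using DGMod.tensor_ind with
    | add s t hs ht => simp only [map_add, hs, ht, LinearMap.add_apply]; abel
    | tmul a p hp b q hq => simp [N.d_actR_par]; abel
  id_actL := by
    intro _ _ m
    induction m using DGMod.tensor_ind with
    | add s t hs ht => simp only [map_add, hs, ht]
    | tmul a p hp b q hq => simp [M.id_actL]
  actR_id := by
    intro _ _ m
    induction m using DGMod.tensor_ind with
    | add s t hs ht => simp only [map_add, hs, ht, LinearMap.add_apply]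
    | tmul a p hp b q hq => simp [N.actR_id]
  comp_actL := by
    intro _ _ _ _ f f' m
    induction m using DGMod.tensor_ind with
    | add s t hs ht => simp only [map_add, hs, ht]
    | tmul a p hp b q hq => simp [M.comp_actL]
  actR_comp := by
    intro _ _ _ _ m g g'
    induction m using DGMod.tensor_ind with
    | add s t hs ht => simp only [map_add, hs, ht, LinearMap.add_apply]
    | tmul a p hp b q hq => simp [N.actR_comp]
  actL_actR := by
    intro _ _ _ _ f m g
    induction m using DGMod.tensor_ind with
    | add s t hs ht => simp only [map_add, hs, ht, LinearMap.add_apply]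
    | tmul a p hp b q hq => simp

/-- The direct sum of a family of bimodules. -/
noncomputable def directSum {A : Type u} (M : A → Bimod.{w} C D) : Bimod.{max u w} C D where
  obj X Y := DGMod.directSum fun a => (M a).obj X Y
  actL := DGMod.sumLeft fun a => (M a).actL
  actR := DGMod.sumRight fun a => (M a).actR
  actL_mem := by
    intro _ _ _ i j f m hf hm
    refine DGMod.directSum_gr_map (DGMod.sumLeft (fun a => (M a).actL) f) _ ?_ hm
    intro a m hm
    simpa using DGMod.incl_mem (M := fun a => (M a).obj _ _) ((M a).actL_mem hf hm)
  actR_mem := by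
    intro _ _ _ i j m g hm hg
    refine DGMod.directSum_gr_map ((DGMod.sumRight (fun a => (M a).actR)).flip g) _ ?_ hm
    intro a m hm
    simpa using DGMod.incl_mem (M := fun a => (M a).obj _ _) ((M a).actR_mem hm hg)
  d_actL := by
    intro _ _ _ i f m hf
    rw [← LinearMap.smul_apply, ← map_zsmul, ← DGMod.par_of_mem _ _ hf]
    induction m using DGMod.directSum_ind with
    | zero => simp
    | add s t hs ht => simp only [map_add, hs, ht]; abel
    | incl a m => simp [(M a).d_actL_par]
  d_actR := by
    intro _ _ _ i m g hm
    rw [← LinearMap.smul_apply, ← map_zsmul, ← DGMod.par_of_mem _ _ hm]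
    clear hm
    induction m using DGMod.directSum_ind with
    | zero => simp
    | add s t hs ht => simp only [map_add, hs, ht, LinearMap.add_apply]; abel
    | incl a m => simp [(M a).d_actR_par]
  id_actL := by
    intro _ _ m
    induction m using DGMod.directSum_ind with
    | zero => simp
    | add s t hs ht => simp only [map_add, hs, ht]
    | incl a m => simp [(M a).id_actL]
  actR_id := by
    intro _ _ m
    induction m using DGMod.directSum_ind with
    | zero => simp
    | add s t hs ht => simp only [map_add, hs, ht, LinearMap.add_apply]
    | incl a m => simp [(M a).actR_id]
  comp_actL := by
    intro _ _ _ _ f f' m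
    induction m using DGMod.directSum_ind with
    | zero => simp
    | add s t hs ht => simp only [map_add, hs, ht]
    | incl a m => simp [(M a).comp_actL]
  actR_comp := by
    intro _ _ _ _ m g g'
    induction m using DGMod.directSum_ind with
    | zero => simp
    | add s t hs ht => simp only [map_add, hs, ht, LinearMap.add_apply]
    | incl a m => simp [(M a).actR_comp]
  actL_actR := by
    intro _ _ _ _ f m g
    induction m using DGMod.directSum_ind with
    | zero => simp
    | add s t hs ht => simp only [map_add, hs, ht, LinearMap.add_apply]
    | incl a m => simp [(M a).actL_actR]

/-- The shift `q ^ j M` of a bimodule, with the actions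
`g · (q ^ j m) · g' = (-1) ^ ⟨j, |g|⟩ q ^ j (g · m · g')`. -/
noncomputable def shift (j : Γ) (M : Bimod.{w} C D) : Bimod.{w} C D where
  obj X Y := DGMod.shift j (M.obj X Y)
  actL {X' X Y} := (M.actL.compr₂ (DGMod.toShift j _).toLinearMap).compl₁₂
    ((C.Hom X' X).par j) (DGMod.toShift j _).symm.toLinearMap
  actR {X Y Y'} := (M.actR.compr₂ (DGMod.toShift j _).toLinearMap) ∘ₗ
    (DGMod.toShift j _).symm.toLinearMap
  actL_mem := by
    intro _ _ _ i i' f m hf hm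
    obtain ⟨m, rfl⟩ := (DGMod.toShift j _).surjective m
    rw [DGMod.toShift_mem] at hm
    simp only [LinearMap.compl₁₂_apply, LinearMap.compr₂_apply, LinearEquiv.coe_coe,
      LinearEquiv.symm_apply_apply, DGMod.toShift_mem, add_sub_assoc]
    exact M.actL_mem (DGMod.par_mem _ _ hf) hm
  actR_mem := by
    intro _ _ _ i i' m g hm hg
    obtain ⟨m, rfl⟩ := (DGMod.toShift j _).surjective m
    rw [DGMod.toShift_mem] at hm
    simp only [LinearMap.comp_apply, LinearMap.compr₂_apply, LinearEquiv.coe_coe,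
      LinearEquiv.symm_apply_apply, DGMod.toShift_mem, add_sub_right_comm]
    exact M.actR_mem hm hg
  d_actL := by
    intro _ _ _ i f m hf
    obtain ⟨m, rfl⟩ := (DGMod.toShift j _).surjective m
    rw [← LinearMap.smul_apply, ← map_zsmul, ← DGMod.par_of_mem _ _ hf]
    simp only [LinearMap.compl₁₂_apply, LinearMap.compr₂_apply, LinearEquiv.coe_coe,
      LinearEquiv.symm_apply_apply, DGMod.d_toShift, M.d_actL_par, DGMod.d_par, map_add, map_zsmul,
      LinearMap.smul_apply, smul_add, smul_smul, G.sgn_mul_self, one_smul]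
    rw [DGMod.par_of_mem _ _ hf, DGMod.par_of_mem _ _ hf]
    simp only [map_zsmul, LinearMap.smul_apply, smul_smul, DGMod.par_of_mem _ _ hf]
    congr 2
    ring
  d_actR := by
    intro _ _ _ i m g hm
    obtain ⟨m, rfl⟩ := (DGMod.toShift j _).surjective m
    rw [← LinearMap.smul_apply, ← map_zsmul, ← DGMod.par_of_mem _ _ hm]
    simp [M.d_actR_par, G.sgn_symm j G.ι]
  id_actL := by
    intro _ _ m
    obtain ⟨m, rfl⟩ := (DGMod.toShift j _).surjective m
    simp [DGMod.par_of_mem _ _ (C.id_mem _), M.id_actL]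
  actR_id := by
    intro _ _ m
    obtain ⟨m, rfl⟩ := (DGMod.toShift j _).surjective m
    simp [M.actR_id]
  comp_actL := by
    intro _ _ _ _ f f' m
    obtain ⟨m, rfl⟩ := (DGMod.toShift j _).surjective m
    simp [C.par_comp, M.comp_actL]
  actR_comp := by
    intro _ _ _ _ m g g'
    obtain ⟨m, rfl⟩ := (DGMod.toShift j _).surjective m
    simp [M.actR_comp]
  actL_actR := by
    intro _ _ _ _ f m g
    obtain ⟨m, rfl⟩ := (DGMod.toShift j _).surjective m
    simp [M.actL_actR]

/-- The quotient of a bimodule by the sub-bimodule spanned by a family of sets of homogeneous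
elements. -/
noncomputable def quot (M : Bimod.{w} C D) (T : ∀ X Y, Set (M.obj X Y))
    (hT : ∀ {X Y}, ∀ t ∈ T X Y, ∃ i, t ∈ (M.obj X Y).gr i)
    (hd : ∀ {X Y}, ∀ t ∈ T X Y, (M.obj X Y).d t ∈ Submodule.span k (T X Y))
    (hl : ∀ {X' X Y} (f : C.Hom X' X), ∀ t ∈ T X Y, M.actL f t ∈ Submodule.span k (T X' Y))
    (hr : ∀ {X Y Y'} (g : D.Hom Y Y'), ∀ t ∈ T X Y, M.actR t g ∈ Submodule.span k (T X Y')) :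
    Bimod.{w} C D where
  obj X Y := DGMod.quot (M.obj X Y) (T X Y) hT hd
  actL := LinearMap.flip (DGMod.qdesc (LinearMap.flip (M.actL.compr₂ DGMod.proj))
    (fun t ht => LinearMap.ext fun f => DGMod.proj_of_mem (hl f t ht)))
  actR := DGMod.qdesc (M.actR.compr₂ DGMod.proj)
    (fun t ht => LinearMap.ext fun g => DGMod.proj_of_mem (hr g t ht))
  actL_mem := by
    rintro _ _ _ i j f _ hf ⟨m, hm, rfl⟩
    exact DGMod.proj_mem (M.actL_mem hf hm)
  actR_mem := by
    rintro _ _ _ i j _ g ⟨m, hm, rfl⟩ hg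
    exact DGMod.proj_mem (M.actR_mem hm hg)
  d_actL := by
    intro _ _ _ i f m hf
    obtain ⟨m, rfl⟩ := DGMod.proj_surjective m
    simp only [LinearMap.flip_apply, DGMod.qdesc_proj, LinearMap.compr₂_apply, DGMod.d_proj,
      M.d_actL m hf, map_add, map_zsmul]
  d_actR := by
    rintro _ _ _ i _ g ⟨m, hm, rfl⟩
    change (DGMod.quot _ _ _ _).d (DGMod.proj (M.actR m g)) = DGMod.proj (M.actR _ g) +
      G.sgn G.ι i • DGMod.proj (M.actR m _)
    rw [DGMod.d_proj, M.d_actR g hm, map_add, map_zsmul]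
  id_actL := by
    intro _ _ m
    obtain ⟨m, rfl⟩ := DGMod.proj_surjective m
    simp [M.id_actL]
  actR_id := by
    intro _ _ m
    obtain ⟨m, rfl⟩ := DGMod.proj_surjective m
    simp [M.actR_id]
  comp_actL := by
    intro _ _ _ _ f f' m
    obtain ⟨m, rfl⟩ := DGMod.proj_surjective m
    simp [M.comp_actL]
  actR_comp := by
    intro _ _ _ _ m g g'
    obtain ⟨m, rfl⟩ := DGMod.proj_surjective m
    simp [M.actR_comp]
  actL_actR := by
    intro _ _ _ _ f m g
    obtain ⟨m, rfl⟩ := DGMod.proj_surjective m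
    simp [M.actL_actR]

section tensorOver

variable {B : DGCat.{u, v} G k} (M : Bimod.{w₁} C B) (N : Bimod.{w₂} B D)

variable {M N} in
/-- The element `m ⊗ n` of the summand indexed by `Y`. -/
noncomputable def pure (Y : B.Obj) {X : C.Obj} {Z : D.Obj} :
    M.obj X Y →ₗ[k] N.obj Y Z →ₗ[k] (directSum fun Y => outer M Y N).obj X Z :=
  DGMod.tmul.compr₂ (DGMod.incl (M := fun Y => (outer M Y N).obj X Z) Y)

variable {M N} in
theorem pure_mem {X : C.Obj} {Z : D.Obj} {Y : B.Obj} {i j : Γ}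
    {m : M.obj X Y} (hm : m ∈ (M.obj X Y).gr i) {n : N.obj Y Z} (hn : n ∈ (N.obj Y Z).gr j) :
    pure Y m n ∈ ((directSum fun Y => outer M Y N).obj X Z).gr (i + j) :=
  DGMod.incl_mem (M := fun Y => (outer M Y N).obj X Z) (DGMod.tmul_mem hm hn)

variable {M N} in
theorem d_pure {X : C.Obj} {Z : D.Obj} {Y : B.Obj} (m : M.obj X Y) (n : N.obj Y Z) :
    ((directSum fun Y => outer M Y N).obj X Z).d (pure Y m n) =
      pure Y ((M.obj X Y).d m) n + pure Y ((M.obj X Y).par G.ι m) ((N.obj Y Z).d n) := by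
  refine (DGMod.d_incl (M := fun Y => (outer M Y N).obj X Z) Y _).trans ?_
  exact (congrArg (DGMod.incl (M := fun Y => (outer M Y N).obj X Z) Y)
    (DGMod.d_tmul m n)).trans (map_add _ _ _)

variable {M N} in
theorem actL_pure {X' X : C.Obj} {Z : D.Obj} {Y : B.Obj} (g : C.Hom X' X) (m : M.obj X Y)
    (n : N.obj Y Z) :
    (directSum fun Y => outer M Y N).actL g (pure Y m n) = pure Y (M.actL g m) n :=
  (DGMod.sumLeft_incl (fun Y => (outer M Y N).actL) g Y _).trans
    (congrArg (DGMod.incl (M := fun Y => (outer M Y N).obj X' Z) Y) (DGMod.onLeft_tmul _ _ _ _))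

variable {M N} in
theorem actR_pure {X : C.Obj} {Z Z' : D.Obj} {Y : B.Obj} (g : D.Hom Z Z') (m : M.obj X Y)
    (n : N.obj Y Z) :
    (directSum fun Y => outer M Y N).actR (pure Y m n) g = pure Y m (N.actR n g) :=
  (DGMod.sumRight_incl (fun Y => (outer M Y N).actR) g Y _).trans
    (congrArg (DGMod.incl (M := fun Y => (outer M Y N).obj X Z') Y) (DGMod.onRight_tmul _ _ _ _))

variable {M N} in
theorem pure_ind {X : C.Obj} {Z : D.Obj} {P : (directSum fun Y => outer M Y N).obj X Z → Prop}
    (zero : P 0)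
    (pure : ∀ Y i, ∀ m ∈ (M.obj X Y).gr i, ∀ j, ∀ n ∈ (N.obj Y Z).gr j, P (pure Y m n))
    (add : ∀ s t, P s → P t → P (s + t)) (t : (directSum fun Y => outer M Y N).obj X Z) : P t := by
  refine DGMod.directSum_ind (M := fun Y => (outer M Y N).obj X Z) zero ?_ add t
  intro Y m
  refine DGMod.tensor_ind (P := fun m => P (DGMod.incl (M := fun Y => (outer M Y N).obj X Z) Y m))
    ?_ ?_ m
  · exact fun i m hm j n hn => pure Y i m hm j n hn
  · intro s t hs ht
    exact (congrArg P ((DGMod.incl (M := fun Y => (outer M Y N).obj X Z) Y).map_add s t)).mpr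
      (add _ _ hs ht)

/-- The relations `m f ⊗ n ∼ m ⊗ f n`, for homogeneous `m`, `f`, `n`. -/
def tensorRel (X : C.Obj) (Z : D.Obj) : Set ((directSum fun Y => outer M Y N).obj X Z) :=
  {t | ∃ Y Y' i j l, ∃ m ∈ (M.obj X Y).gr i, ∃ f ∈ (B.Hom Y Y').gr j, ∃ n ∈ (N.obj Y' Z).gr l,
    t = pure Y' (M.actR m f) n - pure Y m (N.actL f n)}

variable {M N} in
theorem mem_span_tensorRel {X : C.Obj} {Z : D.Obj} {Y Y' : B.Obj} {i j l : Γ}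
    {m : M.obj X Y} (hm : m ∈ (M.obj X Y).gr i) {f : B.Hom Y Y'} (hf : f ∈ (B.Hom Y Y').gr j)
    {n : N.obj Y' Z} (hn : n ∈ (N.obj Y' Z).gr l) :
    pure Y' (M.actR m f) n - pure Y m (N.actL f n) ∈ Submodule.span k (tensorRel M N X Z) :=
  Submodule.subset_span ⟨Y, Y', i, j, l, m, hm, f, hf, n, hn, rfl⟩

variable {M N} in
theorem tensorRel_homog {X : C.Obj} {Z : D.Obj} : ∀ t ∈ tensorRel M N X Z,
    ∃ i, t ∈ ((directSum fun Y => outer M Y N).obj X Z).gr i := by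
  rintro _ ⟨Y, Y', i, j, l, m, hm, f, hf, n, hn, rfl⟩
  refine ⟨i + j + l, Submodule.sub_mem _ (pure_mem (M.actR_mem hm hf) hn) ?_⟩
  rw [add_assoc]
  exact pure_mem hm (N.actL_mem hf hn)

variable {M N} in
theorem tensorRel_d {X : C.Obj} {Z : D.Obj} : ∀ t ∈ tensorRel M N X Z,
    ((directSum fun Y => outer M Y N).obj X Z).d t ∈ Submodule.span k (tensorRel M N X Z) := by
  rintro _ ⟨Y, Y', i, j, l, m, hm, f, hf, n, hn, rfl⟩
  have h1 := mem_span_tensorRel (M := M) (N := N) ((M.obj X Y).d_mem hm) hf hn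
  have h2 := mem_span_tensorRel (M := M) (N := N) ((M.obj X Y).par_mem G.ι hm)
    ((B.Hom Y Y').d_mem hf) hn
  have h3 := mem_span_tensorRel (M := M) (N := N) ((M.obj X Y).par_mem G.ι hm)
    ((B.Hom Y Y').par_mem G.ι hf) ((N.obj Y' Z).d_mem hn)
  convert Submodule.add_mem _ (Submodule.add_mem _ h1 h2) h3 using 1
  simp only [map_sub, d_pure, M.d_actR_par, M.par_actR, N.d_actL_par, map_add,
    LinearMap.add_apply]
  abel

variable {M N} in
theorem tensorRel_actL {X' X : C.Obj} {Z : D.Obj} (g : C.Hom X' X) : ∀ t ∈ tensorRel M N X Z,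
    (directSum fun Y => outer M Y N).actL g t ∈ Submodule.span k (tensorRel M N X' Z) := by
  rintro _ ⟨Y, Y', i, j, l, m, hm, f, hf, n, hn, rfl⟩
  induction g using DGMod.ind with
  | add g g' h h' =>
    rw [map_add, LinearMap.add_apply]
    exact Submodule.add_mem _ h h'
  | homog e g hg =>
    have := mem_span_tensorRel (M := M) (N := N) (M.actL_mem hg hm) hf hn
    rwa [map_sub, actL_pure, actL_pure, ← M.actL_actR]

variable {M N} in
theorem tensorRel_actR {X : C.Obj} {Z Z' : D.Obj} (g : D.Hom Z Z') : ∀ t ∈ tensorRel M N X Z,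
    (directSum fun Y => outer M Y N).actR t g ∈ Submodule.span k (tensorRel M N X Z') := by
  rintro _ ⟨Y, Y', i, j, l, m, hm, f, hf, n, hn, rfl⟩
  induction g using DGMod.ind with
  | add g g' h h' =>
    rw [map_add]
    exact Submodule.add_mem _ h h'
  | homog e g hg =>
    have := mem_span_tensorRel (M := M) (N := N) hm hf (N.actR_mem hn hg)
    rwa [map_sub, LinearMap.sub_apply, actR_pure, actR_pure, N.actL_actR]

/-- The tensor product `M ⊗_B N` of bimodules:
`⟨X|M ⊗_B N|Z⟩ = (⨁ Y, ⟨X|M|Y⟩ ⊗ ⟨Y|N|Z⟩) / (m f ⊗ n ∼ m ⊗ f n)`. -/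
noncomputable def tensorOver : Bimod.{max u w₁ w₂} C D :=
  quot (directSum fun Y => outer M Y N) (tensorRel M N) tensorRel_homog tensorRel_d
    tensorRel_actL tensorRel_actR

variable {M N} in
/-- The quotient map onto `M ⊗_B N`. -/
noncomputable def tproj {X : C.Obj} {Z : D.Obj} :
    (directSum fun Y => outer M Y N).obj X Z →ₗ[k] (tensorOver M N).obj X Z :=
  DGMod.proj (hT := tensorRel_homog) (hd := tensorRel_d)

variable {M N}

/-- The element `m ⊗ n` of `M ⊗_B N`. -/
noncomputable def tmul (Y : B.Obj) {X : C.Obj} {Z : D.Obj} :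
    M.obj X Y →ₗ[k] N.obj Y Z →ₗ[k] (tensorOver M N).obj X Z :=
  (pure Y).compr₂ tproj

/-- The linear map out of `M ⊗_B N` given by balanced bilinear maps. -/
noncomputable def tlift {X : C.Obj} {Z : D.Obj} {Q : Type w₃} [AddCommGroup Q] [Module k Q]
    (φ : ∀ Y, M.obj X Y →ₗ[k] N.obj Y Z →ₗ[k] Q)
    (h : ∀ {Y Y'} (m : M.obj X Y) (f : B.Hom Y Y') (n : N.obj Y' Z),
      φ Y' (M.actR m f) n = φ Y m (N.actL f n)) : (tensorOver M N).obj X Z →ₗ[k] Q :=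
  DGMod.qdesc (hT := tensorRel_homog) (hd := tensorRel_d)
    (DGMod.desc (M := fun Y => (outer M Y N).obj X Z) fun Y => DGMod.tlift (φ Y)) (by
      rintro _ ⟨Y, Y', i, j, l, m, hm, f, hf, n, hn, rfl⟩
      refine (map_sub _ _ _).trans (sub_eq_zero.2 ?_)
      refine (DGMod.desc_incl (M := fun Y => (outer M Y N).obj X Z) _ _ _).trans
        (Eq.trans ?_ (DGMod.desc_incl (M := fun Y => (outer M Y N).obj X Z) _ _ _).symm)
      exact (DGMod.tlift_tmul _ _ _).trans ((h m f n).trans (DGMod.tlift_tmul _ _ _).symm))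

theorem tlift_tmul {X : C.Obj} {Z : D.Obj} {Q : Type w₃} [AddCommGroup Q] [Module k Q]
    (φ : ∀ Y, M.obj X Y →ₗ[k] N.obj Y Z →ₗ[k] Q)
    (h : ∀ {Y Y'} (m : M.obj X Y) (f : B.Hom Y Y') (n : N.obj Y' Z),
      φ Y' (M.actR m f) n = φ Y m (N.actL f n)) {Y : B.Obj} (m : M.obj X Y) (n : N.obj Y Z) :
    tlift φ h (tmul Y m n) = φ Y m n :=
  (DGMod.desc_incl (M := fun Y => (outer M Y N).obj X Z) (fun Y => DGMod.tlift (φ Y)) Y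
    (DGMod.tmul m n)).trans (DGMod.tlift_tmul _ _ _)

theorem tmul_mem {X : C.Obj} {Z : D.Obj} {Y : B.Obj} {i j : Γ}
    {m : M.obj X Y} (hm : m ∈ (M.obj X Y).gr i) {n : N.obj Y Z} (hn : n ∈ (N.obj Y Z).gr j) :
    tmul Y m n ∈ ((tensorOver M N).obj X Z).gr (i + j) :=
  DGMod.proj_mem (hT := tensorRel_homog) (hd := tensorRel_d) (pure_mem hm hn)

theorem tmul_actR {X : C.Obj} {Z : D.Obj} {Y Y' : B.Obj} (m : M.obj X Y) (f : B.Hom Y Y')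
    (n : N.obj Y' Z) :
    (tmul Y' (M.actR m f) n : (tensorOver M N).obj X Z) = tmul Y m (N.actL f n) := by
  induction m using DGMod.ind with
  | add m m' h h' => simp only [map_add, LinearMap.add_apply, h, h']
  | homog i m hm =>
    induction f using DGMod.ind with
    | add f f' h h' => simp only [map_add, LinearMap.add_apply, h, h']
    | homog j f hf =>
      induction n using DGMod.ind with
      | add n n' h h' => simp only [map_add, h, h']
      | homog l n hn =>
        refine sub_eq_zero.1 ((map_sub (tproj (M := M) (N := N)) _ _).symm.trans ?_)
        exact DGMod.proj_of_mem (mem_span_tensorRel hm hf hn)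

theorem d_tmul {X : C.Obj} {Z : D.Obj} {Y : B.Obj} (m : M.obj X Y) (n : N.obj Y Z) :
    ((tensorOver M N).obj X Z).d (tmul Y m n) =
      tmul Y ((M.obj X Y).d m) n + tmul Y ((M.obj X Y).par G.ι m) ((N.obj Y Z).d n) :=
  (congrArg (tproj (M := M) (N := N)) (d_pure m n)).trans (map_add _ _ _)

theorem actL_tmul {X' X : C.Obj} {Z : D.Obj} {Y : B.Obj} (g : C.Hom X' X) (m : M.obj X Y)
    (n : N.obj Y Z) : (tensorOver M N).actL g (tmul Y m n) = tmul Y (M.actL g m) n :=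
  congrArg (tproj (M := M) (N := N)) (actL_pure g m n)

theorem actR_tmul {X : C.Obj} {Z Z' : D.Obj} {Y : B.Obj} (g : D.Hom Z Z') (m : M.obj X Y)
    (n : N.obj Y Z) : (tensorOver M N).actR (tmul Y m n) g = tmul Y m (N.actR n g) :=
  congrArg (tproj (M := M) (N := N)) (actR_pure g m n)

theorem tensorOver_ind {X : C.Obj} {Z : D.Obj} {P : (tensorOver M N).obj X Z → Prop}
    (zero : P 0)
    (tmul : ∀ Y i, ∀ m ∈ (M.obj X Y).gr i, ∀ j, ∀ n ∈ (N.obj Y Z).gr j, P (tmul Y m n))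
    (add : ∀ s t, P s → P t → P (s + t)) (t : (tensorOver M N).obj X Z) : P t := by
  obtain ⟨t, rfl⟩ : ∃ s, tproj s = t := DGMod.proj_surjective t
  refine pure_ind (P := fun t => P (tproj (M := M) (N := N) t)) ?_ tmul ?_ t
  · exact (congrArg P (LinearMap.map_zero _)).mpr zero
  · intro s t hs ht
    exact (congrArg P (LinearMap.map_add _ s t)).mpr (add _ _ hs ht)

theorem tensorOver_gr_map {X : C.Obj} {Z : D.Obj} {Q : Type w₃} [AddCommGroup Q] [Module k Q]
    (φ : (tensorOver M N).obj X Z →ₗ[k] Q) (S : Submodule k Q) {n : Γ}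
    (h : ∀ Y i j, i + j = n → ∀ a ∈ (M.obj X Y).gr i, ∀ b ∈ (N.obj Y Z).gr j, φ (tmul Y a b) ∈ S)
    {t : (tensorOver M N).obj X Z} (ht : t ∈ ((tensorOver M N).obj X Z).gr n) : φ t ∈ S := by
  obtain ⟨t, ht, rfl⟩ : ∃ s, s ∈ ((directSum fun Y => outer M Y N).obj X Z).gr n ∧
    tproj s = t := ht
  refine DGMod.directSum_gr_map (M := fun Y => (outer M Y N).obj X Z)
    (φ ∘ₗ tproj) S ?_ ht
  intro Y m hm
  refine DGMod.tensor_gr_map ((φ ∘ₗ tproj) ∘ₗ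
    DGMod.incl (M := fun Y => (outer M Y N).obj X Z) Y) S ?_ hm
  exact fun i j hij a ha b hb => h Y i j hij a ha b hb

end tensorOver

end Bimod

/-! ## Morphisms of bimodules -/

/-- A bimodule map of degree `l`. It satisfies `φ(g · m · g') = (-1) ^ ⟨l, |g|⟩ g · φ(m) · g'`, and
need not commute with the differentials. -/
structure BimHom (l : Γ) (M : Bimod.{w₁} C D) (N : Bimod.{w₂} C D) where
  app : ∀ X Y, M.obj X Y →ₗ[k] N.obj X Y
  app_mem : ∀ {X Y} {i : Γ} {m : M.obj X Y}, m ∈ (M.obj X Y).gr i → app X Y m ∈ (N.obj X Y).gr (i + l)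
  app_actL : ∀ {X' X Y} {i : Γ} {g : C.Hom X' X} (m : M.obj X Y), g ∈ (C.Hom X' X).gr i →
    app X' Y (M.actL g m) = G.sgn l i • N.actL g (app X Y m)
  app_actR : ∀ {X Y Y'} (m : M.obj X Y) (g : D.Hom Y Y'),
    app X Y' (M.actR m g) = N.actR (app X Y m) g

namespace BimHom

theorem app_actL_par {l : Γ} {M : Bimod.{w₁} C D} {N : Bimod.{w₂} C D} (φ : BimHom l M N)
    {X' X Y} (g : C.Hom X' X) (m : M.obj X Y) :
    φ.app X' Y (M.actL g m) = N.actL ((C.Hom X' X).par l g) (φ.app X Y m) := by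
  induction g using DGMod.ind with
  | add g g' h h' => simp only [map_add, LinearMap.add_apply, h, h']
  | homog i g hg => rw [φ.app_actL m hg, DGMod.par_of_mem _ _ hg]; simp

theorem app_actL_zero {M : Bimod.{w₁} C D} {N : Bimod.{w₂} C D} (φ : BimHom (0 : Γ) M N)
    {X' X Y} (g : C.Hom X' X) (m : M.obj X Y) :
    φ.app X' Y (M.actL g m) = N.actL g (φ.app X Y m) := by
  induction g using DGMod.ind with
  | add g g' h h' => simp only [map_add, LinearMap.add_apply, h, h']
  | homog i g hg => rw [φ.app_actL m hg]; simp

/-- The differential `d(φ) = d ∘ φ - (-1) ^ ⟨ι, l⟩ φ ∘ d` of a bimodule map of degree `l`. -/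
def diff {l : Γ} {M : Bimod.{w₁} C D} {N : Bimod.{w₂} C D} (φ : BimHom l M N) (X : C.Obj)
    (Y : D.Obj) : M.obj X Y →ₗ[k] N.obj X Y :=
  (N.obj X Y).d ∘ₗ φ.app X Y - G.sgn G.ι l • (φ.app X Y ∘ₗ (M.obj X Y).d)

/-- A bimodule map is closed if its differential vanishes. -/
def IsClosed {l : Γ} {M : Bimod.{w₁} C D} {N : Bimod.{w₂} C D} (φ : BimHom l M N) : Prop :=
  ∀ X Y, φ.diff X Y = 0

/-- Two bimodule maps of the same degree are homotopic if their difference is exact. -/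
def Homotopic {l : Γ} {M : Bimod.{w₁} C D} {N : Bimod.{w₂} C D} (φ ψ : BimHom l M N) : Prop :=
  ∃ h : BimHom (l - G.ι) M N, ∀ X Y, φ.app X Y - ψ.app X Y = h.diff X Y

/-- The identity map. -/
def id (M : Bimod.{w} C D) : BimHom (0 : Γ) M M where
  app _ _ := LinearMap.id
  app_mem h := by simpa using h
  app_actL := by intros; simp
  app_actR _ _ := rfl

/-- Composition of bimodule maps of degree zero. -/
def comp {M : Bimod.{w₁} C D} {N : Bimod.{w₂} C D} {P : Bimod.{w₃} C D}
    (ψ : BimHom (0 : Γ) N P) (φ : BimHom (0 : Γ) M N) : BimHom (0 : Γ) M P where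
  app X Y := ψ.app X Y ∘ₗ φ.app X Y
  app_mem h := by simpa using ψ.app_mem (φ.app_mem h)
  app_actL m hg := by simp [φ.app_actL_zero, ψ.app_actL_zero]
  app_actR m g := by simp [φ.app_actR, ψ.app_actR]

/-- The difference of two bimodule maps. -/
def sub {l : Γ} {M : Bimod.{w₁} C D} {N : Bimod.{w₂} C D} (φ ψ : BimHom l M N) :
    BimHom l M N where
  app X Y := φ.app X Y - ψ.app X Y
  app_mem h := Submodule.sub_mem _ (φ.app_mem h) (ψ.app_mem h)
  app_actL m hg := by simp [φ.app_actL m hg, ψ.app_actL m hg, smul_sub]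
  app_actR m g := by simp [φ.app_actR, ψ.app_actR]

/-- A closed degree zero bimodule map is a homotopy equivalence if it has an inverse up to
homotopy. -/
def IsHomotopyEquiv {M : Bimod.{w₁} C D} {N : Bimod.{w₂} C D} (φ : BimHom (0 : Γ) M N) : Prop :=
  φ.IsClosed ∧ ∃ ψ : BimHom (0 : Γ) N M, ψ.IsClosed ∧
    (ψ.comp φ).Homotopic (id M) ∧ (φ.comp ψ).Homotopic (id N)

theorem whiskerLeft_balanced {P : Bimod.{w₁} C C} (ε : BimHom (0 : Γ) P (Bimod.unit C))
    (N : Bimod.{w₂} C D) {X : C.Obj} {Z : D.Obj} {Y Y' : C.Obj} (m : P.obj X Y) (f : C.Hom Y Y')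
    (n : N.obj Y' Z) :
    (N.actL ∘ₗ Bimod.toHom ∘ₗ ε.app X Y') (P.actR m f) n =
      (N.actL ∘ₗ Bimod.toHom ∘ₗ ε.app X Y) m (N.actL f n) := by
  simp only [LinearMap.comp_apply, ε.app_actR, Bimod.toHom_actR, N.comp_actL]

theorem whiskerRight_balanced {P : Bimod.{w₁} D D} (N : Bimod.{w₂} C D)
    (ε : BimHom (0 : Γ) P (Bimod.unit D)) {X : C.Obj} {Z Y Y' : D.Obj} (m : N.obj X Y)
    (f : D.Hom Y Y') (n : P.obj Y' Z) :
    (N.actR.compl₂ (Bimod.toHom ∘ₗ ε.app Y' Z)) (N.actR m f) n =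
      (N.actR.compl₂ (Bimod.toHom ∘ₗ ε.app Y Z)) m (P.actL f n) := by
  simp only [LinearMap.compl₂_apply, LinearMap.comp_apply, ε.app_actL_zero, Bimod.toHom_actL,
    N.actR_comp]

/-- For a map `ε : P → C`, the map `ε ⊗ id_N : P ⊗_C N → C ⊗_C N ≅ N`, `p ⊗ n ↦ ε(p) · n`. -/
noncomputable def whiskerLeft {P : Bimod.{w₁} C C} (ε : BimHom (0 : Γ) P (Bimod.unit C))
    (N : Bimod.{w₂} C D) : BimHom (0 : Γ) (Bimod.tensorOver P N) N where
  app X Z := Bimod.tlift (fun Y => N.actL ∘ₗ Bimod.toHom ∘ₗ ε.app X Y) (ε.whiskerLeft_balanced N)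
  app_mem := by
    intro X Z n t ht
    refine Bimod.tensorOver_gr_map _ _ ?_ ht
    rintro Y i j rfl a ha b hb
    rw [Bimod.tlift_tmul, add_right_comm]
    exact N.actL_mem (Bimod.toHom_mem (ε.app_mem ha)) hb
  app_actL := by
    intro X' X Z i g t hg
    rw [G.sgn_zero_left, one_smul]
    induction t using Bimod.tensorOver_ind with
    | zero => simp
    | add s t hs ht => simp only [map_add, hs, ht]
    | tmul Y i m hm j n hn =>
      rw [Bimod.actL_tmul, Bimod.tlift_tmul, Bimod.tlift_tmul]
      simp only [LinearMap.comp_apply, ε.app_actL_zero, Bimod.toHom_actL, N.comp_actL]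
  app_actR := by
    intro X Z Z' t g
    induction t using Bimod.tensorOver_ind with
    | zero => simp
    | add s t hs ht => simp only [map_add, LinearMap.add_apply, hs, ht]
    | tmul Y i m hm j n hn =>
      rw [Bimod.actR_tmul, Bimod.tlift_tmul, Bimod.tlift_tmul]
      exact (N.actL_actR _ _ _).symm

/-- For a map `ε : P → D`, the map `id_N ⊗ ε : N ⊗_D P → N ⊗_D D ≅ N`, `n ⊗ p ↦ n · ε(p)`. -/
noncomputable def whiskerRight {P : Bimod.{w₁} D D} (N : Bimod.{w₂} C D)
    (ε : BimHom (0 : Γ) P (Bimod.unit D)) : BimHom (0 : Γ) (Bimod.tensorOver N P) N where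
  app X Z := Bimod.tlift (fun Y => N.actR.compl₂ (Bimod.toHom ∘ₗ ε.app Y Z)) (whiskerRight_balanced N ε)
  app_mem := by
    intro X Z n t ht
    refine Bimod.tensorOver_gr_map _ _ ?_ ht
    rintro Y i j rfl a ha b hb
    rw [Bimod.tlift_tmul, add_assoc]
    exact N.actR_mem ha (Bimod.toHom_mem (ε.app_mem hb))
  app_actL := by
    intro X' X Z i g t hg
    rw [G.sgn_zero_left, one_smul]
    induction t using Bimod.tensorOver_ind with
    | zero => simp
    | add s t hs ht => simp only [map_add, hs, ht]
    | tmul Y i m hm j n hn =>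
      rw [Bimod.actL_tmul, Bimod.tlift_tmul, Bimod.tlift_tmul]
      exact N.actL_actR _ _ _
  app_actR := by
    intro X Z Z' t g
    induction t using Bimod.tensorOver_ind with
    | zero => simp
    | add s t hs ht => simp only [map_add, LinearMap.add_apply, hs, ht]
    | tmul Y i m hm j n hn =>
      rw [Bimod.actR_tmul, Bimod.tlift_tmul, Bimod.tlift_tmul]
      simp only [LinearMap.compl₂_apply, LinearMap.comp_apply, ε.app_actR, Bimod.toHom_actR,
        N.actR_comp]

end BimHom

/-! ## Counital idempotents -/

/-- A counital idempotent in the dg monoidal category of `(C, C)`-bimodules: a bimodule `P` with a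
closed degree zero map `ε : P → C` such that `ε ⊗ id_P` and `id_P ⊗ ε` are homotopy equivalences
`P ⊗_C P → P`. -/
structure IsCounitalIdempotent (P : Bimod.{w} C C) (ε : BimHom (0 : Γ) P (Bimod.unit C)) :
    Prop where
  isClosed : ε.IsClosed
  left : (ε.whiskerLeft P).IsHomotopyEquiv
  right : (BimHom.whiskerRight P ε).IsHomotopyEquiv

/-- The order `P₁ ≤ P₂` on counital idempotents: there is a closed degree zero map `θ : P₁ → P₂`
with `ε₂ ∘ θ ≃ ε₁`. -/
def CounitalLE {P₁ : Bimod.{w₁} C C} (ε₁ : BimHom (0 : Γ) P₁ (Bimod.unit C))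
    {P₂ : Bimod.{w₂} C C} (ε₂ : BimHom (0 : Γ) P₂ (Bimod.unit C)) : Prop :=
  ∃ θ : BimHom (0 : Γ) P₁ P₂, θ.IsClosed ∧ (ε₂.comp θ).Homotopic ε₁

/-! ## The relative bar complex -/

namespace Bimod

/-- The twist `tw_α M` of a bimodule by a Maurer--Cartan endomorphism `α` of degree `ι`. -/
def twist (M : Bimod.{w} C D) (α : BimHom G.ι M M)
    (mc : ∀ X Y, α.diff X Y + α.app X Y ∘ₗ α.app X Y = 0) : Bimod.{w} C D where
  obj X Y := DGMod.twist (M.obj X Y) (α.app X Y) α.app_mem (fun m => by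
    simpa [BimHom.diff] using LinearMap.congr_fun (mc X Y) m)
  actL := M.actL
  actR := M.actR
  actL_mem := M.actL_mem
  actR_mem := M.actR_mem
  d_actL := by
    intro X' X Y i f (m : M.obj X Y) hf
    change (M.obj X' Y).d (M.actL f m) + α.app X' Y (M.actL f m) =
      M.actL ((C.Hom X' X).d f) m + G.sgn G.ι i • M.actL f ((M.obj X Y).d m + α.app X Y m)
    rw [M.d_actL m hf, α.app_actL m hf, map_add, smul_add, add_assoc]
  d_actR := by
    intro X Y Y' i (m : M.obj X Y) g hm
    change (M.obj X Y').d (M.actR m g) + α.app X Y' (M.actR m g) =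
      M.actR ((M.obj X Y).d m + α.app X Y m) g + G.sgn G.ι i • M.actR m ((D.Hom Y Y').d g)
    rw [M.d_actR g hm, α.app_actR, map_add, LinearMap.add_apply]
    abel
  id_actL := M.id_actL
  actR_id := M.actR_id
  comp_actL := M.comp_actL
  actR_comp := M.actR_comp
  actL_actR := M.actL_actR

end Bimod

/-- For a set `𝒳` of objects of `C` and a bimodule `N`, the bimodule `⨁_{X ∈ 𝒳} |X⟩ ⊗ ⟨X|N`. -/
noncomputable def barStep (𝒳 : Set C.Obj) (N : Bimod.{w} C D) : Bimod.{max u₁ v₁ w} C D :=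
  Bimod.directSum fun X : 𝒳 => Bimod.outer (Bimod.unit C) X.1 N

section barStep

variable {𝒳 : Set C.Obj} {N : Bimod.{w} C D}

/-- The element `f ⊗ n` of the summand indexed by `X`. -/
noncomputable def stepMk (X : 𝒳) {Y : C.Obj} {Z : D.Obj} :
    C.Hom Y X →ₗ[k] N.obj X Z →ₗ[k] (barStep 𝒳 N).obj Y Z :=
  (DGMod.tmul (M := C.Hom Y X) (N := N.obj X Z)).compr₂
    (DGMod.incl (M := fun X : 𝒳 => (Bimod.outer (Bimod.unit C) X.1 N).obj Y Z) X)

/-- The linear map out of `barStep 𝒳 N` given by a family of bilinear maps. -/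
noncomputable def stepLift {Y : C.Obj} {Z : D.Obj} {Q : Type w₃} [AddCommGroup Q] [Module k Q]
    (φ : ∀ X : 𝒳, C.Hom Y X →ₗ[k] N.obj X Z →ₗ[k] Q) : (barStep 𝒳 N).obj Y Z →ₗ[k] Q :=
  DGMod.desc (M := fun X : 𝒳 => (Bimod.outer (Bimod.unit C) X.1 N).obj Y Z)
    fun X => DGMod.tlift (M := C.Hom Y X) (φ X)

theorem stepLift_mk {Y : C.Obj} {Z : D.Obj} {Q : Type w₃} [AddCommGroup Q] [Module k Q]
    (φ : ∀ X : 𝒳, C.Hom Y X →ₗ[k] N.obj X Z →ₗ[k] Q) (X : 𝒳) (f : C.Hom Y X) (n : N.obj X Z) :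
    stepLift φ (stepMk X f n) = φ X f n :=
  (DGMod.desc_incl (M := fun X : 𝒳 => (Bimod.outer (Bimod.unit C) X.1 N).obj Y Z)
    (fun X => DGMod.tlift (M := C.Hom Y X) (φ X)) X (DGMod.tmul f n)).trans
    (DGMod.tlift_tmul (M := C.Hom Y X) _ _ _)

theorem stepMk_mem {X : 𝒳} {Y : C.Obj} {Z : D.Obj} {i j : Γ} {f : C.Hom Y X}
    (hf : f ∈ (C.Hom Y X).gr i) {n : N.obj X Z} (hn : n ∈ (N.obj X Z).gr j) :
    stepMk X f n ∈ ((barStep 𝒳 N).obj Y Z).gr (i + j) :=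
  DGMod.incl_mem (M := fun X : 𝒳 => (Bimod.outer (Bimod.unit C) X.1 N).obj Y Z)
    (DGMod.tmul_mem hf hn)

theorem d_stepMk (X : 𝒳) {Y : C.Obj} {Z : D.Obj} (f : C.Hom Y X) (n : N.obj X Z) :
    ((barStep 𝒳 N).obj Y Z).d (stepMk X f n) = stepMk X ((C.Hom Y X).d f) n +
      stepMk X ((C.Hom Y X).par G.ι f) ((N.obj X Z).d n) := by
  refine (DGMod.d_incl (M := fun X : 𝒳 => (Bimod.outer (Bimod.unit C) X.1 N).obj Y Z) X _).trans ?_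
  exact (congrArg (DGMod.incl (M := fun X : 𝒳 => (Bimod.outer (Bimod.unit C) X.1 N).obj Y Z) X)
    (DGMod.d_tmul (M := C.Hom Y X) f n)).trans (map_add _ _ _)

theorem actL_stepMk (X : 𝒳) {Y' Y : C.Obj} {Z : D.Obj} (g : C.Hom Y' Y) (f : C.Hom Y X)
    (n : N.obj X Z) : (barStep 𝒳 N).actL g (stepMk X f n) = stepMk X (C.comp g f) n :=
  (DGMod.sumLeft_incl (fun X : 𝒳 => (Bimod.outer (Bimod.unit C) X.1 N).actL) g X _).trans
    (congrArg (DGMod.incl (M := fun X : 𝒳 => (Bimod.outer (Bimod.unit C) X.1 N).obj Y' Z) X)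
      (DGMod.onLeft_tmul _ _ _ _))

theorem actR_stepMk (X : 𝒳) {Y : C.Obj} {Z Z' : D.Obj} (g : D.Hom Z Z') (f : C.Hom Y X)
    (n : N.obj X Z) : (barStep 𝒳 N).actR (stepMk X f n) g = stepMk X f (N.actR n g) :=
  (DGMod.sumRight_incl (fun X : 𝒳 => (Bimod.outer (Bimod.unit C) X.1 N).actR) g X _).trans
    (congrArg (DGMod.incl (M := fun X : 𝒳 => (Bimod.outer (Bimod.unit C) X.1 N).obj Y Z') X)
      (DGMod.onRight_tmul _ _ _ _))

theorem step_ind {Y : C.Obj} {Z : D.Obj} {P : (barStep 𝒳 N).obj Y Z → Prop} (zero : P 0)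
    (mk : ∀ (X : 𝒳) (f : C.Hom Y X) (n : N.obj X Z), P (stepMk X f n))
    (add : ∀ s t, P s → P t → P (s + t)) (t : (barStep 𝒳 N).obj Y Z) : P t := by
  refine DGMod.directSum_ind
    (M := fun X : 𝒳 => (Bimod.outer (Bimod.unit C) X.1 N).obj Y Z) zero ?_ add t
  intro X m
  refine DGMod.tensor_ind (M := C.Hom Y X) (N := N.obj X Z) (P := fun m => P (DGMod.incl
    (M := fun X : 𝒳 => (Bimod.outer (Bimod.unit C) X.1 N).obj Y Z) X m)) ?_ ?_ m
  · exact fun i f hf j n hn => mk X f n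
  · intro s t hs ht
    exact (congrArg P ((DGMod.incl (M := fun X : 𝒳 =>
      (Bimod.outer (Bimod.unit C) X.1 N).obj Y Z) X).map_add s t)).mpr (add _ _ hs ht)

theorem step_gr_map {Y : C.Obj} {Z : D.Obj} {Q : Type w₃} [AddCommGroup Q] [Module k Q]
    (φ : (barStep 𝒳 N).obj Y Z →ₗ[k] Q) (S : Submodule k Q) {n : Γ}
    (h : ∀ (X : 𝒳) i j, i + j = n → ∀ f ∈ (C.Hom Y X).gr i, ∀ m ∈ (N.obj X Z).gr j,
      φ (stepMk X f m) ∈ S)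
    {t : (barStep 𝒳 N).obj Y Z} (ht : t ∈ ((barStep 𝒳 N).obj Y Z).gr n) : φ t ∈ S := by
  refine DGMod.directSum_gr_map
    (M := fun X : 𝒳 => (Bimod.outer (Bimod.unit C) X.1 N).obj Y Z) φ S ?_ ht
  intro X m hm
  refine DGMod.tensor_gr_map (M := C.Hom Y X) (N := N.obj X Z) (φ ∘ₗ
    DGMod.incl (M := fun X : 𝒳 => (Bimod.outer (Bimod.unit C) X.1 N).obj Y Z) X) S ?_ hm
  exact fun i j hij a ha b hb => h X i j hij a ha b hb

end barStep

/-- The action map `⨁_X |X⟩ ⊗ ⟨X|N → N`, `f ⊗ n ↦ f · n`. -/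
noncomputable def stepMul (𝒳 : Set C.Obj) (N : Bimod.{w} C D) :
    BimHom (0 : Γ) (barStep 𝒳 N) N where
  app Y Z := stepLift fun X => N.actL
  app_mem := by
    intro Y Z n t ht
    refine step_gr_map _ _ ?_ ht
    rintro X i j rfl f hf m hm
    rw [stepLift_mk, add_zero]
    exact N.actL_mem hf hm
  app_actL := by
    intro Y' Y Z i g t hg
    rw [G.sgn_zero_left, one_smul]
    induction t using step_ind with
    | zero => simp
    | add s t hs ht => simp only [map_add, hs, ht]
    | mk X f n => rw [actL_stepMk, stepLift_mk, stepLift_mk, N.comp_actL]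
  app_actR := by
    intro Y Z Z' t g
    induction t using step_ind with
    | zero => simp
    | add s t hs ht => simp only [map_add, LinearMap.add_apply, hs, ht]
    | mk X f n => rw [actR_stepMk, stepLift_mk, stepLift_mk, N.actL_actR]

theorem stepMul_mk {𝒳 : Set C.Obj} {N : Bimod.{w} C D} (X : 𝒳) {Y : C.Obj} {Z : D.Obj}
    (f : C.Hom Y X) (n : N.obj X Z) : (stepMul 𝒳 N).app Y Z (stepMk X f n) = N.actL f n :=
  stepLift_mk _ _ _ _

/-- The map `f ⊗ n ↦ f ⊗ φ(n)` induced by a bimodule map `φ` of degree zero. -/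
noncomputable def stepMap (𝒳 : Set C.Obj) {N : Bimod.{w₁} C D} {N' : Bimod.{w₂} C D}
    (φ : BimHom (0 : Γ) N N') : BimHom (0 : Γ) (barStep 𝒳 N) (barStep 𝒳 N') where
  app Y Z := stepLift fun X => (stepMk X).compl₂ (φ.app X Z)
  app_mem := by
    intro Y Z n t ht
    refine step_gr_map _ _ ?_ ht
    rintro X i j rfl f hf m hm
    rw [stepLift_mk, add_assoc]
    exact stepMk_mem hf (φ.app_mem hm)
  app_actL := by
    intro Y' Y Z i g t hg
    rw [G.sgn_zero_left, one_smul]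
    induction t using step_ind with
    | zero => simp
    | add s t hs ht => simp only [map_add, hs, ht]
    | mk X f n =>
      rw [actL_stepMk, stepLift_mk, stepLift_mk, LinearMap.compl₂_apply, LinearMap.compl₂_apply,
        actL_stepMk]
  app_actR := by
    intro Y Z Z' t g
    induction t using step_ind with
    | zero => simp
    | add s t hs ht => simp only [map_add, LinearMap.add_apply, hs, ht]
    | mk X f n =>
      rw [actR_stepMk, stepLift_mk, stepLift_mk, LinearMap.compl₂_apply, LinearMap.compl₂_apply,
        actR_stepMk, φ.app_actR]

theorem stepMap_mk {𝒳 : Set C.Obj} {N : Bimod.{w₁} C D} {N' : Bimod.{w₂} C D}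
    (φ : BimHom (0 : Γ) N N') (X : 𝒳) {Y : C.Obj} {Z : D.Obj} (f : C.Hom Y X) (n : N.obj X Z) :
    (stepMap 𝒳 φ).app Y Z (stepMk X f n) = stepMk X f (φ.app X Z n) :=
  stepLift_mk _ _ _ _

section bar

variable (𝒳 : Set C.Obj)

/-- The bimodule `⨁_{X₀, …, X_r ∈ 𝒳} |X₀⟩ ⊗ ⟨X₀|X₁⟩ ⊗ ⋯ ⊗ ⟨X_{r-1}|X_r⟩ ⊗ ⟨X_r|`. -/
noncomputable def barTerm : ℕ → Bimod.{max u₁ v₁} C C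
  | 0 => barStep 𝒳 (Bimod.unit C)
  | r + 1 => barStep 𝒳 (barTerm r)

/-- The alternating sum of the face maps,
`[f₀, …, f_{r+2}] ↦ ∑_{0 ≤ i ≤ r+1} (-1) ^ i [f₀, …, f_i ∘ f_{i+1}, …, f_{r+2}]`. For
`w = [f₁, …, f_{r+2}]` this is `[f₀] ⊗ w ↦ f₀ · w - [f₀] ⊗ δ(w)`. -/
noncomputable def barFace : ∀ r, BimHom (0 : Γ) (barTerm 𝒳 (r + 1)) (barTerm 𝒳 r)
  | 0 => (stepMul 𝒳 (barTerm 𝒳 0)).sub (stepMap 𝒳 (stepMul 𝒳 (Bimod.unit C)))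
  | r + 1 => (stepMul 𝒳 (barTerm 𝒳 (r + 1))).sub (stepMap 𝒳 (barFace r))

theorem stepMul_natural {N : Bimod.{w₁} C D} {N' : Bimod.{w₂} C D} (φ : BimHom (0 : Γ) N N')
    {Y : C.Obj} {Z : D.Obj} (t : (barStep 𝒳 N).obj Y Z) :
    φ.app Y Z ((stepMul 𝒳 N).app Y Z t) = (stepMul 𝒳 N').app Y Z ((stepMap 𝒳 φ).app Y Z t) := by
  induction t using step_ind with
  | zero => simp
  | add s t hs ht => simp only [map_add, hs, ht]
  | mk X f n => rw [stepMul_mk, stepMap_mk, stepMul_mk, φ.app_actL_zero]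

theorem stepMul_closed (N : Bimod.{w} C D) {Y : C.Obj} {Z : D.Obj} (t : (barStep 𝒳 N).obj Y Z) :
    (N.obj Y Z).d ((stepMul 𝒳 N).app Y Z t) =
      (stepMul 𝒳 N).app Y Z (((barStep 𝒳 N).obj Y Z).d t) := by
  induction t using step_ind with
  | zero => simp
  | add s t hs ht => simp only [map_add, hs, ht]
  | mk X f n => rw [d_stepMk, map_add, stepMul_mk, stepMul_mk, stepMul_mk, N.d_actL_par]

theorem stepMap_closed {N : Bimod.{w₁} C D} {N' : Bimod.{w₂} C D} (φ : BimHom (0 : Γ) N N')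
    (hφ : ∀ {Y Z} (n : N.obj Y Z), (N'.obj Y Z).d (φ.app Y Z n) = φ.app Y Z ((N.obj Y Z).d n))
    {Y : C.Obj} {Z : D.Obj} (t : (barStep 𝒳 N).obj Y Z) :
    ((barStep 𝒳 N').obj Y Z).d ((stepMap 𝒳 φ).app Y Z t) =
      (stepMap 𝒳 φ).app Y Z (((barStep 𝒳 N).obj Y Z).d t) := by
  induction t using step_ind with
  | zero => simp
  | add s t hs ht => simp only [map_add, hs, ht]
  | mk X f n => rw [d_stepMk, map_add, stepMap_mk, stepMap_mk, stepMap_mk, d_stepMk, hφ]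

theorem stepMap_comp_eq_zero {N : Bimod.{w₁} C D} {N' : Bimod.{w₂} C D} {N'' : Bimod.{w₃} C D}
    (φ : BimHom (0 : Γ) N N') (ψ : BimHom (0 : Γ) N' N'')
    (h : ∀ {Y Z} (n : N.obj Y Z), ψ.app Y Z (φ.app Y Z n) = 0)
    {Y : C.Obj} {Z : D.Obj} (t : (barStep 𝒳 N).obj Y Z) :
    (stepMap 𝒳 ψ).app Y Z ((stepMap 𝒳 φ).app Y Z t) = 0 := by
  induction t using step_ind with
  | zero => simp
  | add s t hs ht => simp only [map_add, hs, ht, add_zero]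
  | mk X f n => rw [stepMap_mk, stepMap_mk, h, map_zero]

theorem barFace_closed (r : ℕ) {Y Z : C.Obj} (t : (barTerm 𝒳 (r + 1)).obj Y Z) :
    ((barTerm 𝒳 r).obj Y Z).d ((barFace 𝒳 r).app Y Z t) =
      (barFace 𝒳 r).app Y Z (((barTerm 𝒳 (r + 1)).obj Y Z).d t) := by
  induction r generalizing Y Z with
  | zero =>
    refine (map_sub ((barTerm 𝒳 0).obj Y Z).d _ _).trans ?_
    refine congrArg₂ (· - ·) (stepMul_closed 𝒳 _ t) ?_
    exact stepMap_closed 𝒳 _ (fun n => stepMul_closed 𝒳 _ n) t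
  | succ r ih =>
    refine (map_sub ((barTerm 𝒳 (r + 1)).obj Y Z).d _ _).trans ?_
    refine congrArg₂ (· - ·) (stepMul_closed 𝒳 _ t) ?_
    exact stepMap_closed 𝒳 _ (fun n => ih n) t

theorem counit_barFace {Y Z : C.Obj} (t : (barTerm 𝒳 1).obj Y Z) :
    (stepMul 𝒳 (Bimod.unit C)).app Y Z ((barFace 𝒳 0).app Y Z t) = 0 := by
  refine (map_sub ((stepMul 𝒳 (Bimod.unit C)).app Y Z) _ _).trans (sub_eq_zero.2 ?_)
  exact stepMul_natural 𝒳 (stepMul 𝒳 (Bimod.unit C)) t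

theorem barFace_barFace (r : ℕ) {Y Z : C.Obj} (t : (barTerm 𝒳 (r + 2)).obj Y Z) :
    (barFace 𝒳 r).app Y Z ((barFace 𝒳 (r + 1)).app Y Z t) = 0 := by
  induction r generalizing Y Z with
  | zero =>
    refine (map_sub ((barFace 𝒳 0).app Y Z) _ _).trans ?_
    refine (congrArg (· - _) (stepMul_natural 𝒳 (barFace 𝒳 0) t)).trans ?_
    refine (sub_sub_cancel _ _).trans ?_
    exact stepMap_comp_eq_zero 𝒳 _ _ (fun n => counit_barFace 𝒳 n) t
  | succ r ih =>
    refine (map_sub ((barFace 𝒳 (r + 1)).app Y Z) _ _).trans ?_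
    refine (congrArg (· - _) (stepMul_natural 𝒳 (barFace 𝒳 (r + 1)) t)).trans ?_
    refine (sub_sub_cancel _ _).trans ?_
    exact stepMap_comp_eq_zero 𝒳 _ _ (fun n => ih n) t

/-- The underlying untwisted bimodule `⨁_r q ^ (-r ι) barTerm r` of the bar complex. -/
noncomputable def barSum : Bimod.{max u₁ v₁} C C :=
  Bimod.directSum fun r : ℕ => Bimod.shift (-(r • G.ι)) (barTerm 𝒳 r)

/-- The element of `barSum` given by an element of `barTerm r`. -/
noncomputable def barIncl (r : ℕ) {Y Z : C.Obj} :
    (barTerm 𝒳 r).obj Y Z →ₗ[k] (barSum 𝒳).obj Y Z :=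
  DGMod.incl (M := fun r : ℕ => (Bimod.shift (-(r • G.ι)) (barTerm 𝒳 r)).obj Y Z) r ∘ₗ
    (DGMod.toShift (-(r • G.ι)) ((barTerm 𝒳 r).obj Y Z)).toLinearMap

/-- The linear map out of `barSum` given by linear maps out of the `barTerm r`. -/
noncomputable def barLift {Y Z : C.Obj} {Q : Type w₃} [AddCommGroup Q] [Module k Q]
    (φ : ∀ r, (barTerm 𝒳 r).obj Y Z →ₗ[k] Q) : (barSum 𝒳).obj Y Z →ₗ[k] Q :=
  DGMod.desc (M := fun r : ℕ => (Bimod.shift (-(r • G.ι)) (barTerm 𝒳 r)).obj Y Z) fun r =>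
    φ r ∘ₗ (DGMod.toShift (-(r • G.ι)) ((barTerm 𝒳 r).obj Y Z)).symm.toLinearMap

theorem barLift_incl {Y Z : C.Obj} {Q : Type w₃} [AddCommGroup Q] [Module k Q]
    (φ : ∀ r, (barTerm 𝒳 r).obj Y Z →ₗ[k] Q) (r : ℕ) (t : (barTerm 𝒳 r).obj Y Z) :
    barLift 𝒳 φ (barIncl 𝒳 r t) = φ r t :=
  DGMod.desc_incl (M := fun r : ℕ => (Bimod.shift (-(r • G.ι)) (barTerm 𝒳 r)).obj Y Z) _ r _

theorem bar_ind {Y Z : C.Obj} {P : (barSum 𝒳).obj Y Z → Prop} (zero : P 0)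
    (incl : ∀ r t, P (barIncl 𝒳 r t)) (add : ∀ s t, P s → P t → P (s + t))
    (t : (barSum 𝒳).obj Y Z) : P t :=
  DGMod.directSum_ind (M := fun r : ℕ => (Bimod.shift (-(r • G.ι)) (barTerm 𝒳 r)).obj Y Z) zero
    (fun r t => incl r t) add t

theorem bar_gr_map {Y Z : C.Obj} {Q : Type w₃} [AddCommGroup Q] [Module k Q]
    (φ : (barSum 𝒳).obj Y Z →ₗ[k] Q) (S : Submodule k Q) {n : Γ}
    (h : ∀ r, ∀ t ∈ ((barTerm 𝒳 r).obj Y Z).gr (n + r • G.ι), φ (barIncl 𝒳 r t) ∈ S)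
    {t : (barSum 𝒳).obj Y Z} (ht : t ∈ ((barSum 𝒳).obj Y Z).gr n) : φ t ∈ S := by
  refine DGMod.directSum_gr_map
    (M := fun r : ℕ => (Bimod.shift (-(r • G.ι)) (barTerm 𝒳 r)).obj Y Z) φ S ?_ ht
  intro r m hm
  refine h r m ?_
  have : m ∈ ((barTerm 𝒳 r).obj Y Z).gr (n - -(r • G.ι)) := hm
  rwa [sub_neg_eq_add] at this

theorem barIncl_mem {Y Z : C.Obj} {n : Γ} {r : ℕ} {t : (barTerm 𝒳 r).obj Y Z}
    (ht : t ∈ ((barTerm 𝒳 r).obj Y Z).gr (n + r • G.ι)) :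
    barIncl 𝒳 r t ∈ ((barSum 𝒳).obj Y Z).gr n := by
  refine DGMod.incl_mem
    (M := fun r : ℕ => (Bimod.shift (-(r • G.ι)) (barTerm 𝒳 r)).obj Y Z) ?_
  refine DGMod.toShift_mem.2 ?_
  rwa [sub_neg_eq_add]

theorem d_barIncl {Y Z : C.Obj} (r : ℕ) (t : (barTerm 𝒳 r).obj Y Z) :
    ((barSum 𝒳).obj Y Z).d (barIncl 𝒳 r t) =
      G.sgn (r • G.ι) G.ι • barIncl 𝒳 r (((barTerm 𝒳 r).obj Y Z).d t) := by
  rw [← G.sgn_neg_left]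
  refine (DGMod.d_incl
    (M := fun r : ℕ => (Bimod.shift (-(r • G.ι)) (barTerm 𝒳 r)).obj Y Z) r _).trans ?_
  exact map_zsmul (DGMod.incl
    (M := fun r : ℕ => (Bimod.shift (-(r • G.ι)) (barTerm 𝒳 r)).obj Y Z) r) _ _

theorem actL_barIncl {Y' Y Z : C.Obj} (r : ℕ) (g : C.Hom Y' Y) (t : (barTerm 𝒳 r).obj Y Z) :
    (barSum 𝒳).actL g (barIncl 𝒳 r t) =
      barIncl 𝒳 r ((barTerm 𝒳 r).actL ((C.Hom Y' Y).par (-(r • G.ι)) g) t) :=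
  DGMod.sumLeft_incl (M := fun r : ℕ => (Bimod.shift (-(r • G.ι)) (barTerm 𝒳 r)).obj Y Z)
    (fun r : ℕ => (Bimod.shift (-(r • G.ι)) (barTerm 𝒳 r)).actL) g r _

theorem actR_barIncl {Y Z Z' : C.Obj} (r : ℕ) (g : C.Hom Z Z') (t : (barTerm 𝒳 r).obj Y Z) :
    (barSum 𝒳).actR (barIncl 𝒳 r t) g = barIncl 𝒳 r ((barTerm 𝒳 r).actR t g) :=
  DGMod.sumRight_incl (M := fun r : ℕ => (Bimod.shift (-(r • G.ι)) (barTerm 𝒳 r)).obj Y Z)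
    (fun r : ℕ => (Bimod.shift (-(r • G.ι)) (barTerm 𝒳 r)).actR) g r _

/-- The components of the bar differential. -/
noncomputable def barTwistApp {Y Z : C.Obj} :
    ∀ r, (barTerm 𝒳 r).obj Y Z →ₗ[k] (barSum 𝒳).obj Y Z
  | 0 => 0
  | r + 1 => barIncl 𝒳 r ∘ₗ (barFace 𝒳 r).app Y Z

/-- The bar differential, as an endomorphism of degree `ι`. -/
noncomputable def barTwist : BimHom G.ι (barSum 𝒳) (barSum 𝒳) where
  app Y Z := barLift 𝒳 (barTwistApp 𝒳)
  app_mem := by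
    intro Y Z n t ht
    refine bar_gr_map 𝒳 _ _ ?_ ht
    intro r t ht
    rw [barLift_incl]
    cases r with
    | zero => exact Submodule.zero_mem _
    | succ r =>
      refine barIncl_mem 𝒳 ?_
      have := (barFace 𝒳 r).app_mem ht
      rwa [add_zero, succ_nsmul', ← add_assoc] at this
  app_actL := by
    intro Y' Y Z i g t hg
    induction t using bar_ind with
    | zero => simp
    | add s t hs ht => simp only [map_add, smul_add, hs, ht]
    | incl r t =>
      rw [actL_barIncl, barLift_incl, barLift_incl, DGMod.par_of_mem _ _ hg]
      cases r with
      | zero => simp [barTwistApp]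
      | succ r =>
        simp only [barTwistApp, LinearMap.comp_apply, map_zsmul, LinearMap.smul_apply,
          actL_barIncl, (barFace 𝒳 r).app_actL_zero, DGMod.par_of_mem _ _ hg, smul_smul,
          G.sgn_neg_left, succ_nsmul', G.sgn_add_left]
  app_actR := by
    intro Y Z Z' t g
    induction t using bar_ind with
    | zero => simp
    | add s t hs ht => simp only [map_add, LinearMap.add_apply, hs, ht]
    | incl r t =>
      rw [actR_barIncl, barLift_incl, barLift_incl]
      cases r with
      | zero => simp [barTwistApp]
      | succ r =>
        simp only [barTwistApp, LinearMap.comp_apply, actR_barIncl, (barFace 𝒳 r).app_actR]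

theorem barTwist_mc (Y Z : C.Obj) : (barTwist 𝒳).diff Y Z +
    (barTwist 𝒳).app Y Z ∘ₗ (barTwist 𝒳).app Y Z = 0 := by
  ext t
  simp only [BimHom.diff, LinearMap.add_apply, LinearMap.sub_apply, LinearMap.comp_apply,
    LinearMap.smul_apply, LinearMap.zero_apply, G.sgn_ι, barTwist]
  induction t using bar_ind with
  | zero => simp
  | add s t hs ht =>
    simp only [map_add, smul_add]
    rw [← add_zero (0 : (barSum 𝒳).obj Y Z)]
    nth_rewrite 1 [← hs]
    rw [← ht]
    abel
  | incl r t =>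
    rw [d_barIncl, map_zsmul, barLift_incl, barLift_incl]
    cases r with
    | zero => simp [barTwistApp]
    | succ r =>
      simp only [barTwistApp, LinearMap.comp_apply, d_barIncl, barFace_closed, barLift_incl,
        succ_nsmul', G.sgn_add_left, G.sgn_ι]
      cases r with
      | zero => simp
      | succ r =>
        simp only [LinearMap.comp_apply, barFace_barFace, map_zero]
        simp

/-- The two-sided bar complex of `C` relative to a set `𝒳` of objects,
`tw_δ (⨁_r q ^ (-r ι) ⨁_{X₀, …, X_r ∈ 𝒳} |X₀⟩ ⊗ ⟨X₀|X₁⟩ ⊗ ⋯ ⊗ ⟨X_{r-1}|X_r⟩ ⊗ ⟨X_r|)`. -/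
noncomputable def Bar : Bimod.{max u₁ v₁} C C :=
  (barSum 𝒳).twist (barTwist 𝒳) (barTwist_mc 𝒳)

/-- The components of the counit. -/
noncomputable def counitApp {Y Z : C.Obj} :
    ∀ r, (barTerm 𝒳 r).obj Y Z →ₗ[k] (Bimod.unit C).obj Y Z
  | 0 => (stepMul 𝒳 (Bimod.unit C)).app Y Z
  | _ + 1 => 0

/-- The counit on the underlying untwisted bimodule. -/
noncomputable def counitSum : BimHom (0 : Γ) (barSum 𝒳) (Bimod.unit C) where
  app Y Z := barLift 𝒳 (counitApp 𝒳)
  app_mem := by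
    intro Y Z n t ht
    refine bar_gr_map 𝒳 _ _ ?_ ht
    intro r t ht
    rw [barLift_incl]
    cases r with
    | zero =>
      rw [zero_nsmul, add_zero] at ht
      exact (stepMul 𝒳 (Bimod.unit C)).app_mem ht
    | succ r => exact Submodule.zero_mem _
  app_actL := by
    intro Y' Y Z i g t hg
    rw [G.sgn_zero_left, one_smul]
    induction t using bar_ind with
    | zero => simp
    | add s t hs ht => simp only [map_add, hs, ht]
    | incl r t =>
      rw [actL_barIncl, barLift_incl, barLift_incl, DGMod.par_of_mem _ _ hg]
      cases r with
      | zero =>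
        rw [zero_nsmul, neg_zero, G.sgn_zero_left, one_smul]
        exact (stepMul 𝒳 (Bimod.unit C)).app_actL_zero g t
      | succ r => simp [counitApp]
  app_actR := by
    intro Y Z Z' t g
    induction t using bar_ind with
    | zero => simp
    | add s t hs ht => simp only [map_add, LinearMap.add_apply, hs, ht]
    | incl r t =>
      rw [actR_barIncl, barLift_incl, barLift_incl]
      cases r with
      | zero => exact (stepMul 𝒳 (Bimod.unit C)).app_actR t g
      | succ r => simp [counitApp]

/-- The counit `Bar(C, 𝒳) → C`, which sends `[f₀, f₁]` to `f₀ ∘ f₁` and vanishes on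
`[f₀, …, f_{r+1}]` for `r > 0`. -/
noncomputable def counit : BimHom (0 : Γ) (Bar 𝒳) (Bimod.unit C) where
  app := (counitSum 𝒳).app
  app_mem := (counitSum 𝒳).app_mem
  app_actL := (counitSum 𝒳).app_actL
  app_actR := (counitSum 𝒳).app_actR

end bar

end

end DGBar

/-! ### Sign operators on graded modules. -/

namespace DGBar

noncomputable section

variable {Γ : Type x} [AddCommGroup Γ] {G : Grading Γ} {k : Type y} [CommRing k]

/-! Write P for a bar complex and ε for its counit. Two structures on P carry the whole argument.

The first is a comultiplication Δ : P → P ⊗ P (`comul`). It cuts a chain at each of its objects X_i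
and inserts identities there: [f₀, …, f_{r+1}] goes to the sum over i of ± [f₀, …, f_i, 1] ⊗ [1,
f_{i+1}, …, f_{r+1}]. It is closed and strictly counital: (ε ⊗ 1)Δ = 1 = (1 ⊗ ε)Δ (`comul_isClosed`,
`whiskerLeft_comul`, `whiskerRight_comul`). The second is concatenation P ⊗ P → P of degree -ι
(`conc`), which glues two chains by composing the last entry of one with the first entry of the
other. Its differential is ε ⊗ 1 - 1 ⊗ ε (`d_conc`), so these two maps P ⊗ P → P are homotopic.

These facts alone make P a counital idempotent (`isCounitalIdempotent_of_comul`). Strict counitality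
says that Δ is a right inverse of ε ⊗ 1. For the other composite, left linearity of Δ gives Δ(ε ⊗ 1)
= (ε ⊗ 1 ⊗ 1)(1 ⊗ Δ); this is homotopic to (1 ⊗ ε ⊗ 1)(1 ⊗ Δ), which is the identity by balancing
and counitality. The map 1 ⊗ ε is treated by the mirror argument. Coassociativity is never needed.

The same data make P rigid over its counit (`homotopic_id_of_counit`): if φ : P → P is closed and εφ
≃ ε, then φ = φ(ε ⊗ 1)Δ = (ε ⊗ 1)(1 ⊗ φ)Δ ≃ (1 ⊗ ε)(1 ⊗ φ)Δ = (1 ⊗ εφ)Δ ≃ (1 ⊗ ε)Δ = 1.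

For 𝒳 ⊆ 𝒴 the evident inclusion θ of bar complexes is closed and strictly compatible with the
counits, which gives the order relation. Given Ξ in the opposite direction over the counits, θΞ and
Ξθ are endomorphisms over the counits, hence homotopic to identities by rigidity; so θ inverts Ξ.

The computations with chains run on two kinds of generators: [f, h], and f prefixed to a chain w
(`barCons`). The sign in `barCons` places the shift symbol between f and w rather than in front,
which makes prefixing left linear and puts the whole bar differential into one formula independent
of the length of w (`d_barCons`). -/

theorem DGMod.par_comm (M : DGMod.{w} G k) (i j : Γ) (m : M) :
    M.par i (M.par j m) = M.par j (M.par i m) := by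
  induction m using M.ind with
  | add m n hm hn => simp only [map_add, hm, hn]
  | homog l m hm =>
    simp only [M.par_of_mem _ hm, map_zsmul, smul_smul, mul_comm]

@[simp] theorem DGMod.par_par (M : DGMod.{w} G k) (j : Γ) (m : M) : M.par j (M.par j m) = m := by
  induction m using M.ind with
  | add m n hm hn => simp only [map_add, hm, hn]
  | homog l m hm =>
    simp only [M.par_of_mem _ hm, map_zsmul, smul_smul, G.sgn_mul_self, one_smul]

@[simp] theorem DGMod.par_zero (M : DGMod.{w} G k) (m : M) : M.par 0 m = m := by
  induction m using M.ind with
  | add m n hm hn => simp only [map_add, hm, hn]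
  | homog l m hm => rw [M.par_of_mem _ hm, G.sgn_zero_left, one_smul]

theorem DGMod.par_add (M : DGMod.{w} G k) (i j : Γ) (m : M) :
    M.par (i + j) m = M.par i (M.par j m) := by
  induction m using M.ind with
  | add m n hm hn => simp only [map_add, hm, hn]
  | homog l m hm =>
    simp only [M.par_of_mem _ hm, map_zsmul, smul_smul, G.sgn_add_left, mul_comm]

theorem DGMod.par_neg (M : DGMod.{w} G k) (j : Γ) (m : M) : M.par (-j) m = M.par j m := by
  induction m using M.ind with
  | add m n hm hn => simp only [map_add, hm, hn]
  | homog l m hm => rw [M.par_of_mem _ hm, M.par_of_mem _ hm, G.sgn_neg_left]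

/-- Homotopies between maps of degree zero have degree `0 - G.ι`, and this expression occurs in
their type, so signs are computed for it unreduced. -/
theorem Grading.sgn_zero_sub_ι (j : Γ) : G.sgn (0 - G.ι) j = G.sgn G.ι j := by
  rw [zero_sub, G.sgn_neg_left]

theorem Grading.sgn_ι_zero_sub_ι : G.sgn G.ι (0 - G.ι) = -1 := by
  rw [G.sgn_symm, G.sgn_zero_sub_ι, G.sgn_ι]

theorem DGMod.sgn_ι_smul (M : DGMod.{w} G k) (m : M) : G.sgn G.ι G.ι • m = -m := by
  rw [G.sgn_ι, neg_smul, one_smul]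

/-- The trilinear map `(b, e, a) ↦ γ (β a b) e`. -/
def flipComp {A : Type u} {B : Type v} {D : Type w₁} {E : Type w₂} {T : Type w₃}
    [AddCommGroup A] [Module k A] [AddCommGroup B] [Module k B] [AddCommGroup D] [Module k D]
    [AddCommGroup E] [Module k E] [AddCommGroup T] [Module k T]
    (β : A →ₗ[k] B →ₗ[k] D) (γ : D →ₗ[k] E →ₗ[k] T) : B →ₗ[k] E →ₗ[k] A →ₗ[k] T where
  toFun b := (γ ∘ₗ β.flip b).flip
  map_add' b b' := by ext; simp
  map_smul' c b := by ext; simp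

namespace BimHom

variable {B : DGCat.{u, v} G k} {C : DGCat.{u₁, v₁} G k} {D : DGCat.{u₂, v₂} G k}

/-! ### Calculus of closed maps and homotopies. -/

section basic

variable {M : Bimod.{w₁} C D} {N : Bimod.{w₂} C D} {P : Bimod.{w₃} C D} {l : Γ}

@[ext] theorem ext {φ ψ : BimHom l M N} (h : ∀ X Y m, φ.app X Y m = ψ.app X Y m) : φ = ψ := by
  have : φ.app = ψ.app := funext fun X => funext fun Y => LinearMap.ext (h X Y)
  cases φ; cases ψ; cases this; rfl

/-- A bimodule map of degree `l`, given by linear maps `φ` with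
`φ (g · m) = (-1) ^ ⟨l, |g|⟩ g · φ m`. -/
def ofPar (l : Γ) (app : ∀ X Y, M.obj X Y →ₗ[k] N.obj X Y)
    (mem : ∀ {X Y} {i : Γ} {m : M.obj X Y}, m ∈ (M.obj X Y).gr i →
      app X Y m ∈ (N.obj X Y).gr (i + l))
    (actL : ∀ {X' X Y} (g : C.Hom X' X) (m : M.obj X Y),
      app X' Y (M.actL g m) = N.actL ((C.Hom X' X).par l g) (app X Y m))
    (actR : ∀ {X Y Y'} (m : M.obj X Y) (g : D.Hom Y Y'),
      app X Y' (M.actR m g) = N.actR (app X Y m) g) : BimHom l M N where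
  app := app
  app_mem := mem
  app_actL m hg := by
    rw [actL, DGMod.par_of_mem _ _ hg, map_zsmul, LinearMap.smul_apply]
  app_actR := actR

/-- A bimodule map of degree zero, given by linear maps which preserve degrees and actions. -/
def ofZero (app : ∀ X Y, M.obj X Y →ₗ[k] N.obj X Y)
    (mem : ∀ {X Y} {i : Γ} {m : M.obj X Y}, m ∈ (M.obj X Y).gr i →
      app X Y m ∈ (N.obj X Y).gr i)
    (actL : ∀ {X' X Y} (g : C.Hom X' X) (m : M.obj X Y),
      app X' Y (M.actL g m) = N.actL g (app X Y m))
    (actR : ∀ {X Y Y'} (m : M.obj X Y) (g : D.Hom Y Y'),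
      app X Y' (M.actR m g) = N.actR (app X Y m) g) : BimHom (0 : Γ) M N where
  app := app
  app_mem h := by rw [add_zero]; exact mem h
  app_actL m _ := by rw [actL, G.sgn_zero_left, one_smul]
  app_actR := actR

@[simp] theorem id_app (X Y) (m : M.obj X Y) : (id M).app X Y m = m := rfl

@[simp] theorem comp_app (ψ : BimHom (0 : Γ) N P) (φ : BimHom (0 : Γ) M N) (X Y)
    (m : M.obj X Y) : (ψ.comp φ).app X Y m = ψ.app X Y (φ.app X Y m) := rfl

theorem diff_apply (φ : BimHom l M N) (X Y) (m : M.obj X Y) : φ.diff X Y m =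
    (N.obj X Y).d (φ.app X Y m) - G.sgn G.ι l • φ.app X Y ((M.obj X Y).d m) := rfl

theorem isClosed_iff {φ : BimHom (0 : Γ) M N} : φ.IsClosed ↔
    ∀ X Y m, (N.obj X Y).d (φ.app X Y m) = φ.app X Y ((M.obj X Y).d m) := by
  refine forall_congr' fun X => forall_congr' fun Y => ?_
  rw [LinearMap.ext_iff]
  refine forall_congr' fun m => ?_
  rw [diff_apply, G.sgn_zero_right, one_smul, LinearMap.zero_apply, sub_eq_zero]

/-- A homotopy has degree `-ι` and `⟨ι, -ι⟩ = 1`, so the general differential becomes the familiar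
`dh + hd`. -/
theorem homotopic_iff {φ ψ : BimHom (0 : Γ) M N} : φ.Homotopic ψ ↔
    ∃ h : BimHom (0 - G.ι) M N, ∀ X Y m, φ.app X Y m - ψ.app X Y m =
      (N.obj X Y).d (h.app X Y m) + h.app X Y ((M.obj X Y).d m) := by
  refine exists_congr fun h => forall_congr' fun X => forall_congr' fun Y => ?_
  rw [LinearMap.ext_iff]
  refine forall_congr' fun m => ?_
  rw [diff_apply, G.sgn_ι_zero_sub_ι, neg_smul, one_smul, sub_neg_eq_add, LinearMap.sub_apply]

theorem app_mem_zero (φ : BimHom (0 : Γ) M N) {X Y} {i : Γ} {m : M.obj X Y}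
    (hm : m ∈ (M.obj X Y).gr i) : φ.app X Y m ∈ (N.obj X Y).gr i := by
  simpa using φ.app_mem hm

/-- A map of degree `l` moves degree `i` to `i + l`, so the sign operator before and after the map
differs by `(-1) ^ ⟨j, l⟩`. -/
theorem app_par (φ : BimHom l M N) (j : Γ) {X Y} (m : M.obj X Y) :
    φ.app X Y ((M.obj X Y).par j m) = G.sgn j l • (N.obj X Y).par j (φ.app X Y m) := by
  induction m using DGMod.ind with
  | add m m' h h' => simp only [map_add, smul_add, h, h']
  | homog i m hm =>
    rw [DGMod.par_of_mem _ _ hm, DGMod.par_of_mem _ _ (φ.app_mem hm), map_zsmul, smul_smul,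
      G.sgn_add_right, mul_left_comm, G.sgn_mul_self, mul_one]

theorem isClosed_id : (id M).IsClosed := isClosed_iff.2 fun _ _ _ => rfl

theorem IsClosed.comp {ψ : BimHom (0 : Γ) N P} {φ : BimHom (0 : Γ) M N} (hψ : ψ.IsClosed)
    (hφ : φ.IsClosed) : (ψ.comp φ).IsClosed := by
  rw [isClosed_iff] at *
  intro X Y m
  rw [comp_app, comp_app, hψ, hφ]

/-- The zero map. -/
def zero (l : Γ) (M : Bimod.{w₁} C D) (N : Bimod.{w₂} C D) : BimHom l M N where
  app _ _ := 0
  app_mem _ := Submodule.zero_mem _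
  app_actL _ _ := by simp
  app_actR _ _ := by simp

/-- The sum of two bimodule maps. -/
def add (φ ψ : BimHom l M N) : BimHom l M N where
  app X Y := φ.app X Y + ψ.app X Y
  app_mem h := Submodule.add_mem _ (φ.app_mem h) (ψ.app_mem h)
  app_actL m hg := by simp [φ.app_actL m hg, ψ.app_actL m hg, smul_add]
  app_actR m g := by simp [φ.app_actR, ψ.app_actR]

/-- Composition of a bimodule map of degree `l` with one of degree zero. -/
def postcomp (ψ : BimHom (0 : Γ) N P) (φ : BimHom l M N) : BimHom l M P where
  app X Y := ψ.app X Y ∘ₗ φ.app X Y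
  app_mem h := ψ.app_mem_zero (φ.app_mem h)
  app_actL m hg := by simp [φ.app_actL m hg, ψ.app_actL_zero]
  app_actR m g := by simp [φ.app_actR, ψ.app_actR]

/-- Composition of a bimodule map of degree zero with one of degree `l`. -/
def precomp (ψ : BimHom l N P) (φ : BimHom (0 : Γ) M N) : BimHom l M P where
  app X Y := ψ.app X Y ∘ₗ φ.app X Y
  app_mem h := ψ.app_mem (φ.app_mem_zero h)
  app_actL m hg := by simp [φ.app_actL_zero, ψ.app_actL _ hg]
  app_actR m g := by simp [φ.app_actR, ψ.app_actR]

theorem Homotopic.refl (φ : BimHom (0 : Γ) M N) : φ.Homotopic φ :=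
  homotopic_iff.2 ⟨zero _ M N, fun X Y m => by simp [zero]⟩

theorem Homotopic.symm {φ ψ : BimHom (0 : Γ) M N} (h : φ.Homotopic ψ) : ψ.Homotopic φ := by
  rw [homotopic_iff] at *
  obtain ⟨h, e⟩ := h
  refine ⟨(zero _ M N).sub h, fun X Y m => ?_⟩
  rw [← neg_sub, e]
  simp only [sub, zero, zero_sub, LinearMap.neg_apply, map_neg]
  abel

theorem Homotopic.trans {φ ψ χ : BimHom (0 : Γ) M N} (h₁ : φ.Homotopic ψ)
    (h₂ : ψ.Homotopic χ) : φ.Homotopic χ := by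
  rw [homotopic_iff] at *
  obtain ⟨h₁, e₁⟩ := h₁
  obtain ⟨h₂, e₂⟩ := h₂
  refine ⟨h₁.add h₂, fun X Y m => ?_⟩
  rw [← sub_add_sub_cancel _ (ψ.app X Y m), e₁, e₂]
  simp only [add, LinearMap.add_apply, map_add]
  abel

theorem Homotopic.comp_left {φ φ' : BimHom (0 : Γ) M N} (h : φ.Homotopic φ')
    {ψ : BimHom (0 : Γ) N P} (hψ : ψ.IsClosed) : (ψ.comp φ).Homotopic (ψ.comp φ') := by
  rw [homotopic_iff] at *
  rw [isClosed_iff] at hψ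
  obtain ⟨h, e⟩ := h
  refine ⟨postcomp ψ h, fun X Y m => ?_⟩
  simp only [comp_app, postcomp, LinearMap.comp_apply]
  rw [hψ, ← map_add, ← e, map_sub]

theorem Homotopic.comp_right {ψ ψ' : BimHom (0 : Γ) N P} (h : ψ.Homotopic ψ')
    {φ : BimHom (0 : Γ) M N} (hφ : φ.IsClosed) : (ψ.comp φ).Homotopic (ψ'.comp φ) := by
  rw [homotopic_iff] at *
  rw [isClosed_iff] at hφ
  obtain ⟨h, e⟩ := h
  refine ⟨precomp h φ, fun X Y m => ?_⟩
  simp only [comp_app, precomp, LinearMap.comp_apply]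
  rw [← hφ, ← e]

end basic

/-! ### Tensoring maps and homotopies with a bimodule. -/

section tensor

variable {M : Bimod.{w₁} C B} {M' : Bimod.{w₂} C B} {l : Γ}

theorem rTensor_balanced (φ : BimHom l M M') (N : Bimod.{w₃} B D) {X Z} {Y Y' : B.Obj}
    (m : M.obj X Y) (f : B.Hom Y Y') (n : N.obj Y' Z) :
    (Bimod.tmul Y' ∘ₗ φ.app X Y' : _ →ₗ[k] _ →ₗ[k] (Bimod.tensorOver M' N).obj X Z)
        (M.actR m f) n =
      (Bimod.tmul Y ∘ₗ φ.app X Y : _ →ₗ[k] _ →ₗ[k] (Bimod.tensorOver M' N).obj X Z)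
        m (N.actL f n) := by
  simp only [LinearMap.comp_apply, φ.app_actR, Bimod.tmul_actR]

/-- The map `φ ⊗ id`, `m ⊗ n ↦ φ(m) ⊗ n`. -/
def rTensor (φ : BimHom l M M') (N : Bimod.{w₃} B D) :
    BimHom l (Bimod.tensorOver M N) (Bimod.tensorOver M' N) where
  app X Z := Bimod.tlift (fun Y => Bimod.tmul Y ∘ₗ φ.app X Y) (φ.rTensor_balanced N)
  app_mem := by
    intro X Z n t ht
    refine Bimod.tensorOver_gr_map _ _ ?_ ht
    rintro Y i j rfl a ha b hb
    rw [Bimod.tlift_tmul, add_right_comm]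
    exact Bimod.tmul_mem (φ.app_mem ha) hb
  app_actL := by
    intro X' X Z i g t hg
    induction t using Bimod.tensorOver_ind with
    | zero => simp
    | add s t hs ht => simp only [map_add, smul_add, hs, ht]
    | tmul Y i m hm j n hn =>
      rw [Bimod.actL_tmul, Bimod.tlift_tmul, Bimod.tlift_tmul, LinearMap.comp_apply,
        LinearMap.comp_apply, φ.app_actL _ hg, map_zsmul, LinearMap.smul_apply, Bimod.actL_tmul]
  app_actR := by
    intro X Z Z' t g
    induction t using Bimod.tensorOver_ind with
    | zero => simp
    | add s t hs ht => simp only [map_add, LinearMap.add_apply, hs, ht]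
    | tmul Y i m hm j n hn =>
      rw [Bimod.actR_tmul, Bimod.tlift_tmul, Bimod.tlift_tmul, LinearMap.comp_apply,
        LinearMap.comp_apply, Bimod.actR_tmul]

@[simp] theorem rTensor_tmul (φ : BimHom l M M') (N : Bimod.{w₃} B D) {X Y Z} (m : M.obj X Y)
    (n : N.obj Y Z) :
    (φ.rTensor N).app X Z (Bimod.tmul Y m n) = Bimod.tmul Y (φ.app X Y m) n :=
  Bimod.tlift_tmul _ (φ.rTensor_balanced N) m n

theorem IsClosed.rTensor {φ : BimHom (0 : Γ) M M'} (hφ : φ.IsClosed) (N : Bimod.{w₃} B D) :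
    (φ.rTensor N).IsClosed := by
  rw [isClosed_iff] at *
  intro X Z t
  induction t using Bimod.tensorOver_ind with
  | zero => simp
  | add s t hs ht => simp only [map_add, hs, ht]
  | tmul Y i m hm j n hn =>
    simp only [Bimod.d_tmul, rTensor_tmul, map_add, hφ, φ.app_par, G.sgn_zero_right, one_smul]

theorem Homotopic.rTensor {φ ψ : BimHom (0 : Γ) M M'} (h : φ.Homotopic ψ) (N : Bimod.{w₃} B D) :
    (φ.rTensor N).Homotopic (ψ.rTensor N) := by
  rw [homotopic_iff] at *
  obtain ⟨h, e⟩ := h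
  refine ⟨h.rTensor N, fun X Z t => ?_⟩
  induction t using Bimod.tensorOver_ind with
  | zero => simp
  | add s t hs ht =>
    simp only [map_add]
    rw [add_sub_add_comm, hs, ht]
    abel
  | tmul Y i m hm j n hn =>
    -- Since `h` has degree `-ι`, it anticommutes with the sign operator for `ι`. Hence the two
    -- terms containing `d n` cancel, and what remains is `(dh + hd)(m) ⊗ n`.
    simp only [Bimod.d_tmul, rTensor_tmul, map_add, h.app_par, G.sgn_ι_zero_sub_ι]
    rw [← LinearMap.sub_apply, ← map_sub, e]
    simp only [map_add, LinearMap.add_apply, neg_smul, one_smul, map_neg, LinearMap.neg_apply]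
    abel

variable {N : Bimod.{w₁} B D} {N' : Bimod.{w₂} B D}

/-- Moving `f` through `φ` costs `(-1) ^ ⟨l, |f|⟩`, and the Koszul sign attached to `m f` contains
exactly this factor. Without the sign on `m` the map would not descend to the tensor product. -/
theorem lTensor_balanced (M : Bimod.{w₃} C B) (φ : BimHom l N N') {X Z} {Y Y' : B.Obj}
    (m : M.obj X Y) (f : B.Hom Y Y') (n : N.obj Y' Z) :
    ((Bimod.tmul Y').compl₁₂ ((M.obj X Y').par l) (φ.app Y' Z) :
        _ →ₗ[k] _ →ₗ[k] (Bimod.tensorOver M N').obj X Z) (M.actR m f) n =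
      ((Bimod.tmul Y).compl₁₂ ((M.obj X Y).par l) (φ.app Y Z) :
        _ →ₗ[k] _ →ₗ[k] (Bimod.tensorOver M N').obj X Z) m (N.actL f n) := by
  simp only [LinearMap.compl₁₂_apply, M.par_actR, φ.app_actL_par, Bimod.tmul_actR]

/-- The map `id ⊗ φ`, `m ⊗ n ↦ (-1) ^ ⟨l, |m|⟩ m ⊗ φ(n)`. -/
def lTensor (M : Bimod.{w₃} C B) (φ : BimHom l N N') :
    BimHom l (Bimod.tensorOver M N) (Bimod.tensorOver M N') where
  app X Z := Bimod.tlift (fun Y => (Bimod.tmul Y).compl₁₂ ((M.obj X Y).par l) (φ.app Y Z))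
    (lTensor_balanced M φ)
  app_mem := by
    intro X Z n t ht
    refine Bimod.tensorOver_gr_map _ _ ?_ ht
    rintro Y i j rfl a ha b hb
    rw [Bimod.tlift_tmul, add_assoc]
    exact Bimod.tmul_mem (DGMod.par_mem _ _ ha) (φ.app_mem hb)
  app_actL := by
    intro X' X Z i g t hg
    induction t using Bimod.tensorOver_ind with
    | zero => simp
    | add s t hs ht => simp only [map_add, smul_add, hs, ht]
    | tmul Y i m hm j n hn =>
      rw [Bimod.actL_tmul, Bimod.tlift_tmul, Bimod.tlift_tmul, LinearMap.compl₁₂_apply,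
        LinearMap.compl₁₂_apply, Bimod.actL_tmul, M.par_actL, DGMod.par_of_mem _ _ hg]
      simp only [map_zsmul, LinearMap.smul_apply]
  app_actR := by
    intro X Z Z' t g
    induction t using Bimod.tensorOver_ind with
    | zero => simp
    | add s t hs ht => simp only [map_add, LinearMap.add_apply, hs, ht]
    | tmul Y i m hm j n hn =>
      rw [Bimod.actR_tmul, Bimod.tlift_tmul, Bimod.tlift_tmul, LinearMap.compl₁₂_apply,
        LinearMap.compl₁₂_apply, Bimod.actR_tmul, φ.app_actR]

theorem lTensor_tmul (M : Bimod.{w₃} C B) (φ : BimHom l N N') {X Y Z} (m : M.obj X Y)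
    (n : N.obj Y Z) :
    (lTensor M φ).app X Z (Bimod.tmul Y m n) =
      Bimod.tmul Y ((M.obj X Y).par l m) (φ.app Y Z n) :=
  Bimod.tlift_tmul _ (lTensor_balanced M φ) m n

@[simp] theorem lTensor_tmul_zero (M : Bimod.{w₃} C B) (φ : BimHom (0 : Γ) N N') {X Y Z}
    (m : M.obj X Y) (n : N.obj Y Z) :
    (lTensor M φ).app X Z (Bimod.tmul Y m n) = Bimod.tmul Y m (φ.app Y Z n) := by
  rw [lTensor_tmul, DGMod.par_zero]

theorem IsClosed.lTensor {φ : BimHom (0 : Γ) N N'} (hφ : φ.IsClosed) (M : Bimod.{w₃} C B) :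
    (lTensor M φ).IsClosed := by
  rw [isClosed_iff] at *
  intro X Z t
  induction t using Bimod.tensorOver_ind with
  | zero => simp
  | add s t hs ht => simp only [map_add, hs, ht]
  | tmul Y i m hm j n hn =>
    simp only [Bimod.d_tmul, lTensor_tmul_zero, map_add, hφ]

theorem Homotopic.lTensor {φ ψ : BimHom (0 : Γ) N N'} (h : φ.Homotopic ψ) (M : Bimod.{w₃} C B) :
    (lTensor M φ).Homotopic (lTensor M ψ) := by
  rw [homotopic_iff] at *
  obtain ⟨h, e⟩ := h
  refine ⟨BimHom.lTensor M h, fun X Z t => ?_⟩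
  induction t using Bimod.tensorOver_ind with
  | zero => simp
  | add s t hs ht =>
    simp only [map_add]
    rw [add_sub_add_comm, hs, ht]
    abel
  | tmul Y i m hm j n hn =>
    -- Here the terms containing `d m` cancel, because `d` anticommutes with the sign operator on
    -- `m` for `ι`. In the other terms that operator is applied twice and disappears.
    simp only [Bimod.d_tmul, lTensor_tmul, map_add, zero_sub, DGMod.par_neg, DGMod.par_par,
      DGMod.par_zero, DGMod.d_par, G.sgn_ι]
    rw [← map_sub, e]
    simp only [map_add, neg_smul, one_smul, map_neg, LinearMap.neg_apply]
    abel

end tensor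

/-! ### The associator and its inverse on iterated tensors. -/

section assoc

variable {A : DGCat.{u, v} G k} {M : Bimod.{w₁} A B} {N : Bimod.{w₂} B C} {P : Bimod.{w₃} C D}

/-- The trilinear map `(m, n, p) ↦ m ⊗ (n ⊗ p)`. -/
def tmulRight (Y : B.Obj) (W : C.Obj) {X : A.Obj} {Z : D.Obj} :
    M.obj X Y →ₗ[k] N.obj Y W →ₗ[k] P.obj W Z →ₗ[k]
      (Bimod.tensorOver M (Bimod.tensorOver N P)).obj X Z where
  toFun m := (Bimod.tmul W).compr₂ (Bimod.tmul Y m)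
  map_add' m m' := by ext; simp
  map_smul' c m := by ext; simp

theorem tmulRight_apply {X Y W Z} (m : M.obj X Y) (n : N.obj Y W) (p : P.obj W Z) :
    tmulRight Y W m n p = Bimod.tmul Y m (Bimod.tmul W n p) := rfl

/-- The trilinear map `(n, p, m) ↦ (m ⊗ n) ⊗ p`. -/
def tmulLeft (Y : B.Obj) (W : C.Obj) {X : A.Obj} {Z : D.Obj} :
    N.obj Y W →ₗ[k] P.obj W Z →ₗ[k] M.obj X Y →ₗ[k]
      (Bimod.tensorOver (Bimod.tensorOver M N) P).obj X Z :=
  flipComp (Bimod.tmul Y) (Bimod.tmul W)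

theorem tmulLeft_apply {X Y W Z} (m : M.obj X Y) (n : N.obj Y W) (p : P.obj W Z) :
    tmulLeft Y W n p m = Bimod.tmul W (Bimod.tmul Y m n) p := rfl

variable (M N P)

theorem tmulRight_balanced (W : C.Obj) {X : A.Obj} {Z : D.Obj} {Y Y' : B.Obj} (m : M.obj X Y)
    (f : B.Hom Y Y') (n : N.obj Y' W) :
    (tmulRight Y' W (M.actR m f) n : P.obj W Z →ₗ[k] _) = tmulRight Y W m (N.actL f n) := by
  ext p
  rw [tmulRight_apply, tmulRight_apply, Bimod.tmul_actR, Bimod.actL_tmul]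

/-- The tensor product over `C` couples `n` and `p`, so `m` is kept as the argument of a linear map.
The descent to `N ⊗ P` then takes values in linear maps out of `M`. -/
theorem tmulLeft_balanced (Y : B.Obj) {X : A.Obj} {Z : D.Obj} {W W' : C.Obj} (n : N.obj Y W)
    (f : C.Hom W W') (p : P.obj W' Z) :
    (tmulLeft Y W' (N.actR n f) p : M.obj X Y →ₗ[k] _) = tmulLeft Y W n (P.actL f p) := by
  ext m
  rw [tmulLeft_apply, tmulLeft_apply, ← Bimod.actR_tmul, Bimod.tmul_actR]

/-- The bilinear map `(m ⊗ n, p) ↦ m ⊗ (n ⊗ p)`. -/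
def assocBilin (W : C.Obj) (X : A.Obj) (Z : D.Obj) :
    (Bimod.tensorOver M N).obj X W →ₗ[k] P.obj W Z →ₗ[k]
      (Bimod.tensorOver M (Bimod.tensorOver N P)).obj X Z :=
  Bimod.tlift (fun Y => tmulRight Y W) (tmulRight_balanced M N P W)

variable {M N P} in
theorem assocBilin_tmul {X Y W Z} (m : M.obj X Y) (n : N.obj Y W) (p : P.obj W Z) :
    assocBilin M N P W X Z (Bimod.tmul Y m n) p = Bimod.tmul Y m (Bimod.tmul W n p) :=
  DFunLike.congr_fun (Bimod.tlift_tmul _ (tmulRight_balanced M N P W) m n) p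

/-- The bilinear map `(m, n ⊗ p) ↦ (m ⊗ n) ⊗ p`. -/
def assocInvBilin (Y : B.Obj) (X : A.Obj) (Z : D.Obj) :
    M.obj X Y →ₗ[k] (Bimod.tensorOver N P).obj Y Z →ₗ[k]
      (Bimod.tensorOver (Bimod.tensorOver M N) P).obj X Z :=
  (Bimod.tlift (fun W => tmulLeft Y W) (tmulLeft_balanced M N P Y)).flip

variable {M N P} in
theorem assocInvBilin_tmul {X Y W Z} (m : M.obj X Y) (n : N.obj Y W) (p : P.obj W Z) :
    assocInvBilin M N P Y X Z m (Bimod.tmul W n p) = Bimod.tmul W (Bimod.tmul Y m n) p :=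
  DFunLike.congr_fun (Bimod.tlift_tmul _ (tmulLeft_balanced M N P Y) n p) m

theorem assocBilin_balanced {X : A.Obj} {Z : D.Obj} {W W' : C.Obj}
    (t : (Bimod.tensorOver M N).obj X W) (f : C.Hom W W') (p : P.obj W' Z) :
    assocBilin M N P W' X Z ((Bimod.tensorOver M N).actR t f) p =
      assocBilin M N P W X Z t (P.actL f p) := by
  induction t using Bimod.tensorOver_ind with
  | zero => simp
  | add s t hs ht => simp only [map_add, LinearMap.add_apply, hs, ht]
  | tmul Y i m hm j n hn =>
    rw [Bimod.actR_tmul, assocBilin_tmul, assocBilin_tmul, Bimod.tmul_actR]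

/-- The components of the associator. -/
def assocApp (X : A.Obj) (Z : D.Obj) : (Bimod.tensorOver (Bimod.tensorOver M N) P).obj X Z →ₗ[k]
    (Bimod.tensorOver M (Bimod.tensorOver N P)).obj X Z :=
  Bimod.tlift (fun W => assocBilin M N P W X Z) (assocBilin_balanced M N P)

theorem assocInvBilin_balanced {X : A.Obj} {Z : D.Obj} {Y Y' : B.Obj} (m : M.obj X Y)
    (f : B.Hom Y Y') (t : (Bimod.tensorOver N P).obj Y' Z) :
    assocInvBilin M N P Y' X Z (M.actR m f) t =
      assocInvBilin M N P Y X Z m ((Bimod.tensorOver N P).actL f t) := by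
  induction t using Bimod.tensorOver_ind with
  | zero => simp
  | add s t hs ht => simp only [map_add, hs, ht]
  | tmul W i n hn j p hp =>
    rw [Bimod.actL_tmul, assocInvBilin_tmul, assocInvBilin_tmul, Bimod.tmul_actR]

/-- The components of the inverse associator. -/
def assocInvApp (X : A.Obj) (Z : D.Obj) :
    (Bimod.tensorOver M (Bimod.tensorOver N P)).obj X Z →ₗ[k]
      (Bimod.tensorOver (Bimod.tensorOver M N) P).obj X Z :=
  Bimod.tlift (fun Y => assocInvBilin M N P Y X Z) (assocInvBilin_balanced M N P)

variable {M N P}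

theorem assocApp_tmul {X Y W Z} (m : M.obj X Y) (n : N.obj Y W) (p : P.obj W Z) :
    assocApp M N P X Z (Bimod.tmul W (Bimod.tmul Y m n) p) = Bimod.tmul Y m (Bimod.tmul W n p) :=
  (Bimod.tlift_tmul _ (assocBilin_balanced M N P) _ p).trans (assocBilin_tmul m n p)

theorem assocInvApp_tmul {X Y W Z} (m : M.obj X Y) (n : N.obj Y W) (p : P.obj W Z) :
    assocInvApp M N P X Z (Bimod.tmul Y m (Bimod.tmul W n p)) =
      Bimod.tmul W (Bimod.tmul Y m n) p :=
  (Bimod.tlift_tmul _ (assocInvBilin_balanced M N P) m _).trans (assocInvBilin_tmul m n p)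

/-- Iterated pure tensors generate, so two additive maps out of a threefold tensor product may be
compared on them alone. -/
theorem tensorOver_left_ind {X : A.Obj} {Z : D.Obj}
    {Q : (Bimod.tensorOver (Bimod.tensorOver M N) P).obj X Z → Prop} (zero : Q 0)
    (tmul : ∀ Y W (m : M.obj X Y) (n : N.obj Y W) (p : P.obj W Z),
      Q (Bimod.tmul W (Bimod.tmul Y m n) p))
    (add : ∀ s t, Q s → Q t → Q (s + t))
    (t : (Bimod.tensorOver (Bimod.tensorOver M N) P).obj X Z) : Q t := by
  induction t using Bimod.tensorOver_ind with
  | zero => exact zero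
  | add s t hs ht => exact add s t hs ht
  | tmul W i t ht j p hp =>
    -- The homogeneity of `t` is dropped, since it need not be inherited by the summands in the
    -- inner induction.
    clear ht
    induction t using Bimod.tensorOver_ind with
    | zero => rwa [map_zero, LinearMap.zero_apply]
    | add s t hs ht => rw [map_add, LinearMap.add_apply]; exact add _ _ hs ht
    | tmul Y i m hm j n hn => exact tmul Y W m n p

theorem tensorOver_right_ind {X : A.Obj} {Z : D.Obj}
    {Q : (Bimod.tensorOver M (Bimod.tensorOver N P)).obj X Z → Prop} (zero : Q 0)
    (tmul : ∀ Y W (m : M.obj X Y) (n : N.obj Y W) (p : P.obj W Z),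
      Q (Bimod.tmul Y m (Bimod.tmul W n p)))
    (add : ∀ s t, Q s → Q t → Q (s + t))
    (t : (Bimod.tensorOver M (Bimod.tensorOver N P)).obj X Z) : Q t := by
  induction t using Bimod.tensorOver_ind with
  | zero => exact zero
  | add s t hs ht => exact add s t hs ht
  | tmul Y i m hm j t ht =>
    clear ht
    induction t using Bimod.tensorOver_ind with
    | zero => rwa [map_zero]
    | add s t hs ht => rw [map_add]; exact add _ _ hs ht
    | tmul W i n hn j p hp => exact tmul Y W m n p

theorem assocApp_mem {X Z} {l : Γ} {t : (Bimod.tensorOver (Bimod.tensorOver M N) P).obj X Z}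
    (ht : t ∈ ((Bimod.tensorOver (Bimod.tensorOver M N) P).obj X Z).gr l) :
    assocApp M N P X Z t ∈ ((Bimod.tensorOver M (Bimod.tensorOver N P)).obj X Z).gr l := by
  refine Bimod.tensorOver_gr_map (assocApp M N P X Z) _ ?_ ht
  rintro W i j rfl t ht p hp
  refine Bimod.tensorOver_gr_map (assocApp M N P X Z ∘ₗ (Bimod.tmul W).flip p) _ ?_ ht
  rintro Y i j rfl m hm n hn
  rw [LinearMap.comp_apply, LinearMap.flip_apply, assocApp_tmul, add_assoc]
  exact Bimod.tmul_mem hm (Bimod.tmul_mem hn hp)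

theorem assocInvApp_mem {X Z} {l : Γ} {t : (Bimod.tensorOver M (Bimod.tensorOver N P)).obj X Z}
    (ht : t ∈ ((Bimod.tensorOver M (Bimod.tensorOver N P)).obj X Z).gr l) :
    assocInvApp M N P X Z t ∈ ((Bimod.tensorOver (Bimod.tensorOver M N) P).obj X Z).gr l := by
  refine Bimod.tensorOver_gr_map (assocInvApp M N P X Z) _ ?_ ht
  rintro Y i j rfl m hm t ht
  refine Bimod.tensorOver_gr_map (assocInvApp M N P X Z ∘ₗ Bimod.tmul Y m) _ ?_ ht
  rintro W i j rfl n hn p hp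
  rw [LinearMap.comp_apply, assocInvApp_tmul, ← add_assoc]
  exact Bimod.tmul_mem (Bimod.tmul_mem hm hn) hp

theorem assocApp_actL {X' X Z} (g : A.Hom X' X)
    (t : (Bimod.tensorOver (Bimod.tensorOver M N) P).obj X Z) :
    assocApp M N P X' Z ((Bimod.tensorOver (Bimod.tensorOver M N) P).actL g t) =
      (Bimod.tensorOver M (Bimod.tensorOver N P)).actL g (assocApp M N P X Z t) := by
  induction t using tensorOver_left_ind with
  | zero => simp only [map_zero]
  | add s t hs ht => simp only [map_add, hs, ht]
  | tmul Y W m n p =>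
    rw [Bimod.actL_tmul, Bimod.actL_tmul, assocApp_tmul, assocApp_tmul, Bimod.actL_tmul]

theorem assocApp_actR {X Z Z'} (t : (Bimod.tensorOver (Bimod.tensorOver M N) P).obj X Z)
    (g : D.Hom Z Z') :
    assocApp M N P X Z' ((Bimod.tensorOver (Bimod.tensorOver M N) P).actR t g) =
      (Bimod.tensorOver M (Bimod.tensorOver N P)).actR (assocApp M N P X Z t) g := by
  induction t using tensorOver_left_ind with
  | zero => simp only [map_zero, LinearMap.zero_apply]
  | add s t hs ht => simp only [map_add, LinearMap.add_apply, hs, ht]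
  | tmul Y W m n p =>
    rw [Bimod.actR_tmul, assocApp_tmul, assocApp_tmul, Bimod.actR_tmul, Bimod.actR_tmul]

theorem assocInvApp_actL {X' X Z} (g : A.Hom X' X)
    (t : (Bimod.tensorOver M (Bimod.tensorOver N P)).obj X Z) :
    assocInvApp M N P X' Z ((Bimod.tensorOver M (Bimod.tensorOver N P)).actL g t) =
      (Bimod.tensorOver (Bimod.tensorOver M N) P).actL g (assocInvApp M N P X Z t) := by
  induction t using tensorOver_right_ind with
  | zero => simp only [map_zero]
  | add s t hs ht => simp only [map_add, hs, ht]
  | tmul Y W m n p =>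
    rw [Bimod.actL_tmul, assocInvApp_tmul, assocInvApp_tmul, Bimod.actL_tmul, Bimod.actL_tmul]

theorem assocInvApp_actR {X Z Z'} (t : (Bimod.tensorOver M (Bimod.tensorOver N P)).obj X Z)
    (g : D.Hom Z Z') :
    assocInvApp M N P X Z' ((Bimod.tensorOver M (Bimod.tensorOver N P)).actR t g) =
      (Bimod.tensorOver (Bimod.tensorOver M N) P).actR (assocInvApp M N P X Z t) g := by
  induction t using tensorOver_right_ind with
  | zero => simp only [map_zero, LinearMap.zero_apply]
  | add s t hs ht => simp only [map_add, LinearMap.add_apply, hs, ht]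
  | tmul Y W m n p =>
    rw [Bimod.actR_tmul, Bimod.actR_tmul, assocInvApp_tmul, assocInvApp_tmul, Bimod.actR_tmul]

variable (M N P) in
/-- The associator `(M ⊗ N) ⊗ P → M ⊗ (N ⊗ P)`. -/
def assoc : BimHom (0 : Γ) (Bimod.tensorOver (Bimod.tensorOver M N) P)
    (Bimod.tensorOver M (Bimod.tensorOver N P)) :=
  .ofZero (assocApp M N P) assocApp_mem assocApp_actL assocApp_actR

variable (M N P) in
/-- The inverse associator `M ⊗ (N ⊗ P) → (M ⊗ N) ⊗ P`. -/
def assocInv : BimHom (0 : Γ) (Bimod.tensorOver M (Bimod.tensorOver N P))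
    (Bimod.tensorOver (Bimod.tensorOver M N) P) :=
  .ofZero (assocInvApp M N P) assocInvApp_mem assocInvApp_actL assocInvApp_actR

theorem assoc_tmul {X Y W Z} (m : M.obj X Y) (n : N.obj Y W) (p : P.obj W Z) :
    (assoc M N P).app X Z (Bimod.tmul W (Bimod.tmul Y m n) p) =
      Bimod.tmul Y m (Bimod.tmul W n p) :=
  assocApp_tmul m n p

theorem assocInv_tmul {X Y W Z} (m : M.obj X Y) (n : N.obj Y W) (p : P.obj W Z) :
    (assocInv M N P).app X Z (Bimod.tmul Y m (Bimod.tmul W n p)) =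
      Bimod.tmul W (Bimod.tmul Y m n) p :=
  assocInvApp_tmul m n p

end assoc

end BimHom

/-- Degrees add in a tensor product, so the sign operator is multiplicative on pure tensors. -/
theorem Bimod.par_tmul {B : DGCat.{u, v} G k} {C : DGCat.{u₁, v₁} G k} {D : DGCat.{u₂, v₂} G k}
    {M : Bimod.{w₁} C B} {N : Bimod.{w₂} B D} (l : Γ) {X Y Z} (m : M.obj X Y) (n : N.obj Y Z) :
    ((Bimod.tensorOver M N).obj X Z).par l (Bimod.tmul Y m n) =
      Bimod.tmul Y ((M.obj X Y).par l m) ((N.obj Y Z).par l n) := by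
  induction m using DGMod.ind with
  | add m m' h h' => simp only [map_add, LinearMap.add_apply, h, h']
  | homog i m hm =>
    induction n using DGMod.ind with
    | add n n' h h' => simp only [map_add, h, h']
    | homog j n hn =>
      rw [DGMod.par_of_mem _ _ hm, DGMod.par_of_mem _ _ hn,
        DGMod.par_of_mem _ _ (Bimod.tmul_mem hm hn)]
      simp [G.sgn_add_right, mul_smul]

namespace BimHom

variable {C : DGCat.{u₁, v₁} G k} {D : DGCat.{u₂, v₂} G k}

section assocClosed

variable {A : DGCat.{u, v} G k} {B : DGCat.{u, v} G k} {C : DGCat.{u₁, v₁} G k}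
  {D : DGCat.{u₂, v₂} G k} (M : Bimod.{w₁} A B) (N : Bimod.{w₂} B C) (P : Bimod.{w₃} C D)

/-- Both bracketings give the same three-term Leibniz sum. The term in `d p` carries the sign of `m
⊗ n`, which is the product of the signs of `m` and `n` by `Bimod.par_tmul`. -/
theorem assoc_isClosed : (assoc M N P).IsClosed := by
  rw [isClosed_iff]
  intro X Z t
  induction t using tensorOver_left_ind with
  | zero => simp only [map_zero]
  | add s t hs ht => simp only [map_add, hs, ht]
  | tmul Y W m n p =>
    simp only [assoc_tmul, Bimod.d_tmul, Bimod.par_tmul, map_add, LinearMap.add_apply, add_assoc]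

theorem assocInv_isClosed : (assocInv M N P).IsClosed := by
  rw [isClosed_iff]
  intro X Z t
  induction t using tensorOver_right_ind with
  | zero => simp only [map_zero]
  | add s t hs ht => simp only [map_add, hs, ht]
  | tmul Y W m n p =>
    simp only [assocInv_tmul, Bimod.d_tmul, Bimod.par_tmul, map_add, LinearMap.add_apply,
      add_assoc]

end assocClosed

/-! ### Counits -/

theorem whiskerLeft_tmul {P : Bimod.{w₁} C C} (ε : BimHom (0 : Γ) P (Bimod.unit C))
    (N : Bimod.{w₂} C D) {X Y Z} (p : P.obj X Y) (n : N.obj Y Z) :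
    (ε.whiskerLeft N).app X Z (Bimod.tmul Y p n) = N.actL (Bimod.toHom (ε.app X Y p)) n :=
  Bimod.tlift_tmul _ (ε.whiskerLeft_balanced N) p n

theorem whiskerRight_tmul {P : Bimod.{w₁} D D} (N : Bimod.{w₂} C D)
    (ε : BimHom (0 : Γ) P (Bimod.unit D)) {X Y Z} (n : N.obj X Y) (p : P.obj Y Z) :
    (whiskerRight N ε).app X Z (Bimod.tmul Y n p) = N.actR n (Bimod.toHom (ε.app Y Z p)) :=
  Bimod.tlift_tmul _ (whiskerRight_balanced N ε) n p

theorem par_toHom (l : Γ) {X Y : C.Obj} (m : (Bimod.unit C).obj X Y) :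
    (C.Hom X Y).par l (Bimod.toHom m) = Bimod.toHom (((Bimod.unit C).obj X Y).par l m) := rfl

theorem d_toHom {X Y : C.Obj} (m : (Bimod.unit C).obj X Y) :
    (C.Hom X Y).d (Bimod.toHom m) = Bimod.toHom (((Bimod.unit C).obj X Y).d m) := rfl

theorem IsClosed.whiskerLeft {P : Bimod.{w₁} C C} {ε : BimHom (0 : Γ) P (Bimod.unit C)}
    (hε : ε.IsClosed) (N : Bimod.{w₂} C D) : (ε.whiskerLeft N).IsClosed := by
  rw [isClosed_iff] at *
  intro X Z t
  induction t using Bimod.tensorOver_ind with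
  | zero => simp
  | add s t hs ht => simp only [map_add, hs, ht]
  | tmul Y i m hm j n hn =>
    rw [Bimod.d_tmul, map_add, whiskerLeft_tmul, whiskerLeft_tmul, whiskerLeft_tmul,
      N.d_actL_par, d_toHom, hε, par_toHom, ε.app_par, G.sgn_zero_right, one_smul]

theorem IsClosed.whiskerRight {P : Bimod.{w₁} D D} {ε : BimHom (0 : Γ) P (Bimod.unit D)}
    (hε : ε.IsClosed) (N : Bimod.{w₂} C D) : (whiskerRight N ε).IsClosed := by
  rw [isClosed_iff] at *
  intro X Z t
  induction t using Bimod.tensorOver_ind with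
  | zero => simp
  | add s t hs ht => simp only [map_add, hs, ht]
  | tmul Y i m hm j n hn =>
    rw [Bimod.d_tmul, map_add, whiskerRight_tmul, whiskerRight_tmul, whiskerRight_tmul,
      N.d_actR_par, d_toHom, hε]

theorem Homotopic.whiskerRight {P : Bimod.{w₁} D D} {ε ε' : BimHom (0 : Γ) P (Bimod.unit D)}
    (h : ε.Homotopic ε') (N : Bimod.{w₂} C D) :
    (whiskerRight N ε).Homotopic (whiskerRight N ε') := by
  -- The map `id ⊗ ε` into `N` is the tensor map into `N ⊗ D` followed by the right unitor `n ⊗ g ↦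
  -- n · g`. The unitor is itself `whiskerRight` of the identity and is closed, so homotopies of `ε`
  -- pass through.
  have key : ∀ ε : BimHom (0 : Γ) P (Bimod.unit D), BimHom.whiskerRight N ε =
      (BimHom.whiskerRight N (BimHom.id (Bimod.unit D))).comp (BimHom.lTensor N ε) := by
    intro ε
    ext X Z t
    induction t using Bimod.tensorOver_ind with
    | zero => simp
    | add s t hs ht => simp only [map_add, hs, ht]
    | tmul Y i m hm j n hn =>
      rw [comp_app, lTensor_tmul_zero, whiskerRight_tmul, whiskerRight_tmul, id_app]
  rw [key ε, key ε']
  exact (h.lTensor N).comp_left (isClosed_id.whiskerRight N)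

/-! ### Counital idempotents and rigidity from a comultiplication. -/

section coring

variable {P : Bimod.{w} C C} {ε : BimHom (0 : Γ) P (Bimod.unit C)}
  {Δ : BimHom (0 : Γ) P (Bimod.tensorOver P P)}

/-- A bimodule with a closed comultiplication which is strictly counital, and for
which the two maps `ε ⊗ id` and `id ⊗ ε` are homotopic, is a counital idempotent. -/
theorem _root_.DGBar.isCounitalIdempotent_of_comul (hε : ε.IsClosed) (hΔ : Δ.IsClosed)
    (hl : (ε.whiskerLeft P).comp Δ = id P) (hr : (whiskerRight P ε).comp Δ = id P)
    (h : (ε.whiskerLeft P).Homotopic (whiskerRight P ε)) : IsCounitalIdempotent P ε := by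
  have hl' : ∀ X Y p, (ε.whiskerLeft P).app X Y (Δ.app X Y p) = p := fun X Y p =>
    congrArg (fun φ : BimHom (0 : Γ) P P => φ.app X Y p) hl
  have hr' : ∀ X Y p, (whiskerRight P ε).app X Y (Δ.app X Y p) = p := fun X Y p =>
    congrArg (fun φ : BimHom (0 : Γ) P P => φ.app X Y p) hr
  have hL : (assocInv P P P).IsClosed := assocInv_isClosed P P P
  have hR : (assoc P P P).IsClosed := assoc_isClosed P P P
  refine ⟨hε, ⟨hε.whiskerLeft P, Δ, hΔ, ?_, ?_⟩, ⟨hε.whiskerRight P, Δ, hΔ, ?_, ?_⟩⟩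
  -- Left linearity of `Δ`: `Δ(ε(p) q) = ε(p) Δ(q)`, that is, `Δ(ε ⊗ 1) = (ε ⊗ 1 ⊗ 1)(1 ⊗ Δ)`.
  · have e₁ : Δ.comp (ε.whiskerLeft P) = ((ε.whiskerLeft P).rTensor P).comp
        ((assocInv P P P).comp (lTensor P Δ)) := by
      ext X Z t
      induction t using Bimod.tensorOver_ind with
      | zero => simp
      | add s t hs ht => simp only [map_add, hs, ht]
      | tmul Y i p hp j q hq =>
        simp only [comp_app, lTensor_tmul_zero, whiskerLeft_tmul, Δ.app_actL_zero]
        generalize Δ.app Y Z q = t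
        induction t using Bimod.tensorOver_ind with
        | zero => simp
        | add s t hs ht => simp only [map_add, hs, ht]
        | tmul W i q hq j r hr =>
          rw [assocInv_tmul, rTensor_tmul, whiskerLeft_tmul, Bimod.actL_tmul]
    -- With the counit on the middle factor the composite is the identity: if `Δ q` is a sum of `q'
    -- ⊗ q''`, balancing turns `p ε(q') ⊗ q''` into `p ⊗ ε(q') q''`, and the left counit law sums
    -- this to `p ⊗ q`.
    have e₂ : ((whiskerRight P ε).rTensor P).comp ((assocInv P P P).comp (lTensor P Δ)) =
        id _ := by
      ext X Z t
      induction t using Bimod.tensorOver_ind with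
      | zero => simp
      | add s t hs ht => simp only [map_add, hs, ht]
      | tmul Y i p hp j q hq =>
        simp only [comp_app, lTensor_tmul_zero, id_app]
        -- Once `q` on the right is written as `(ε ⊗ 1)(Δ q)`, both sides depend on `Δ q` only, and
        -- the equality holds for an arbitrary tensor in its place.
        nth_rewrite 2 [← hl' Y Z q]
        generalize Δ.app Y Z q = t
        induction t using Bimod.tensorOver_ind with
        | zero => simp
        | add s t hs ht => simp only [map_add, hs, ht]
        | tmul W i q hq j r hr =>
          rw [assocInv_tmul, rTensor_tmul, whiskerRight_tmul, whiskerLeft_tmul, Bimod.tmul_actR]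
    rw [e₁, ← e₂]
    exact (h.rTensor P).comp_right (hL.comp (hΔ.lTensor P))
  · rw [hl]; exact Homotopic.refl _
  -- The mirror argument: right linearity of `Δ` gives `Δ(1 ⊗ ε) = (1 ⊗ 1 ⊗ ε)(Δ ⊗ 1)`. The homotopy
  -- is then used in the reverse direction, on the last two factors, to move the counit to the
  -- middle one.
  · have e₁ : Δ.comp (whiskerRight P ε) = (lTensor P (whiskerRight P ε)).comp
        ((assoc P P P).comp (Δ.rTensor P)) := by
      ext X Z t
      induction t using Bimod.tensorOver_ind with
      | zero => simp
      | add s t hs ht => simp only [map_add, hs, ht]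
      | tmul Y i p hp j q hq =>
        simp only [comp_app, rTensor_tmul, whiskerRight_tmul, Δ.app_actR]
        generalize Δ.app X Y p = t
        induction t using Bimod.tensorOver_ind with
        | zero => simp
        | add s t hs ht => simp only [map_add, LinearMap.add_apply, hs, ht]
        | tmul W i r hr j s hs =>
          rw [assoc_tmul, lTensor_tmul_zero, whiskerRight_tmul, Bimod.actR_tmul]
    have e₂ : (lTensor P (ε.whiskerLeft P)).comp ((assoc P P P).comp (Δ.rTensor P)) =
        id _ := by
      ext X Z t
      induction t using Bimod.tensorOver_ind with
      | zero => simp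
      | add s t hs ht => simp only [map_add, hs, ht]
      | tmul Y i p hp j q hq =>
        simp only [comp_app, rTensor_tmul, id_app]
        nth_rewrite 2 [← hr' X Y p]
        generalize Δ.app X Y p = t
        induction t using Bimod.tensorOver_ind with
        | zero => simp
        | add s t hs ht => simp only [map_add, LinearMap.add_apply, hs, ht]
        | tmul W i r hr j s hs =>
          rw [assoc_tmul, lTensor_tmul_zero, whiskerRight_tmul, whiskerLeft_tmul, Bimod.tmul_actR]
    rw [e₁, ← e₂]
    exact ((h.symm).lTensor P).comp_right (hR.comp (hΔ.rTensor P))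
  · rw [hr]; exact Homotopic.refl _

/-- An endomorphism which is compatible with the counit up to homotopy is homotopic to the
identity. -/
theorem homotopic_id_of_counit (hΔ : Δ.IsClosed)
    (hl : (ε.whiskerLeft P).comp Δ = id P) (hr : (whiskerRight P ε).comp Δ = id P)
    (h : (ε.whiskerLeft P).Homotopic (whiskerRight P ε)) {φ : BimHom (0 : Γ) P P}
    (hφ : φ.IsClosed) (hφε : (ε.comp φ).Homotopic ε) : φ.Homotopic (id P) := by
  -- Left linearity of `φ` gives `φ(ε(p) q) = ε(p) φ(q)`, so `φ` commutes past `ε ⊗ 1`; the left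
  -- counit law then removes `Δ`.
  have e₁ : φ = ((ε.whiskerLeft P).comp (lTensor P φ)).comp Δ := by
    have : (ε.whiskerLeft P).comp (lTensor P φ) = φ.comp (ε.whiskerLeft P) := by
      ext X Z t
      induction t using Bimod.tensorOver_ind with
      | zero => simp
      | add s t hs ht => simp only [map_add, hs, ht]
      | tmul Y i p hp j q hq =>
        rw [comp_app, comp_app, lTensor_tmul_zero, whiskerLeft_tmul, whiskerLeft_tmul,
          φ.app_actL_zero]
    rw [this]
    exact (congrArg φ.comp hl).symm
  have e₂ : (whiskerRight P ε).comp (lTensor P φ) = whiskerRight P (ε.comp φ) := by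
    ext X Z t
    induction t using Bimod.tensorOver_ind with
    | zero => simp
    | add s t hs ht => simp only [map_add, hs, ht]
    | tmul Y i p hp j q hq =>
      rw [comp_app, lTensor_tmul_zero, whiskerRight_tmul, whiskerRight_tmul, comp_app]
  -- First the homotopy `ε ⊗ 1 ≃ 1 ⊗ ε` is applied with `φ` on the second factor. That places `φ`
  -- directly under `ε`, where the hypothesis `εφ ≃ ε` replaces it.
  have h₁ := (h.comp_right (hφ.lTensor P)).comp_right hΔ
  rw [← e₁, e₂] at h₁
  have h₂ := (hφε.whiskerRight P).comp_right hΔ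
  rw [hr] at h₂
  exact h₁.trans h₂

end coring

end BimHom

end

end DGBar

namespace DGBar

noncomputable section

variable {Γ : Type x} [AddCommGroup Γ] {G : Grading Γ} {k : Type y} [CommRing k]
  {C : DGCat.{u₁, v₁} G k}

/-! ### Generators of the bar complex -/

section generators

variable {𝒳 : Set C.Obj}

/-- The element of the bar complex given by an element of `barTerm 𝒳 r`. -/
def barMk (r : ℕ) {Y Z : C.Obj} : (barTerm 𝒳 r).obj Y Z →ₗ[k] (Bar 𝒳).obj Y Z :=
  barIncl 𝒳 r

theorem barMk_mem {Y Z : C.Obj} {n : Γ} {r : ℕ} {t : (barTerm 𝒳 r).obj Y Z}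
    (ht : t ∈ ((barTerm 𝒳 r).obj Y Z).gr (n + r • G.ι)) :
    barMk r t ∈ ((Bar 𝒳).obj Y Z).gr n := barIncl_mem 𝒳 ht

theorem barMk_ind {Y Z : C.Obj} {P : (Bar 𝒳).obj Y Z → Prop} (zero : P 0)
    (mk : ∀ r t, P (barMk r t)) (add : ∀ s t, P s → P t → P (s + t))
    (t : (Bar 𝒳).obj Y Z) : P t := bar_ind 𝒳 (P := P) zero mk add t

/-- The linear map out of the bar complex given by linear maps out of the `barTerm 𝒳 r`. -/
def barDesc {Y Z : C.Obj} {Q : Type w₃} [AddCommGroup Q] [Module k Q]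
    (φ : ∀ r, (barTerm 𝒳 r).obj Y Z →ₗ[k] Q) : (Bar 𝒳).obj Y Z →ₗ[k] Q := barLift 𝒳 φ

theorem barDesc_mk {Y Z : C.Obj} {Q : Type w₃} [AddCommGroup Q] [Module k Q]
    (φ : ∀ r, (barTerm 𝒳 r).obj Y Z →ₗ[k] Q) (r : ℕ) (t : (barTerm 𝒳 r).obj Y Z) :
    barDesc φ (barMk r t) = φ r t := barLift_incl 𝒳 φ r t

theorem d_barMk_zero {Y Z : C.Obj} (t : (barTerm 𝒳 0).obj Y Z) :
    ((Bar 𝒳).obj Y Z).d (barMk 0 t) = barMk 0 (((barTerm 𝒳 0).obj Y Z).d t) := by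
  change ((barSum 𝒳).obj Y Z).d (barIncl 𝒳 0 t) + barLift 𝒳 (barTwistApp 𝒳) (barIncl 𝒳 0 t) = _
  rw [d_barIncl, barLift_incl, zero_nsmul, G.sgn_zero_left, one_smul]
  exact add_zero _

/-- The sign on the internal differential comes from the shift by `-(r + 1)ι`; the second term is
the twist. In length zero there is neither a sign nor a face. -/
theorem d_barMk_succ {Y Z : C.Obj} (r : ℕ) (t : (barTerm 𝒳 (r + 1)).obj Y Z) :
    ((Bar 𝒳).obj Y Z).d (barMk (r + 1) t) =
      G.sgn ((r + 1) • G.ι) G.ι • barMk (r + 1) (((barTerm 𝒳 (r + 1)).obj Y Z).d t) +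
        barMk r ((barFace 𝒳 r).app Y Z t) := by
  change ((barSum 𝒳).obj Y Z).d (barIncl 𝒳 (r + 1) t) +
    barLift 𝒳 (barTwistApp 𝒳) (barIncl 𝒳 (r + 1) t) = _
  rw [d_barIncl, barLift_incl]
  rfl

theorem actL_barMk {Y' Y Z : C.Obj} (r : ℕ) (g : C.Hom Y' Y) (t : (barTerm 𝒳 r).obj Y Z) :
    (Bar 𝒳).actL g (barMk r t) =
      barMk r ((barTerm 𝒳 r).actL ((C.Hom Y' Y).par (r • G.ι) g) t) := by
  rw [← DGMod.par_neg]
  exact actL_barIncl 𝒳 r g t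

theorem actR_barMk {Y Z Z' : C.Obj} (r : ℕ) (g : C.Hom Z Z') (t : (barTerm 𝒳 r).obj Y Z) :
    (Bar 𝒳).actR (barMk r t) g = barMk r ((barTerm 𝒳 r).actR t g) :=
  actR_barIncl 𝒳 r g t

theorem counit_barMk_zero {Y Z : C.Obj} (t : (barTerm 𝒳 0).obj Y Z) :
    (counit 𝒳).app Y Z (barMk 0 t) = (stepMul 𝒳 (Bimod.unit C)).app Y Z t :=
  barLift_incl 𝒳 _ 0 t

theorem counit_barMk_succ {Y Z : C.Obj} (r : ℕ) (t : (barTerm 𝒳 (r + 1)).obj Y Z) :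
    (counit 𝒳).app Y Z (barMk (r + 1) t) = 0 :=
  barLift_incl 𝒳 _ (r + 1) t

/-- The element `f ⊗ n` of `barTerm 𝒳 0`. -/
def termMkZero (X : 𝒳) {Y Z : C.Obj} :
    C.Hom Y X →ₗ[k] C.Hom X Z →ₗ[k] (barTerm 𝒳 0).obj Y Z :=
  stepMk (N := Bimod.unit C) X

/-- The element `f ⊗ n` of `barTerm 𝒳 (r + 1)`. -/
def termMkSucc (r : ℕ) (X : 𝒳) {Y Z : C.Obj} :
    C.Hom Y X →ₗ[k] (barTerm 𝒳 r).obj X Z →ₗ[k] (barTerm 𝒳 (r + 1)).obj Y Z :=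
  stepMk (N := barTerm 𝒳 r) X

/-- The element `[f, h]` of the bar complex. -/
def barBase (X : 𝒳) {Y Z : C.Obj} : C.Hom Y X →ₗ[k] C.Hom X Z →ₗ[k] (Bar 𝒳).obj Y Z :=
  (termMkZero X).compr₂ (barMk 0)

/-- The bilinear map sending `f` and `w = [f₁, …, f_{r+1}]` to
`(-1) ^ ((r + 1) ⟨ι, |f|⟩) [f, f₁, …, f_{r+1}]`. -/
def barCons (X : 𝒳) {Y Z : C.Obj} :
    C.Hom Y X →ₗ[k] (Bar 𝒳).obj X Z →ₗ[k] (Bar 𝒳).obj Y Z :=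
  (barDesc fun r => (((termMkSucc r X).compr₂ (barMk (r + 1))) ∘ₗ
    (C.Hom Y X).par ((r + 1) • G.ι)).flip).flip

theorem barBase_apply (X : 𝒳) {Y Z : C.Obj} (f : C.Hom Y X) (h : C.Hom X Z) :
    barBase X f h = barMk 0 (termMkZero X f h) := rfl

theorem barCons_mk (X : 𝒳) {Y Z : C.Obj} (f : C.Hom Y X) (r : ℕ) (w : (barTerm 𝒳 r).obj X Z) :
    barCons X f (barMk r w) =
      barMk (r + 1) (termMkSucc r X ((C.Hom Y X).par ((r + 1) • G.ι) f) w) := by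
  unfold barCons
  rw [LinearMap.flip_apply, barDesc_mk]
  rfl

theorem barMk_termMkSucc (X : 𝒳) {Y Z : C.Obj} (f : C.Hom Y X) (r : ℕ)
    (w : (barTerm 𝒳 r).obj X Z) : barMk (r + 1) (termMkSucc r X f w) =
      barCons X ((C.Hom Y X).par ((r + 1) • G.ι) f) (barMk r w) := by
  rw [barCons_mk, DGMod.par_par]

theorem barBase_mem {X : 𝒳} {Y Z : C.Obj} {i j : Γ} {f : C.Hom Y X} {h : C.Hom X Z}
    (hf : f ∈ (C.Hom Y X).gr i) (hh : h ∈ (C.Hom X Z).gr j) :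
    barBase X f h ∈ ((Bar 𝒳).obj Y Z).gr (i + j) := by
  refine barMk_mem ?_
  rw [zero_nsmul, add_zero]
  exact stepMk_mem (N := Bimod.unit C) hf hh

/-- The twist changes the differential only, so membership statements for `Bar` can be tested on the
untwisted sum. -/
theorem bar_gr_le {Y Z : C.Obj} {S : Submodule k ((Bar 𝒳).obj Y Z)} {n : Γ}
    (h : ∀ r, ∀ t ∈ ((barTerm 𝒳 r).obj Y Z).gr (n + r • G.ι), barMk r t ∈ S) :
    ((Bar 𝒳).obj Y Z).gr n ≤ S := fun _ ht =>
  bar_gr_map 𝒳 (LinearMap.id : (barSum 𝒳).obj Y Z →ₗ[k] (Bar 𝒳).obj Y Z) S h ht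

theorem barCons_mem {X : 𝒳} {Y Z : C.Obj} {i j : Γ} {f : C.Hom Y X} {w : (Bar 𝒳).obj X Z}
    (hf : f ∈ (C.Hom Y X).gr i) (hw : w ∈ ((Bar 𝒳).obj X Z).gr j) :
    barCons X f w ∈ ((Bar 𝒳).obj Y Z).gr (i + j + (0 - G.ι)) := by
  refine bar_gr_le (S := (((Bar 𝒳).obj Y Z).gr (i + j + (0 - G.ι))).comap (barCons X f)) ?_ hw
  intro r t ht
  rw [Submodule.mem_comap, barCons_mk]
  refine barMk_mem ?_
  have e : i + j + (0 - G.ι) + (r + 1) • G.ι = i + (j + r • G.ι) := by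
    rw [succ_nsmul]
    abel
  rw [e]
  exact stepMk_mem (N := barTerm 𝒳 r) (DGMod.par_mem _ _ hf) ht

/-- Every chain arises from some `[f, h]` by prefixing morphisms. Prefixing changes the left
endpoint, so the predicate is a family over `Y`, while `Z` stays fixed. -/
theorem bar_induction {Z : C.Obj} {P : ∀ Y, (Bar 𝒳).obj Y Z → Prop} (zero : ∀ Y, P Y 0)
    (add : ∀ Y s t, P Y s → P Y t → P Y (s + t))
    (base : ∀ Y (X : 𝒳) (f : C.Hom Y X) (h : C.Hom X Z), P Y (barBase X f h))
    (cons : ∀ Y (X : 𝒳) (f : C.Hom Y X) (w : (Bar 𝒳).obj X Z), P X w → P Y (barCons X f w))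
    {Y : C.Obj} (t : (Bar 𝒳).obj Y Z) : P Y t := by
  refine barMk_ind (zero Y) (fun r t' => ?_) (add Y) t
  clear t
  rename' t' => t
  induction r generalizing Y with
  | zero =>
    refine step_ind (N := Bimod.unit C) (P := fun t => P Y (barMk (𝒳 := 𝒳) 0 t)) ?_ ?_ ?_ t
    · exact (congrArg (P Y) (map_zero (barMk (𝒳 := 𝒳) 0))).mpr (zero Y)
    · exact fun X f h => base Y X f h
    · exact fun s t hs ht => (congrArg (P Y) (map_add (barMk (𝒳 := 𝒳) 0) s t)).mpr (add Y _ _ hs ht)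
  | succ r ih =>
    refine step_ind (N := barTerm 𝒳 r) (P := fun t => P Y (barMk (𝒳 := 𝒳) (r + 1) t)) ?_ ?_ ?_ t
    · exact (congrArg (P Y) (map_zero (barMk (𝒳 := 𝒳) (r + 1)))).mpr (zero Y)
    · exact fun X f w => (congrArg (P Y) (barMk_termMkSucc X f r w)).mpr (cons Y X _ _ (ih w))
    · exact fun s t hs ht =>
        (congrArg (P Y) (map_add (barMk (𝒳 := 𝒳) (r + 1)) s t)).mpr (add Y _ _ hs ht)

/-- The graded form of `bar_induction`, used to show that a map defined by recursion on chains has a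
given degree: `S Y n` is taken to be the preimage of a homogeneous component. -/
theorem bar_homog_induction {Z : C.Obj} {S : ∀ Y, Γ → Submodule k ((Bar 𝒳).obj Y Z)}
    (base : ∀ Y (X : 𝒳) i j, ∀ f ∈ (C.Hom Y X).gr i, ∀ h ∈ (C.Hom X Z).gr j,
      barBase X f h ∈ S Y (i + j))
    (cons : ∀ Y (X : 𝒳) i j, ∀ f ∈ (C.Hom Y X).gr i, ∀ w ∈ ((Bar 𝒳).obj X Z).gr j,
      w ∈ S X j → barCons X f w ∈ S Y (i + j + (0 - G.ι)))
    {Y : C.Obj} {n : Γ} {t : (Bar 𝒳).obj Y Z} (ht : t ∈ ((Bar 𝒳).obj Y Z).gr n) : t ∈ S Y n := by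
  refine bar_gr_le (fun r t' ht' => ?_) ht
  clear ht t
  rename' t' => t, ht' => ht
  induction r generalizing Y n with
  | zero =>
    refine step_gr_map (N := Bimod.unit C) (barMk (𝒳 := 𝒳) 0) (S Y n) ?_ ht
    intro X i j hij f hf h hh
    rw [zero_nsmul, add_zero] at hij
    rw [← hij]
    exact base Y X i j f hf h hh
  | succ r ih =>
    refine step_gr_map (N := barTerm 𝒳 r) (barMk (𝒳 := 𝒳) (r + 1)) (S Y n) ?_ ht
    intro X i j hij f hf w hw
    have hw' : w ∈ ((barTerm 𝒳 r).obj X Z).gr (j - r • G.ι + r • G.ι) := by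
      rwa [sub_add_cancel]
    -- The sign-twisted `f` is supplied because `barCons` applies the same sign again and the two
    -- cancel. The degree of `w` inside the bar complex is `j - r • G.ι`.
    have := cons Y X i _ _ (DGMod.par_mem _ ((r + 1) • G.ι) hf) _ (barMk_mem hw') (ih w hw')
    rw [barCons_mk] at this
    have e : i + (j - r • G.ι) + (0 - G.ι) = n := by
      rw [succ_nsmul] at hij
      rw [eq_sub_of_add_eq hij.symm]
      abel
    rw [DGMod.par_par, e] at this
    exact this

theorem d_barBase (X : 𝒳) {Y Z : C.Obj} (f : C.Hom Y X) (h : C.Hom X Z) :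
    ((Bar 𝒳).obj Y Z).d (barBase X f h) = barBase X ((C.Hom Y X).d f) h +
      barBase X ((C.Hom Y X).par G.ι f) ((C.Hom X Z).d h) := by
  rw [barBase_apply, d_barMk_zero]
  exact (congrArg (barMk (𝒳 := 𝒳) 0) (d_stepMk (N := Bimod.unit C) X f h)).trans (map_add _ _ _)

theorem barFace_zero_mk (X : 𝒳) {Y Z : C.Obj} (f : C.Hom Y X) (w : (barTerm 𝒳 0).obj X Z) :
    (barFace 𝒳 0).app Y Z (termMkSucc 0 X f w) = (barTerm 𝒳 0).actL f w -
      termMkZero X f (Bimod.toHom ((stepMul 𝒳 (Bimod.unit C)).app X Z w)) :=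
  congrArg₂ (fun a b : (barTerm 𝒳 0).obj Y Z => a - b) (stepMul_mk (N := barTerm 𝒳 0) X f w)
    (stepMap_mk (stepMul 𝒳 (Bimod.unit C)) X f w)

/-- The face that absorbs `f` acts on `w`; all other faces take place inside `w`, and their index
drops by one, whence the minus sign. -/
theorem barFace_succ_mk (r : ℕ) (X : 𝒳) {Y Z : C.Obj} (f : C.Hom Y X)
    (w : (barTerm 𝒳 (r + 1)).obj X Z) :
    (barFace 𝒳 (r + 1)).app Y Z (termMkSucc (r + 1) X f w) = (barTerm 𝒳 (r + 1)).actL f w -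
      termMkSucc r X f ((barFace 𝒳 r).app X Z w) :=
  congrArg₂ (fun a b : (barTerm 𝒳 (r + 1)).obj Y Z => a - b)
    (stepMul_mk (N := barTerm 𝒳 (r + 1)) X f w)
    (stepMap_mk (barFace 𝒳 r) X f w)

theorem d_termMkSucc (r : ℕ) (X : 𝒳) {Y Z : C.Obj} (f : C.Hom Y X)
    (w : (barTerm 𝒳 r).obj X Z) : ((barTerm 𝒳 (r + 1)).obj Y Z).d (termMkSucc r X f w) =
      termMkSucc r X ((C.Hom Y X).d f) w +
        termMkSucc r X ((C.Hom Y X).par G.ι f) (((barTerm 𝒳 r).obj X Z).d w) :=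
  d_stepMk (N := barTerm 𝒳 r) X f w

/-- `barCons f w` behaves like `f ⊗ s w` with a symbol `s` of degree `-ι`, where `d(s w) = w - s(d
w) - [1, ε(w)]`. For `f = 1` this is the contraction of the augmented bar complex at the objects of
`𝒳`. All later differentials of chains reduce to this formula. -/
theorem d_barCons (X : 𝒳) {Y Z : C.Obj} (f : C.Hom Y X) (w : (Bar 𝒳).obj X Z) :
    ((Bar 𝒳).obj Y Z).d (barCons X f w) = barCons X ((C.Hom Y X).d f) w +
      (Bar 𝒳).actL ((C.Hom Y X).par G.ι f) w -
      barCons X ((C.Hom Y X).par G.ι f) (((Bar 𝒳).obj X Z).d w) -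
      barBase X ((C.Hom Y X).par G.ι f) (Bimod.toHom ((counit 𝒳).app X Z w)) := by
  induction w using barMk_ind with
  | zero => simp
  | add s t hs ht => simp only [map_add, hs, ht]; abel
  | mk r w =>
    -- Prefixing raises the length by one, and each unit of length contributes one sign `(-1) ^ ⟨ι,
    -- |f|⟩`. These identities compare the powers of that sign at lengths `r` and `r + 1`.
    have e : ∀ r : ℕ, (C.Hom Y X).par ((r + 1) • G.ι) f =
        (C.Hom Y X).par (r • G.ι) ((C.Hom Y X).par G.ι f) := fun r => by
      rw [succ_nsmul, DGMod.par_add]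
    have e' : ∀ r : ℕ, (C.Hom Y X).par ((r + 1) • G.ι) ((C.Hom Y X).par G.ι f) =
        (C.Hom Y X).par (r • G.ι) f := fun r => by
      rw [succ_nsmul, DGMod.par_add, DGMod.par_par]
    have e'' : ∀ r : ℕ, (C.Hom Y X).par G.ι ((C.Hom Y X).par (r • G.ι) ((C.Hom Y X).par G.ι f)) =
        (C.Hom Y X).par (r • G.ι) f := fun r => by
      rw [DGMod.par_comm, DGMod.par_par]
    have s : ∀ r : ℕ, G.sgn ((r + 1) • G.ι) G.ι = - G.sgn (r • G.ι) G.ι := fun r => by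
      rw [succ_nsmul, G.sgn_add_left, G.sgn_ι, mul_neg_one]
    have s' : G.sgn (r • G.ι) G.ι * G.sgn (r • G.ι) G.ι = 1 := G.sgn_mul_self _ _
    -- The counit term comes from the last face when `w = [f₁, f₂]`. For longer `w` the counit
    -- vanishes, and the remaining faces all belong to `d w`.
    cases r with
    | zero =>
      rw [barCons_mk, barCons_mk, d_barMk_succ, d_termMkSucc, d_barMk_zero, barFace_zero_mk,
        actL_barMk, barCons_mk, counit_barMk_zero, barBase_apply, DGMod.d_par, e', e, e'', s]
      simp only [map_add, map_sub, zero_nsmul, DGMod.par_zero,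
        zero_add, G.sgn_zero_left, neg_smul, one_smul, map_neg, LinearMap.neg_apply]
      abel
    | succ r =>
      rw [barCons_mk, barCons_mk, d_barMk_succ, d_termMkSucc, d_barMk_succ, barFace_succ_mk,
        actL_barMk, counit_barMk_succ, DGMod.d_par, e', e, e'', s (r + 1)]
      simp only [map_add, map_sub, map_zsmul, barCons_mk, LinearMap.smul_apply, map_zero, sub_zero,
        smul_add, neg_smul, smul_neg, map_neg, LinearMap.neg_apply, smul_smul, neg_mul, neg_neg, s',
        one_smul, e']
      simp only [e]
      abel

theorem par_barBase (l : Γ) (X : 𝒳) {Y Z : C.Obj} (f : C.Hom Y X) (h : C.Hom X Z) :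
    ((Bar 𝒳).obj Y Z).par l (barBase X f h) =
      barBase X ((C.Hom Y X).par l f) ((C.Hom X Z).par l h) := by
  induction f using DGMod.ind with
  | add f f' hf hf' => simp only [map_add, LinearMap.add_apply, hf, hf']
  | homog i f hf =>
    induction h using DGMod.ind with
    | add h h' hh hh' => simp only [map_add, hh, hh']
    | homog j h hh =>
      rw [DGMod.par_of_mem _ _ hf, DGMod.par_of_mem _ _ hh,
        DGMod.par_of_mem _ _ (barBase_mem hf hh)]
      simp only [map_zsmul, LinearMap.smul_apply, smul_smul, G.sgn_add_right, mul_comm]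

/-- The extra factor `(-1) ^ ⟨l, ι⟩` accounts for the degree `-ι` of the prefixing operation. -/
theorem par_barCons (l : Γ) (X : 𝒳) {Y Z : C.Obj} (f : C.Hom Y X) (w : (Bar 𝒳).obj X Z) :
    ((Bar 𝒳).obj Y Z).par l (barCons X f w) =
      G.sgn l G.ι • barCons X ((C.Hom Y X).par l f) (((Bar 𝒳).obj X Z).par l w) := by
  induction f using DGMod.ind with
  | add f f' hf hf' => simp only [map_add, LinearMap.add_apply, smul_add, hf, hf']
  | homog i f hf =>
    induction w using DGMod.ind with
    | add w w' hw hw' => simp only [map_add, smul_add, hw, hw']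
    | homog j w hw =>
      rw [DGMod.par_of_mem _ _ hf, DGMod.par_of_mem _ _ hw,
        DGMod.par_of_mem _ _ (barCons_mem hf hw), zero_sub, G.sgn_add_right, G.sgn_add_right,
        G.sgn_symm l (-G.ι), G.sgn_neg_left, G.sgn_symm G.ι l]
      simp only [map_zsmul, LinearMap.smul_apply, smul_smul]
      congr 1
      ring

theorem actL_barBase (X : 𝒳) {Y' Y Z : C.Obj} (g : C.Hom Y' Y) (f : C.Hom Y X)
    (h : C.Hom X Z) : (Bar 𝒳).actL g (barBase X f h) = barBase X (C.comp g f) h := by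
  rw [barBase_apply, actL_barMk, zero_nsmul, DGMod.par_zero]
  exact congrArg (barMk (𝒳 := 𝒳) 0) (actL_stepMk (N := Bimod.unit C) X g f h)

theorem actR_barBase (X : 𝒳) {Y Z Z' : C.Obj} (g : C.Hom Z Z') (f : C.Hom Y X)
    (h : C.Hom X Z) : (Bar 𝒳).actR (barBase X f h) g = barBase X f (C.comp h g) := by
  rw [barBase_apply, actR_barMk]
  exact congrArg (barMk (𝒳 := 𝒳) 0) (actR_stepMk (N := Bimod.unit C) X g f h)

/-- No sign appears: the sign of the left action on length `r + 1` is multiplicative and is absorbed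
into the one that `barCons` puts on `g f`. -/
theorem actL_barCons (X : 𝒳) {Y' Y Z : C.Obj} (g : C.Hom Y' Y) (f : C.Hom Y X)
    (w : (Bar 𝒳).obj X Z) : (Bar 𝒳).actL g (barCons X f w) = barCons X (C.comp g f) w := by
  induction w using barMk_ind with
  | zero => simp
  | add s t hs ht => simp only [map_add, hs, ht]
  | mk r w =>
    rw [barCons_mk, actL_barMk, barCons_mk, C.par_comp]
    exact congrArg (barMk (𝒳 := 𝒳) (r + 1)) (actL_stepMk (N := barTerm 𝒳 r) X _ _ w)

theorem actR_barCons (X : 𝒳) {Y Z Z' : C.Obj} (g : C.Hom Z Z') (f : C.Hom Y X)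
    (w : (Bar 𝒳).obj X Z) : (Bar 𝒳).actR (barCons X f w) g = barCons X f ((Bar 𝒳).actR w g) := by
  induction w using barMk_ind with
  | zero => simp
  | add s t hs ht => simp only [map_add, LinearMap.add_apply, hs, ht]
  | mk r w =>
    rw [barCons_mk, actR_barMk, actR_barMk, barCons_mk]
    exact congrArg (barMk (𝒳 := 𝒳) (r + 1)) (actR_stepMk (N := barTerm 𝒳 r) X g _ w)

theorem counit_barBase (X : 𝒳) {Y Z : C.Obj} (f : C.Hom Y X) (h : C.Hom X Z) :
    (counit 𝒳).app Y Z (barBase X f h) = C.comp f h := by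
  rw [barBase_apply, counit_barMk_zero]
  exact stepMul_mk (N := Bimod.unit C) X f h

theorem counit_barCons (X : 𝒳) {Y Z : C.Obj} (f : C.Hom Y X) (w : (Bar 𝒳).obj X Z) :
    (counit 𝒳).app Y Z (barCons X f w) = 0 := by
  induction w using barMk_ind with
  | zero => simp
  | add s t hs ht => simp only [map_add, hs, ht, add_zero]
  | mk r w => rw [barCons_mk, counit_barMk_succ]

/-! ### Recursion on the bar complex -/

section recursion

variable {Z : C.Obj} {Q : C.Obj → Type w₃} [∀ Y, AddCommGroup (Q Y)] [∀ Y, Module k (Q Y)]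
  (b : ∀ Y (X : 𝒳), C.Hom Y X →ₗ[k] C.Hom X Z →ₗ[k] Q Y)
  (c : ∀ Y (X : 𝒳), C.Hom Y X →ₗ[k] (Bar 𝒳).obj X Z →ₗ[k] Q Y)
  (e : ∀ Y (X : 𝒳), C.Hom Y X →ₗ[k] Q X →ₗ[k] Q Y)

/-- The components of `barRec`. -/
def barRecApp : ∀ (r : ℕ) (Y : C.Obj), (barTerm 𝒳 r).obj Y Z →ₗ[k] Q Y
  | 0, Y => stepLift (N := Bimod.unit C) (b Y)
  | r + 1, Y => stepLift (N := barTerm 𝒳 r) fun X =>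
      ((c Y X).compl₂ (barMk r) + (e Y X).compl₂ (barRecApp r X)) ∘ₗ
        (C.Hom Y X).par ((r + 1) • G.ι)

/-- The linear maps `φ` out of the bar complex which are determined by
`φ [f, h] = b f h` and `φ (barCons f w) = c f w + e f (φ w)`. -/
def barRec (Y : C.Obj) : (Bar 𝒳).obj Y Z →ₗ[k] Q Y := barDesc fun r => barRecApp b c e r Y

theorem barRec_base {Y : C.Obj} (X : 𝒳) (f : C.Hom Y X) (h : C.Hom X Z) :
    barRec b c e Y (barBase X f h) = b Y X f h := by
  unfold barRec
  rw [barBase_apply, barDesc_mk]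
  exact stepLift_mk (N := Bimod.unit C) _ X f h

theorem barRec_cons {Y : C.Obj} (X : 𝒳) (f : C.Hom Y X) (w : (Bar 𝒳).obj X Z) :
    barRec b c e Y (barCons X f w) = c Y X f w + e Y X f (barRec b c e X w) := by
  induction w using barMk_ind with
  | zero => simp
  | add s t hs ht => simp only [map_add, hs, ht]; abel
  | mk r w =>
    unfold barRec
    rw [barCons_mk, barDesc_mk, barDesc_mk]
    refine (stepLift_mk (N := barTerm 𝒳 r) _ X _ w).trans ?_
    -- The sign operator built into `barRecApp` undoes the one in `barCons`, so the recursion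
    -- equation is free of signs.
    rw [LinearMap.comp_apply, DGMod.par_par]
    rfl

end recursion

end generators

end

end DGBar

namespace DGBar

noncomputable section

variable {Γ : Type x} [AddCommGroup Γ] {G : Grading Γ} {k : Type y} [CommRing k]
  {C : DGCat.{u₁, v₁} G k}

/-! ### Counit, concatenation and comultiplication of the bar complex. -/

section comul

variable {𝒳 : Set C.Obj}

/-- On `[f, h]` this is the Leibniz rule of `C`. On a longer chain the counit vanishes, and in
`d_barCons` the counits of the action term and of the base term are both `± f ε(w)`, with opposite
signs. -/
theorem counit_isClosed (𝒳 : Set C.Obj) : (counit 𝒳).IsClosed := by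
  rw [BimHom.isClosed_iff]
  intro Y Z t
  induction t using bar_induction with
  | zero Y => simp
  | add Y s t hs ht => simp only [map_add, hs, ht]
  | base Y X f h =>
    rw [d_barBase, map_add, counit_barBase, counit_barBase, counit_barBase]
    exact C.d_comp_par f h
  | cons Y X f w ih =>
    rw [d_barCons, map_sub, map_sub, map_add, counit_barCons, counit_barCons, counit_barCons,
      counit_barBase, BimHom.app_actL_zero, map_zero, zero_add, sub_zero]
    exact (sub_self _).symm

/-! ### The homotopy between the two counits -/

/-- The bilinear map `(f, h) ↦ (q ↦ (-1) ^ ⟨ι, |f|⟩ barCons f (h · q))`. -/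
def concBase {W Z : C.Obj} (Y : C.Obj) (X : 𝒳) : C.Hom Y X →ₗ[k] C.Hom X W →ₗ[k]
    (Bar 𝒳).obj W Z →ₗ[k] (Bar 𝒳).obj Y Z :=
  LinearMap.mk₂ k (fun f h => barCons X ((C.Hom Y X).par G.ι f) ∘ₗ (Bar 𝒳).actL h)
    (by intros; ext; simp) (by intros; ext; simp) (by intros; ext; simp) (by intros; ext; simp)

/-- The bilinear map `(f, φ) ↦ (q ↦ -(-1) ^ ⟨ι, |f|⟩ barCons f (φ q))`. -/
def concStep {W Z : C.Obj} (Y : C.Obj) (X : 𝒳) : C.Hom Y X →ₗ[k]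
    ((Bar 𝒳).obj W Z →ₗ[k] (Bar 𝒳).obj X Z) →ₗ[k] (Bar 𝒳).obj W Z →ₗ[k] (Bar 𝒳).obj Y Z :=
  LinearMap.mk₂ k (fun f φ => -(barCons X ((C.Hom Y X).par G.ι f) ∘ₗ φ))
    (by intros; ext; simp; abel) (by intros; ext; simp) (by intros; ext; simp; abel)
    (by intros; ext; simp)

/-- The concatenation
`[f₀, …, f_r, h] ⊗ [h', g₁, …, g_{s+1}] ↦ ± [f₀, …, f_r, h ∘ h', g₁, …, g_{s+1}]`. -/
def conc {Y W Z : C.Obj} : (Bar 𝒳).obj Y W →ₗ[k] (Bar 𝒳).obj W Z →ₗ[k] (Bar 𝒳).obj Y Z :=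
  barRec (Q := fun Y => (Bar 𝒳).obj W Z →ₗ[k] (Bar 𝒳).obj Y Z) concBase (fun _ _ => 0) concStep Y

theorem conc_base {Y W Z : C.Obj} (X : 𝒳) (f : C.Hom Y X) (h : C.Hom X W)
    (q : (Bar 𝒳).obj W Z) : conc (barBase X f h) q =
      barCons X ((C.Hom Y X).par G.ι f) ((Bar 𝒳).actL h q) := by
  unfold conc
  rw [barRec_base]
  rfl

/-- The operator `conc` has degree `-ι`. Passing it over `f` gives the sign operator, and passing it
over the shift symbol in `barCons` gives the minus sign. -/
theorem conc_cons {Y W Z : C.Obj} (X : 𝒳) (f : C.Hom Y X) (w : (Bar 𝒳).obj X W)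
    (q : (Bar 𝒳).obj W Z) : conc (barCons X f w) q =
      -barCons X ((C.Hom Y X).par G.ι f) (conc w q) := by
  unfold conc
  rw [barRec_cons]
  exact DFunLike.congr_fun (zero_add (concStep Y X f (barRec concBase (fun _ _ => 0) concStep X.1 w))) q

theorem conc_mem {Y W Z : C.Obj} {i j : Γ} {p : (Bar 𝒳).obj Y W} {q : (Bar 𝒳).obj W Z}
    (hp : p ∈ ((Bar 𝒳).obj Y W).gr i) (hq : q ∈ ((Bar 𝒳).obj W Z).gr j) :
    conc p q ∈ ((Bar 𝒳).obj Y Z).gr (i + j + (0 - G.ι)) := by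
  refine bar_homog_induction (S := fun Y i =>
    (((Bar 𝒳).obj Y Z).gr (i + j + (0 - G.ι))).comap (conc.flip q)) ?_ ?_ hp
  · intro Y X a b f hf h hh
    rw [Submodule.mem_comap, LinearMap.flip_apply, conc_base, add_assoc a]
    exact barCons_mem (DGMod.par_mem _ _ hf) ((Bar 𝒳).actL_mem hh hq)
  · intro Y X a b f hf w hw ih
    rw [Submodule.mem_comap, LinearMap.flip_apply] at ih ⊢
    rw [conc_cons]
    refine Submodule.neg_mem _ ?_
    have := barCons_mem (DGMod.par_mem _ G.ι hf) ih
    rwa [show a + (b + j + (0 - G.ι)) = a + b + (0 - G.ι) + j by abel] at this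

theorem conc_actL {Y' Y W Z : C.Obj} (g : C.Hom Y' Y) (p : (Bar 𝒳).obj Y W)
    (q : (Bar 𝒳).obj W Z) :
    conc ((Bar 𝒳).actL g p) q = (Bar 𝒳).actL ((C.Hom Y' Y).par G.ι g) (conc p q) := by
  induction p using bar_induction with
  | zero Y => simp
  | add Y s t hs ht => simp only [map_add, LinearMap.add_apply, hs, ht]
  | base Y X f h => rw [actL_barBase, conc_base, conc_base, actL_barCons, C.par_comp]
  | cons Y X f w ih =>
    rw [actL_barCons, conc_cons, conc_cons, map_neg, actL_barCons, C.par_comp]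

theorem conc_actR {Y W Z Z' : C.Obj} (p : (Bar 𝒳).obj Y W) (q : (Bar 𝒳).obj W Z)
    (g : C.Hom Z Z') : conc p ((Bar 𝒳).actR q g) = (Bar 𝒳).actR (conc p q) g := by
  induction p using bar_induction with
  | zero Y => simp
  | add Y s t hs ht => simp only [map_add, LinearMap.add_apply, hs, ht]
  | base Y X f h => rw [conc_base, conc_base, actR_barCons, (Bar 𝒳).actL_actR]
  | cons Y X f w ih => rw [conc_cons, conc_cons, map_neg, LinearMap.neg_apply, actR_barCons, ih]

/-- At the junction this is associativity of the action, `(h f) · q = h · (f · q)`; the entries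
further left are not involved. -/
theorem conc_balanced {Y W W' Z : C.Obj} (p : (Bar 𝒳).obj Y W) (f : C.Hom W W')
    (q : (Bar 𝒳).obj W' Z) : conc ((Bar 𝒳).actR p f) q = conc p ((Bar 𝒳).actL f q) := by
  induction p using bar_induction with
  | zero Y => simp
  | add Y s t hs ht => simp only [map_add, LinearMap.add_apply, hs, ht]
  | base Y X g h => rw [actR_barBase, conc_base, conc_base, (Bar 𝒳).comp_actL]
  | cons Y X g w ih => rw [actR_barCons, conc_cons, conc_cons, ih]

/-- A concatenation always has an inner entry, and the counit sees only chains without one. -/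
theorem counit_conc {Y W Z : C.Obj} (p : (Bar 𝒳).obj Y W) (q : (Bar 𝒳).obj W Z) :
    (counit 𝒳).app Y Z (conc p q) = 0 := by
  induction p using bar_induction with
  | zero Y => simp
  | add Y s t hs ht => simp only [map_add, LinearMap.add_apply, hs, ht, add_zero]
  | base Y X f h => rw [conc_base, counit_barCons]
  | cons Y X f w ih => rw [conc_cons, map_neg, counit_barCons, neg_zero]

/-- Concatenation leaves the junction as one inner entry, and the faces next to it are new only when
one side has minimal length. These exceptional faces give `ε(p) q` and `p ε(q)`; all others come
from the differentials of `p` and `q`. -/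
theorem d_conc {Y W Z : C.Obj} (p : (Bar 𝒳).obj Y W) (q : (Bar 𝒳).obj W Z) :
    ((Bar 𝒳).obj Y Z).d (conc p q) =
      (Bar 𝒳).actL (Bimod.toHom ((counit 𝒳).app Y W p)) q -
      (Bar 𝒳).actR p (Bimod.toHom ((counit 𝒳).app W Z q)) -
      conc (((Bar 𝒳).obj Y W).d p) q -
      conc (((Bar 𝒳).obj Y W).par G.ι p) (((Bar 𝒳).obj W Z).d q) := by
  induction p using bar_induction with
  | zero Y => simp
  | add Y s t hs ht => simp only [map_add, LinearMap.add_apply, hs, ht]; abel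
  | base Y X f h =>
    rw [conc_base, d_barCons, counit_barBase, d_barBase, par_barBase, map_add,
      LinearMap.add_apply, conc_base, conc_base, conc_base, DGMod.par_par, DGMod.d_par, DGMod.sgn_ι_smul,
      (Bar 𝒳).d_actL_par, BimHom.app_actL_zero, actR_barBase, Bimod.toHom_actL]
    simp only [map_add, map_neg, LinearMap.neg_apply]
    rw [← (Bar 𝒳).comp_actL]
    -- The counit takes values in the identity bimodule, on which `toHom` is the identity, so the
    -- first term is the action of `f h` and cancels against the face of `d_barCons`.
    change _ = (Bar 𝒳).actL (C.comp f h) q - _ - _ - _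
    abel
  | cons Y X f w ih =>
    -- The counit term in `d(barCons f w)` is a chain `[f, ε(w)]` up to sign. Its concatenation with
    -- `q` cancels the term `ε(w) q` that the induction hypothesis places behind `f`.
    rw [conc_cons, map_neg, d_barCons, counit_conc, counit_barCons, d_barCons, par_barCons,
      DGMod.par_par, DGMod.d_par, DGMod.sgn_ι_smul, DGMod.sgn_ι_smul, ih, actR_barCons]
    simp only [map_add, map_sub, LinearMap.add_apply, LinearMap.sub_apply, map_zero, sub_zero,
      conc_cons, conc_base, conc_actL, DGMod.par_par, map_neg, LinearMap.neg_apply,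
      LinearMap.zero_apply]
    abel

/-- The components of `concHom`. -/
def concApp (Y Z : C.Obj) :
    (Bimod.tensorOver (Bar 𝒳) (Bar 𝒳)).obj Y Z →ₗ[k] (Bar 𝒳).obj Y Z :=
  Bimod.tlift (fun _ => conc) conc_balanced

theorem concApp_tmul {Y W Z : C.Obj} (p : (Bar 𝒳).obj Y W) (q : (Bar 𝒳).obj W Z) :
    concApp Y Z (Bimod.tmul W p q) = conc p q :=
  Bimod.tlift_tmul _ conc_balanced p q

theorem concApp_mem {Y Z : C.Obj} {n : Γ} {t : (Bimod.tensorOver (Bar 𝒳) (Bar 𝒳)).obj Y Z}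
    (ht : t ∈ ((Bimod.tensorOver (Bar 𝒳) (Bar 𝒳)).obj Y Z).gr n) :
    concApp Y Z t ∈ ((Bar 𝒳).obj Y Z).gr (n + (0 - G.ι)) := by
  refine Bimod.tensorOver_gr_map (concApp Y Z) _ ?_ ht
  rintro W i j rfl p hp q hq
  rw [concApp_tmul]
  exact conc_mem hp hq

theorem concApp_actL {Y' Y Z : C.Obj} (g : C.Hom Y' Y)
    (t : (Bimod.tensorOver (Bar 𝒳) (Bar 𝒳)).obj Y Z) :
    concApp Y' Z ((Bimod.tensorOver (Bar 𝒳) (Bar 𝒳)).actL g t) =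
      (Bar 𝒳).actL ((C.Hom Y' Y).par (0 - G.ι) g) (concApp Y Z t) := by
  induction t using Bimod.tensorOver_ind with
  | zero => simp only [map_zero]
  | add s t hs ht => simp only [map_add, hs, ht]
  | tmul W i p hp j q hq =>
    rw [Bimod.actL_tmul, concApp_tmul, concApp_tmul, conc_actL, zero_sub, DGMod.par_neg]

theorem concApp_actR {Y Z Z' : C.Obj} (t : (Bimod.tensorOver (Bar 𝒳) (Bar 𝒳)).obj Y Z)
    (g : C.Hom Z Z') : concApp Y Z' ((Bimod.tensorOver (Bar 𝒳) (Bar 𝒳)).actR t g) =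
      (Bar 𝒳).actR (concApp Y Z t) g := by
  induction t using Bimod.tensorOver_ind with
  | zero => simp only [map_zero, LinearMap.zero_apply]
  | add s t hs ht => simp only [map_add, LinearMap.add_apply, hs, ht]
  | tmul W i p hp j q hq =>
    rw [Bimod.actR_tmul, concApp_tmul, concApp_tmul, conc_actR]

/-- The concatenation, as a bimodule map of degree `-ι`. -/
def concHom (𝒳 : Set C.Obj) :
    BimHom (0 - G.ι) (Bimod.tensorOver (Bar 𝒳) (Bar 𝒳)) (Bar 𝒳) :=
  .ofPar _ concApp concApp_mem concApp_actL concApp_actR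

theorem concHom_tmul {Y W Z : C.Obj} (p : (Bar 𝒳).obj Y W) (q : (Bar 𝒳).obj W Z) :
    (concHom 𝒳).app Y Z (Bimod.tmul W p q) = conc p q :=
  concApp_tmul p q

theorem whiskerLeft_homotopic_whiskerRight (𝒳 : Set C.Obj) :
    ((counit 𝒳).whiskerLeft (Bar 𝒳)).Homotopic (BimHom.whiskerRight (Bar 𝒳) (counit 𝒳)) := by
  rw [BimHom.homotopic_iff]
  refine ⟨concHom 𝒳, fun Y Z t => ?_⟩
  induction t using Bimod.tensorOver_ind with
  | zero => simp
  | add s t hs ht =>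
    simp only [map_add]
    rw [add_sub_add_comm, hs, ht]
    abel
  | tmul W i p hp j q hq =>
    rw [BimHom.whiskerLeft_tmul, BimHom.whiskerRight_tmul, Bimod.d_tmul, map_add, concHom_tmul,
      concHom_tmul, concHom_tmul, d_conc]
    abel

/-! ### The comultiplication -/

/-- The bilinear map `(p, q) ↦ (f ↦ barCons f p ⊗ q)`. -/
def tensorConsBilin (X : 𝒳) (Y Z W : C.Obj) : (Bar 𝒳).obj X W →ₗ[k] (Bar 𝒳).obj W Z →ₗ[k]
    C.Hom Y X →ₗ[k] (Bimod.tensorOver (Bar 𝒳) (Bar 𝒳)).obj Y Z :=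
  flipComp (barCons X) (Bimod.tmul W)

theorem tensorCons_balanced (X : 𝒳) {Y Z W W' : C.Obj} (p : (Bar 𝒳).obj X W) (g : C.Hom W W')
    (q : (Bar 𝒳).obj W' Z) : tensorConsBilin X Y Z W' ((Bar 𝒳).actR p g) q =
      tensorConsBilin X Y Z W p ((Bar 𝒳).actL g q) := by
  ext f
  change Bimod.tmul W' (barCons X f ((Bar 𝒳).actR p g)) q =
    Bimod.tmul W (barCons X f p) ((Bar 𝒳).actL g q)
  rw [← actR_barCons, Bimod.tmul_actR]

/-- The bilinear map `(f, p ⊗ q) ↦ barCons f p ⊗ q`. -/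
def tensorCons (X : 𝒳) {Y Z : C.Obj} : C.Hom Y X →ₗ[k]
    (Bimod.tensorOver (Bar 𝒳) (Bar 𝒳)).obj X Z →ₗ[k]
      (Bimod.tensorOver (Bar 𝒳) (Bar 𝒳)).obj Y Z :=
  (Bimod.tlift (fun W => tensorConsBilin X Y Z W) (tensorCons_balanced X)).flip

theorem tensorCons_tmul (X : 𝒳) {Y W Z : C.Obj} (f : C.Hom Y X) (p : (Bar 𝒳).obj X W)
    (q : (Bar 𝒳).obj W Z) :
    tensorCons X f (Bimod.tmul W p q) = Bimod.tmul W (barCons X f p) q :=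
  DFunLike.congr_fun (Bimod.tlift_tmul (fun W => tensorConsBilin X Y Z W)
    (tensorCons_balanced X) p q) f

theorem tensorCons_mem {X : 𝒳} {Y Z : C.Obj} {i j : Γ} {f : C.Hom Y X}
    {t : (Bimod.tensorOver (Bar 𝒳) (Bar 𝒳)).obj X Z} (hf : f ∈ (C.Hom Y X).gr i)
    (ht : t ∈ ((Bimod.tensorOver (Bar 𝒳) (Bar 𝒳)).obj X Z).gr j) :
    tensorCons X f t ∈
      ((Bimod.tensorOver (Bar 𝒳) (Bar 𝒳)).obj Y Z).gr (i + j + (0 - G.ι)) := by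
  refine Bimod.tensorOver_gr_map (tensorCons X f) _ ?_ ht
  rintro W a b rfl p hp q hq
  rw [tensorCons_tmul, show i + (a + b) + (0 - G.ι) = i + a + (0 - G.ι) + b by abel]
  exact Bimod.tmul_mem (barCons_mem hf hp) hq

theorem actL_tensorCons (X : 𝒳) {Y' Y Z : C.Obj} (g : C.Hom Y' Y) (f : C.Hom Y X)
    (t : (Bimod.tensorOver (Bar 𝒳) (Bar 𝒳)).obj X Z) :
    (Bimod.tensorOver (Bar 𝒳) (Bar 𝒳)).actL g (tensorCons X f t) =
      tensorCons X (C.comp g f) t := by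
  induction t using Bimod.tensorOver_ind with
  | zero => simp
  | add s t hs ht => simp only [map_add, hs, ht]
  | tmul W i p hp j q hq => rw [tensorCons_tmul, tensorCons_tmul, Bimod.actL_tmul, actL_barCons]

theorem actR_tensorCons (X : 𝒳) {Y Z Z' : C.Obj} (g : C.Hom Z Z') (f : C.Hom Y X)
    (t : (Bimod.tensorOver (Bar 𝒳) (Bar 𝒳)).obj X Z) :
    (Bimod.tensorOver (Bar 𝒳) (Bar 𝒳)).actR (tensorCons X f t) g =
      tensorCons X f ((Bimod.tensorOver (Bar 𝒳) (Bar 𝒳)).actR t g) := by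
  induction t using Bimod.tensorOver_ind with
  | zero => simp
  | add s t hs ht => simp only [map_add, LinearMap.add_apply, hs, ht]
  | tmul W i p hp j q hq =>
    rw [tensorCons_tmul, Bimod.actR_tmul, Bimod.actR_tmul, tensorCons_tmul]

/-- This is `d_barCons` in the left factor. Its counit term `[f, ε(p)] ⊗ q` becomes `[f, 1] ⊗ ε(p)
q` by balancing, and therefore depends on `t` only through `ε ⊗ 1`. -/
theorem d_tensorCons (X : 𝒳) {Y Z : C.Obj} (f : C.Hom Y X)
    (t : (Bimod.tensorOver (Bar 𝒳) (Bar 𝒳)).obj X Z) :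
    ((Bimod.tensorOver (Bar 𝒳) (Bar 𝒳)).obj Y Z).d (tensorCons X f t) =
      tensorCons X ((C.Hom Y X).d f) t +
      (Bimod.tensorOver (Bar 𝒳) (Bar 𝒳)).actL ((C.Hom Y X).par G.ι f) t -
      tensorCons X ((C.Hom Y X).par G.ι f)
        (((Bimod.tensorOver (Bar 𝒳) (Bar 𝒳)).obj X Z).d t) -
      Bimod.tmul X.1 (barBase X ((C.Hom Y X).par G.ι f) (C.id X))
        (((counit 𝒳).whiskerLeft (Bar 𝒳)).app X Z t) := by
  induction t using Bimod.tensorOver_ind with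
  | zero => simp
  | add s t hs ht => simp only [map_add, hs, ht]; abel
  | tmul W i p hp j q hq =>
    rw [tensorCons_tmul, Bimod.d_tmul, d_barCons, Bimod.d_tmul, map_add, tensorCons_tmul,
      tensorCons_tmul, tensorCons_tmul, BimHom.whiskerLeft_tmul, par_barCons, Bimod.actL_tmul,
      ← Bimod.tmul_actR, actR_barBase, C.id_comp, DGMod.sgn_ι_smul]
    simp only [map_add, map_sub, map_neg, LinearMap.add_apply, LinearMap.sub_apply,
      LinearMap.neg_apply]
    abel

/-- The bilinear map `(f, h) ↦ [f, id] ⊗ [id, h]`. -/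
def comulBase (Z Y : C.Obj) (X : 𝒳) : C.Hom Y X →ₗ[k] C.Hom X Z →ₗ[k]
    (Bimod.tensorOver (Bar 𝒳) (Bar 𝒳)).obj Y Z :=
  (Bimod.tmul X.1).compl₁₂ ((barBase X).flip (C.id X)) (barBase X (C.id X))

/-- The bilinear map `(f, w) ↦ [f, id] ⊗ barCons id w`. -/
def comulCons (Z Y : C.Obj) (X : 𝒳) : C.Hom Y X →ₗ[k] (Bar 𝒳).obj X Z →ₗ[k]
    (Bimod.tensorOver (Bar 𝒳) (Bar 𝒳)).obj Y Z :=
  (Bimod.tmul X.1).compl₁₂ ((barBase X).flip (C.id X)) (barCons X (C.id X))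

/-- The components of the comultiplication. -/
def comulApp (Y Z : C.Obj) :
    (Bar 𝒳).obj Y Z →ₗ[k] (Bimod.tensorOver (Bar 𝒳) (Bar 𝒳)).obj Y Z :=
  barRec (Q := fun Y => (Bimod.tensorOver (Bar 𝒳) (Bar 𝒳)).obj Y Z) (comulBase Z) (comulCons Z)
    (fun _ X => tensorCons X) Y

theorem comulApp_base {Y Z : C.Obj} (X : 𝒳) (f : C.Hom Y X) (h : C.Hom X Z) :
    comulApp Y Z (barBase X f h) =
      Bimod.tmul X.1 (barBase X f (C.id X)) (barBase X (C.id X) h) := by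
  unfold comulApp
  rw [barRec_base]
  rfl

/-- The first summand cuts the chain immediately after `f`; the second leaves `f` on the left factor
and cuts inside `w`. -/
theorem comulApp_cons {Y Z : C.Obj} (X : 𝒳) (f : C.Hom Y X) (w : (Bar 𝒳).obj X Z) :
    comulApp Y Z (barCons X f w) =
      Bimod.tmul X.1 (barBase X f (C.id X)) (barCons X (C.id X) w) +
        tensorCons X f (comulApp X Z w) := by
  unfold comulApp
  rw [barRec_cons]
  rfl

theorem comulApp_mem {Y Z : C.Obj} {n : Γ} {t : (Bar 𝒳).obj Y Z}
    (ht : t ∈ ((Bar 𝒳).obj Y Z).gr n) :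
    comulApp Y Z t ∈ ((Bimod.tensorOver (Bar 𝒳) (Bar 𝒳)).obj Y Z).gr n := by
  refine bar_homog_induction (S := fun Y n =>
    (((Bimod.tensorOver (Bar 𝒳) (Bar 𝒳)).obj Y Z).gr n).comap (comulApp Y Z)) ?_ ?_ ht
  · intro Y X a b f hf h hh
    rw [Submodule.mem_comap, comulApp_base]
    have := Bimod.tmul_mem (barBase_mem hf (C.id_mem X)) (barBase_mem (C.id_mem X) hh)
    rwa [add_zero, zero_add] at this
  · intro Y X a b f hf w hw ih
    rw [Submodule.mem_comap] at ih ⊢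
    rw [comulApp_cons]
    refine Submodule.add_mem _ ?_ (tensorCons_mem hf ih)
    have := Bimod.tmul_mem (barBase_mem hf (C.id_mem X)) (barCons_mem (C.id_mem X) hw)
    rwa [add_zero, zero_add, ← add_assoc] at this

theorem comulApp_actL {Y' Y Z : C.Obj} (g : C.Hom Y' Y) (t : (Bar 𝒳).obj Y Z) :
    comulApp Y' Z ((Bar 𝒳).actL g t) =
      (Bimod.tensorOver (Bar 𝒳) (Bar 𝒳)).actL g (comulApp Y Z t) := by
  induction t using bar_induction with
  | zero Y => simp only [map_zero]
  | add Y s t hs ht => simp only [map_add, hs, ht]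
  | base Y X f h =>
    rw [actL_barBase, comulApp_base, comulApp_base, Bimod.actL_tmul, actL_barBase]
  | cons Y X f w ih =>
    rw [actL_barCons, comulApp_cons, comulApp_cons, map_add, Bimod.actL_tmul, actL_barBase,
      actL_tensorCons]

theorem comulApp_actR {Y Z Z' : C.Obj} (t : (Bar 𝒳).obj Y Z) (g : C.Hom Z Z') :
    comulApp Y Z' ((Bar 𝒳).actR t g) =
      (Bimod.tensorOver (Bar 𝒳) (Bar 𝒳)).actR (comulApp Y Z t) g := by
  induction t using bar_induction with
  | zero Y => simp only [map_zero, LinearMap.zero_apply]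
  | add Y s t hs ht => simp only [map_add, LinearMap.add_apply, hs, ht]
  | base Y X f h =>
    rw [actR_barBase, comulApp_base, comulApp_base, Bimod.actR_tmul, actR_barBase]
  | cons Y X f w ih =>
    rw [actR_barCons, comulApp_cons, comulApp_cons, map_add, LinearMap.add_apply,
      Bimod.actR_tmul, actR_barCons, actR_tensorCons, ih]

/-- The comultiplication of the bar complex,
`[f₀, …, f_{r+1}] ↦ ∑_i ± [f₀, …, f_i, id] ⊗ [id, f_{i+1}, …, f_{r+1}]`. -/
def comul (𝒳 : Set C.Obj) : BimHom (0 : Γ) (Bar 𝒳) (Bimod.tensorOver (Bar 𝒳) (Bar 𝒳)) :=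
  .ofZero comulApp comulApp_mem comulApp_actL comulApp_actR

theorem comul_base {Y Z : C.Obj} (X : 𝒳) (f : C.Hom Y X) (h : C.Hom X Z) :
    (comul 𝒳).app Y Z (barBase X f h) =
      Bimod.tmul X.1 (barBase X f (C.id X)) (barBase X (C.id X) h) :=
  comulApp_base X f h

theorem comul_cons {Y Z : C.Obj} (X : 𝒳) (f : C.Hom Y X) (w : (Bar 𝒳).obj X Z) :
    (comul 𝒳).app Y Z (barCons X f w) =
      Bimod.tmul X.1 (barBase X f (C.id X)) (barCons X (C.id X) w) +
        tensorCons X f ((comul 𝒳).app X Z w) :=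
  comulApp_cons X f w

/-- `ε ⊗ 1` kills every term whose left factor has length greater than zero. Only the first cut
survives, and it returns the chain itself. -/
theorem whiskerLeft_comul (𝒳 : Set C.Obj) :
    ((counit 𝒳).whiskerLeft (Bar 𝒳)).comp (comul 𝒳) = BimHom.id (Bar 𝒳) := by
  have key : ∀ {X : 𝒳} {Y Z} (f : C.Hom Y X) (t : (Bimod.tensorOver (Bar 𝒳) (Bar 𝒳)).obj X Z),
      ((counit 𝒳).whiskerLeft (Bar 𝒳)).app Y Z (tensorCons X f t) = 0 := by
    intro X Y Z f t
    induction t using Bimod.tensorOver_ind with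
    | zero => simp
    | add s t hs ht => simp only [map_add, hs, ht, add_zero]
    | tmul W i p hp j q hq =>
      rw [tensorCons_tmul, BimHom.whiskerLeft_tmul, counit_barCons, map_zero, map_zero,
        LinearMap.zero_apply]
  ext Y Z t
  rw [BimHom.comp_app, BimHom.id_app]
  induction t using bar_induction with
  | zero Y => simp
  | add Y s t hs ht => simp only [map_add, hs, ht]
  | base Y X f h =>
    rw [comul_base, BimHom.whiskerLeft_tmul, counit_barBase, C.comp_id, actL_barBase]
    exact congrArg (fun a => barBase X a h) (C.comp_id f)
  | cons Y X f w ih =>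
    rw [comul_cons, map_add, key, add_zero, BimHom.whiskerLeft_tmul, counit_barBase, C.comp_id,
      actL_barCons]
    exact congrArg (fun a => barCons X a w) (C.comp_id f)

/-- `1 ⊗ ε` kills the first cut of a longer chain and commutes with prefixing on the left factor, so
the claim descends to the tail until only `[f, h]` is left. -/
theorem whiskerRight_comul (𝒳 : Set C.Obj) :
    (BimHom.whiskerRight (Bar 𝒳) (counit 𝒳)).comp (comul 𝒳) = BimHom.id (Bar 𝒳) := by
  have key : ∀ {X : 𝒳} {Y Z} (f : C.Hom Y X) (t : (Bimod.tensorOver (Bar 𝒳) (Bar 𝒳)).obj X Z),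
      (BimHom.whiskerRight (Bar 𝒳) (counit 𝒳)).app Y Z (tensorCons X f t) =
        barCons X f ((BimHom.whiskerRight (Bar 𝒳) (counit 𝒳)).app X Z t) := by
    intro X Y Z f t
    induction t using Bimod.tensorOver_ind with
    | zero => simp
    | add s t hs ht => simp only [map_add, hs, ht]
    | tmul W i p hp j q hq =>
      rw [tensorCons_tmul, BimHom.whiskerRight_tmul, BimHom.whiskerRight_tmul, actR_barCons]
  ext Y Z t
  rw [BimHom.comp_app, BimHom.id_app]
  induction t using bar_induction with
  | zero Y => simp
  | add Y s t hs ht => simp only [map_add, hs, ht]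
  | base Y X f h =>
    rw [comul_base, BimHom.whiskerRight_tmul, counit_barBase, C.id_comp, actR_barBase]
    exact congrArg (barBase X f) (C.id_comp h)
  | cons Y X f w ih =>
    rw [comul_cons, map_add, key, ih, BimHom.whiskerRight_tmul, counit_barCons, map_zero,
      map_zero, zero_add]

/-- Apply the Leibniz rule to `1 = 1 ∘ 1`: it gives `d 1 = d 1 + d 1`. -/
theorem DGCat.d_id (C : DGCat.{u₁, v₁} G k) (X : C.Obj) : (C.Hom X X).d (C.id X) = 0 := by
  have h := C.d_comp (C.id X) (C.id_mem X)
  rw [C.id_comp, C.comp_id, G.sgn_zero_right, one_smul, C.id_comp] at h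
  exact left_eq_add.1 h

theorem DGCat.par_id (C : DGCat.{u₁, v₁} G k) (l : Γ) (X : C.Obj) :
    (C.Hom X X).par l (C.id X) = C.id X := by
  rw [DGMod.par_of_mem _ _ (C.id_mem X), G.sgn_zero_right, one_smul]

/-- Differentiating the cut `[f, 1] ⊗ barCons 1 w` produces an unwanted `[f, 1] ⊗ w` up to sign. By
`d_tensorCons` the tail contributes the opposite of `[f, 1] ⊗ (ε ⊗ 1)(Δ w)`, and the left counit law
makes the two cancel. -/
theorem comul_isClosed (𝒳 : Set C.Obj) : (comul 𝒳).IsClosed := by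
  rw [BimHom.isClosed_iff]
  intro Y Z t
  induction t using bar_induction with
  | zero Y => simp
  | add Y s t hs ht => simp only [map_add, hs, ht]
  | base Y X f h =>
    rw [comul_base, Bimod.d_tmul, d_barBase, d_barBase, d_barBase,
      map_add ((comul 𝒳).app Y Z), comul_base, comul_base, par_barBase, C.d_id, C.par_id]
    simp only [map_zero, LinearMap.zero_apply, add_zero, zero_add]
  | cons Y X f w ih =>
    have hw : ((counit 𝒳).whiskerLeft (Bar 𝒳)).app X Z ((comul 𝒳).app X Z w) = w :=
      congrArg (fun φ : BimHom (0 : Γ) (Bar 𝒳) (Bar 𝒳) => φ.app X Z w) (whiskerLeft_comul 𝒳)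
    rw [comul_cons, map_add, Bimod.d_tmul, d_barBase, d_barCons, d_tensorCons, hw, ih,
      d_barCons, map_sub ((comul 𝒳).app Y Z), map_sub ((comul 𝒳).app Y Z),
      map_add ((comul 𝒳).app Y Z), comul_cons, comul_cons, comul_base,
      BimHom.app_actL_zero, par_barBase, C.d_id, C.par_id, (Bar 𝒳).id_actL]
    simp only [map_zero, LinearMap.zero_apply, add_zero, zero_add, map_sub]
    abel

theorem bar_isCounitalIdempotent (𝒳 : Set C.Obj) : IsCounitalIdempotent (Bar 𝒳) (counit 𝒳) :=
  isCounitalIdempotent_of_comul (counit_isClosed 𝒳) (comul_isClosed 𝒳) (whiskerLeft_comul 𝒳)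
    (whiskerRight_comul 𝒳) (whiskerLeft_homotopic_whiskerRight 𝒳)

theorem bar_homotopic_id {φ : BimHom (0 : Γ) (Bar 𝒳) (Bar 𝒳)} (hφ : φ.IsClosed)
    (h : ((counit 𝒳).comp φ).Homotopic (counit 𝒳)) : φ.Homotopic (BimHom.id (Bar 𝒳)) :=
  BimHom.homotopic_id_of_counit (comul_isClosed 𝒳) (whiskerLeft_comul 𝒳)
    (whiskerRight_comul 𝒳) (whiskerLeft_homotopic_whiskerRight 𝒳) hφ h

end comul

/-! ### The inclusion of bar complexes -/

section inclusion

variable {𝒳 𝒴 : Set C.Obj} (h𝒳𝒴 : 𝒳 ⊆ 𝒴)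

/-- The components of the inclusion of bar complexes. -/
def barInclusionApp (Y Z : C.Obj) : (Bar 𝒳).obj Y Z →ₗ[k] (Bar 𝒴).obj Y Z :=
  barRec (Q := fun Y => (Bar 𝒴).obj Y Z) (fun _ X => barBase (Set.inclusion h𝒳𝒴 X))
    (fun _ _ => 0) (fun _ X => barCons (Set.inclusion h𝒳𝒴 X)) Y

theorem barInclusionApp_base {Y Z : C.Obj} (X : 𝒳) (f : C.Hom Y X) (h : C.Hom X Z) :
    barInclusionApp h𝒳𝒴 Y Z (barBase X f h) = barBase (Set.inclusion h𝒳𝒴 X) f h := by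
  unfold barInclusionApp
  rw [barRec_base]

theorem barInclusionApp_cons {Y Z : C.Obj} (X : 𝒳) (f : C.Hom Y X) (w : (Bar 𝒳).obj X Z) :
    barInclusionApp h𝒳𝒴 Y Z (barCons X f w) =
      barCons (Set.inclusion h𝒳𝒴 X) f (barInclusionApp h𝒳𝒴 X Z w) := by
  unfold barInclusionApp
  rw [barRec_cons]
  exact zero_add _

/-- The inclusion `Bar(C, 𝒳) → Bar(C, 𝒴)` for `𝒳 ⊆ 𝒴`. -/
def barInclusion : BimHom (0 : Γ) (Bar 𝒳) (Bar 𝒴) :=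
  .ofZero (barInclusionApp h𝒳𝒴)
    (by
      intro Y Z n t ht
      refine bar_homog_induction (S := fun Y n =>
        (((Bar 𝒴).obj Y Z).gr n).comap (barInclusionApp h𝒳𝒴 Y Z)) ?_ ?_ ht
      · intro Y X a b f hf h hh
        rw [Submodule.mem_comap, barInclusionApp_base]
        exact barBase_mem (X := Set.inclusion h𝒳𝒴 X) hf hh
      · intro Y X a b f hf w hw ih
        rw [Submodule.mem_comap] at ih ⊢
        rw [barInclusionApp_cons]
        exact barCons_mem (X := Set.inclusion h𝒳𝒴 X) hf ih)
    (by
      intro Y' Y Z g t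
      induction t using bar_induction with
      | zero Y => simp
      | add Y s t hs ht => simp only [map_add, hs, ht]
      | base Y X f h =>
        rw [actL_barBase, barInclusionApp_base, barInclusionApp_base]
        exact (actL_barBase (Set.inclusion h𝒳𝒴 X) g f h).symm
      | cons Y X f w ih =>
        rw [actL_barCons, barInclusionApp_cons, barInclusionApp_cons]
        exact (actL_barCons (Set.inclusion h𝒳𝒴 X) g f _).symm)
    (by
      intro Y Z Z' t g
      induction t using bar_induction with
      | zero Y => simp
      | add Y s t hs ht => simp only [map_add, LinearMap.add_apply, hs, ht]
      | base Y X f h =>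
        rw [actR_barBase, barInclusionApp_base, barInclusionApp_base]
        exact (actR_barBase (Set.inclusion h𝒳𝒴 X) g f h).symm
      | cons Y X f w ih =>
        rw [actR_barCons, barInclusionApp_cons, barInclusionApp_cons, ih]
        exact (actR_barCons (Set.inclusion h𝒳𝒴 X) g f _).symm)

theorem barInclusion_base {Y Z : C.Obj} (X : 𝒳) (f : C.Hom Y X) (h : C.Hom X Z) :
    (barInclusion h𝒳𝒴).app Y Z (barBase X f h) = barBase (Set.inclusion h𝒳𝒴 X) f h :=
  barInclusionApp_base h𝒳𝒴 X f h

theorem barInclusion_cons {Y Z : C.Obj} (X : 𝒳) (f : C.Hom Y X) (w : (Bar 𝒳).obj X Z) :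
    (barInclusion h𝒳𝒴).app Y Z (barCons X f w) =
      barCons (Set.inclusion h𝒳𝒴 X) f ((barInclusion h𝒳𝒴).app X Z w) :=
  barInclusionApp_cons h𝒳𝒴 X f w

theorem counit_comp_barInclusion : (counit 𝒴).comp (barInclusion h𝒳𝒴) = counit 𝒳 := by
  ext Y Z t
  rw [BimHom.comp_app]
  induction t using bar_induction with
  | zero Y => simp
  | add Y s t hs ht => simp only [map_add, hs, ht]
  | base Y X f h =>
    rw [barInclusion_base, counit_barBase X]
    exact counit_barBase (Set.inclusion h𝒳𝒴 X) f h
  | cons Y X f w ih =>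
    rw [barInclusion_cons, counit_barCons X]
    exact counit_barCons (Set.inclusion h𝒳𝒴 X) f _

/-- The formula `d_barCons` has the same shape for `𝒳` and `𝒴`, and all its ingredients are
preserved: prefixing, the action, chains `[f, h]`, and the counit. -/
theorem barInclusion_isClosed : (barInclusion h𝒳𝒴).IsClosed := by
  rw [BimHom.isClosed_iff]
  intro Y Z t
  induction t using bar_induction with
  | zero Y => simp
  | add Y s t hs ht => simp only [map_add, hs, ht]
  | base Y X f h =>
    rw [barInclusion_base, d_barBase X, map_add, barInclusion_base, barInclusion_base]
    exact d_barBase (Set.inclusion h𝒳𝒴 X) f h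
  | cons Y X f w ih =>
    rw [barInclusion_cons, d_barCons X, map_sub, map_sub, map_add, barInclusion_cons,
      barInclusion_cons, barInclusion_base, BimHom.app_actL_zero, ← ih,
      ← counit_comp_barInclusion h𝒳𝒴, BimHom.comp_app]
    exact d_barCons (Set.inclusion h𝒳𝒴 X) f _

end inclusion

end

end DGBar

/-! ### The proposition. -/

theorem mainTheorem7 {Γ : Type x} [AddCommGroup Γ] (G : DGBar.Grading Γ) {k : Type y} [CommRing k]
    (C : DGBar.DGCat.{u, v} G k) (𝒳 𝒴 : Set C.Obj) (h𝒳𝒴 : 𝒳 ⊆ 𝒴) :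
    (DGBar.IsCounitalIdempotent (DGBar.Bar 𝒳) (DGBar.counit 𝒳) ∧
      DGBar.IsCounitalIdempotent (DGBar.Bar 𝒴) (DGBar.counit 𝒴) ∧
      DGBar.CounitalLE (DGBar.counit 𝒳) (DGBar.counit 𝒴)) ∧
    ∀ Ξ : DGBar.BimHom 0 (DGBar.Bar 𝒴) (DGBar.Bar 𝒳), Ξ.IsClosed →
      ((DGBar.counit 𝒳).comp Ξ).Homotopic (DGBar.counit 𝒴) → Ξ.IsHomotopyEquiv := by
  have hθ := DGBar.barInclusion_isClosed h𝒳𝒴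
  have hε := DGBar.counit_comp_barInclusion h𝒳𝒴
  refine ⟨⟨DGBar.bar_isCounitalIdempotent 𝒳, DGBar.bar_isCounitalIdempotent 𝒴,
    DGBar.barInclusion h𝒳𝒴, hθ, ?_⟩, ?_⟩
  · rw [hε]
    exact DGBar.BimHom.Homotopic.refl _
  · intro Ξ hΞ h
    refine ⟨hΞ, DGBar.barInclusion h𝒳𝒴, hθ, ?_, ?_⟩
    · refine DGBar.bar_homotopic_id (hθ.comp hΞ) ?_
      -- Regrouping exposes `ε_𝒴 θ`, which equals `ε_𝒳` strictly; what remains is the hypothesis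
      -- `ε_𝒳 Ξ ≃ ε_𝒴`.
      change (((DGBar.counit 𝒴).comp (DGBar.barInclusion h𝒳𝒴)).comp Ξ).Homotopic _
      rwa [hε]
    · refine DGBar.bar_homotopic_id (hΞ.comp hθ) ?_
      -- Precomposing the hypothesis with `θ` gives `ε_𝒳 Ξ θ ≃ ε_𝒴 θ`, and the right side is `ε_𝒳`.
      have := h.comp_right hθ
      rwa [hε] at this
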